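/- **Setting.** Let $\Omega\subset\mathbb R^3$ be a bounded polytopal domain: bounded, open, connected, the interior of its closure, with boundary a finite union of plane polygons. Let $\mathcal T$ be a regular simplicial partition of $\Omega$: finitely many pairwise disjoint open tetrahedra whose closures cover $\overline\Omega$, the closures of any two of them intersecting exactly in the (possibly empty) closed simplex spanned by their common vertices. Let $f$ be a (relatively open) plane face of $\Omega$ with outward unit normal $\nu$, that is, a connected component of the set of those points of a plane $\{\nu\cdot x=c\}$ near which $\Omega$ coincides with the half-space $\{\nu\cdot x<c\}$. Let $\mathcal T_f$ be the set of the nonempty sets among $\operatorname{int}_f(f\cap\overline T)$, $T\in\mathcal T$ (interior relative to $f$). Let $F_f$ be an affine map that restricts to a bijection from $D_f\subset\mathbb R^2$ onto $f$ (so $D_f$ is an open polygon). Let $\mathcal V_f$ and $\mathcal E_f$ be the sets of vertices and edges of $\mathcal T_f$. The shape-regularity constant is $C_{\rm sh}(\mathcal T_f)=\max_{T\in\mathcal T_f}\operatorname{diam}(T)/r_T$, with $r_T$ the radius of the largest disc in $\overline T$. **Spaces** (functions on $f$; for $S_0,\mathrm{RT}_0,\mathrm N_0$ up to null sets). $S_1(\mathcal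 T_f,f)$: functions continuous on $\overline f$ and affine on each $T\in\mathcal T_f$. $S_0(\mathcal T_f,f)$: functions constant on each $T$. $\mathrm{RT}_0(\mathcal T_f,f)$: tangential fields which on each $T$ are of the form $a+cx$ ($a\in\mathbb R^3$, $c\in\mathbb R$), with vanishing jump of $v\cdot n_e$ across each edge $e\subset f$, where $n_e$ is a unit normal of $e$ in the plane of $f$. $\mathrm N_0(\mathcal T_f,f)$: tangential fields which on each $T$ are of the form $a+c\,\nu\times x$, with vanishing jump of $v\times n_e$ across each edge $e\subset f$. **Shape functions.** $\theta^{S_1}_p\in S_1(\mathcal T_f,f)$ with $\theta^{S_1}_p(q)=\delta_{pq}$ for $p,q\in\mathcal V_f$; $\theta^{S_0}_T=\mathbb 1_T$; for $e\in\mathcal E_f$ with adjacent triangles $T_1$ and (if there is a second one) $T_2$, in any chosen order, $\theta^{\mathrm{RT}_0}_e(x)=\frac{|e|}{2|T_1|}(x-a_1)$ on $T_1$, $-\frac{|e|}{2|T_2|}(x-a_2)$ on $T_2$ and $0$ elsewhere, where $a_i$ is the vertex of $T_i$ opposite to $e$; $\theta^{\mathrm N_0}_e=\nu\times\theta^{\mathrm{RT}_0}_e$.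 The index sets are $\mathcal I=\mathcal V_f,\mathcal E_f,\mathcal E_f,\mathcal T_f$ for $\blacklozenge=S_1,\mathrm N_0,\mathrm{RT}_0,S_0$. The values of functions in $\mathrm N_0,\mathrm{RT}_0$ are vectors in $\mathbb R^3$. **Networks.** A network $\Phi$ is a finite sequence of layers $(A_\ell,b_\ell,\varrho_\ell)_{\ell=1}^L$ with realization $x_0=x$, $x_\ell=\varrho_\ell(A_\ell x_{\ell-1}+b_\ell)$ for $\ell<L$, $R(\Phi)(x)=A_Lx_{L-1}+b_L$, where each neuron has its own activation function. The depth is $L(\Phi)=L$ and the size $M(\Phi)$ is the number of nonzero entries of all $A_\ell,b_\ell$. ReLU is $\max\{0,x\}$; BiSU is $0$ for $x\le0$ and $1$ for $x>0$. **Claim.** $\mathcal T_f$ is a regular simplicial partition of $f$, and the functions $\theta_p^{S_1}$ exist and are unique. Moreover, for every $K$ there are $C>0$ and $L_0\in\mathbb N$, depending only on $K$, such that for all $\Omega,\mathcal T,f,F_f$ as above with $C_{\rm sh}(\mathcal T_f)\le K$: 1. For each $\blacklozenge\in\{S_1,\mathrm N_0,\mathrm{RT}_0,S_0\}$ there is a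 network $\Phi^{\blacklozenge,F_f}$ with ReLU and BiSU activations such that $R(\Phi^{\blacklozenge,F_f})(x)_i=\theta^\blacklozenge_i(F_f(x))$ for a.e. $x\in D_f$ and all $i\in\mathcal I$. 2. $L(\Phi^{\blacklozenge,F_f})=5$ if $\blacklozenge\in\{S_1,\mathrm N_0,\mathrm{RT}_0\}$, $L(\Phi^{\blacklozenge,F_f})=3$ if $\blacklozenge=S_0$, and $M(\Phi^{\blacklozenge,F_f})\le C\dim\blacklozenge(\mathcal T_f,f)$. 3. There are networks $\Phi^{\blacklozenge,v,F_f}$, $v\in\blacklozenge(\mathcal T_f,f)$, with ReLU and BiSU activations and satisfying the same depth and size bounds, such that $R(\Phi^{\blacklozenge,v,F_f})=v\circ F_f$ a.e. in $D_f$, and such that the set $\{\Phi^{\blacklozenge,v,F_f}: v\in\blacklozenge(\mathcal T_f,f)\}$ is a real vector space with the linear operation $\Phi^{\blacklozenge,v,F_f}\,\widehat+\,\lambda\Phi^{\blacklozenge,w,F_f}:=\Phi^{\blacklozenge,v+\lambda w,F_f}$. 4. There is a network $\Phi^{CPwL,F_f}$ with only ReLU activations, of depth $L_0$ and size at most $C\dim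 S_1(\mathcal T_f,f)$, such that $R(\Phi^{CPwL,F_f})(x)_i=\theta^{S_1}_i(F_f(x))$ for all $x\in\overline{D_f}$ and all $i\in\mathcal V_f$. 5. There are networks $\Phi^{CPwL,v,F_f}$, $v\in S_1(\mathcal T_f,f)$, with only ReLU activations, of depth $L_0$ and size at most $C\dim S_1(\mathcal T_f,f)$, such that $R(\Phi^{CPwL,v,F_f})=v\circ F_f$ everywhere in $\overline{D_f}$, and such that the set $\{\Phi^{CPwL,v,F_f}: v\in S_1(\mathcal T_f,f)\}$ is a real vector space with the linear operation $\Phi^{CPwL,v,F_f}\,\widehat+\,\lambda\Phi^{CPwL,w,F_f}:=\Phi^{CPwL,v+\lambda w,F_f}$. -/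

import Mathlib

open MeasureTheory Filter Topology Set
open scoped Matrix

noncomputable section

namespace TraceFEM

/-! ### Neural networks -/

/-- Feedforward networks with input dimension `n` and output dimension `m`. A network is either a
single affine output layer, or a hidden layer `(A, b, ϱ)` with `k ≥ 1` neurons, with an activation
function `ϱ i` for each neuron, followed by a network. No activation acts in the output layer. -/
inductive NN : ℕ → ℕ → Type
  | output {n m : ℕ} (A : Matrix (Fin m) (Fin n) ℝ) (b : Fin m → ℝ) : NN n m
  | hidden {n m : ℕ} (k : ℕ) (hk : 0 < k) (A : Matrix (Fin k) (Fin n) ℝ) (b : Fin k → ℝ)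
      (ϱ : Fin k → ℝ → ℝ) (Φ : NN k m) : NN n m

namespace NN

/-- The realization of a network. -/
def realize : {n m : ℕ} → NN n m → (Fin n → ℝ) → Fin m → ℝ
  | _, _, output A b, x => A *ᵥ x + b
  | _, _, hidden _ _ A b ϱ Φ, x => Φ.realize fun i => ϱ i ((A *ᵥ x + b) i)

/-- The number of layers, the output layer included. -/
def depth : {n m : ℕ} → NN n m → ℕ
  | _, _, output _ _ => 1
  | _, _, hidden _ _ _ _ _ Φ => Φ.depth + 1

/-- The number of nonzero entries of all weight matrices and bias vectors. -/
def size : {n m : ℕ} → NN n m → ℕ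
  | _, _, output A b => {p : _ × _ | A p.1 p.2 ≠ 0}.ncard + {i | b i ≠ 0}.ncard
  | _, _, hidden _ _ A b _ Φ =>
      {p : _ × _ | A p.1 p.2 ≠ 0}.ncard + {i | b i ≠ 0}.ncard + Φ.size

/-- All activation functions of the network belong to `S`. -/
def UsesOnly (S : Set (ℝ → ℝ)) : {n m : ℕ} → NN n m → Prop
  | _, _, output _ _ => True
  | _, _, hidden _ _ _ _ ϱ Φ => (∀ i, ϱ i ∈ S) ∧ Φ.UsesOnly S

end NN

/-- The rectified linear unit. -/
def relu : ℝ → ℝ := fun x => max 0 x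

/-- The binary step unit. -/
def bisu : ℝ → ℝ := fun x => if x ≤ 0 then 0 else 1

/-! ### Simplices, meshes, polytopes and their faces -/

/-- Euclidean space. -/
abbrev E (d : ℕ) : Type := EuclideanSpace ℝ (Fin d)

/-- The open convex hull of a finite set: all convex combinations with positive weights. -/
def openHull (s : Finset (E 3)) : Set (E 3) :=
  {x | ∃ w : E 3 → ℝ, (∀ y ∈ s, 0 < w y) ∧ ∑ y ∈ s, w y = 1 ∧ ∑ y ∈ s, w y • y = x}

/-- `s` is the set of vertices of a `k`-simplex. The open simplex is `openHull s`, the closed one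
is `convexHull ℝ s`. -/
def IsSimplex (k : ℕ) (s : Finset (E 3)) : Prop :=
  s.card = k + 1 ∧ AffineIndependent ℝ ((↑) : s → E 3)

/-- Regular partitions of `G` into `k`-simplices; a simplex is given by its vertex set. The
simplices are pairwise disjoint, their closures cover the closure of `G`, and the closures of two of
them intersect in the closed simplex spanned by their common vertices (possibly empty). -/
structure IsRegularPartition (k : ℕ) (𝒯 : Set (Finset (E 3))) (G : Set (E 3)) : Prop where
  finite : 𝒯.Finite
  simplex : ∀ s ∈ 𝒯, IsSimplex k s
  cover : ⋃ s ∈ 𝒯, convexHull ℝ (s : Set (E 3)) = closure G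
  disjoint : ∀ s ∈ 𝒯, ∀ t ∈ 𝒯, s ≠ t → Disjoint (openHull s) (openHull t)
  inter : ∀ s ∈ 𝒯, ∀ t ∈ 𝒯, s ≠ t →
    convexHull ℝ (s : Set (E 3)) ∩ convexHull ℝ (t : Set (E 3)) =
      convexHull ℝ ((s : Set (E 3)) ∩ (t : Set (E 3)))

/-- Vertices of a mesh. -/
def vertices (𝒯 : Set (Finset (E 3))) : Set (E 3) := {p | ∃ t ∈ 𝒯, p ∈ t}

/-- Edges of a mesh, each given by its two endpoints. -/
def edges (𝒯 : Set (Finset (E 3))) : Set (Finset (E 3)) := {e | e.card = 2 ∧ ∃ t ∈ 𝒯, e ⊆ t}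

/-- The radius of the largest ball contained in the closed simplex with vertex set `s`, where balls
are balls of the affine hull of the simplex. -/
def inradius (s : Finset (E 3)) : ℝ :=
  sSup {r | 0 ≤ r ∧ ∃ x ∈ affineSpan ℝ (s : Set (E 3)),
    Metric.closedBall x r ∩ affineSpan ℝ (s : Set (E 3)) ⊆ convexHull ℝ (s : Set (E 3))}

/-- The shape-regularity constant: the maximum over the mesh of diameter over inradius. -/
def shapeRegularity (𝒯 : Set (Finset (E 3))) : ℝ :=
  ⨆ t : 𝒯, Metric.diam (convexHull ℝ ((t : Finset (E 3)) : Set (E 3))) / inradius t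

/-- Bounded polytopal domains of three-dimensional space: bounded, open and connected sets which
are the interior of their closure and whose boundary is a finite union of plane polygons, that is,
of closed triangles. -/
structure IsPolytopalDomain (Ω : Set (E 3)) : Prop where
  isOpen : IsOpen Ω
  isConnected : IsConnected Ω
  isBounded : Bornology.IsBounded Ω
  interior_closure : interior (closure Ω) = Ω
  boundary : ∃ Γs : Set (Finset (E 3)), Γs.Finite ∧ (∀ t ∈ Γs, IsSimplex 2 t) ∧
    frontier Ω = ⋃ t ∈ Γs, convexHull ℝ (t : Set (E 3))

/-- The points of the plane `{x | ⟪ν, x⟫ = c}` near which `Ω` is the open half-space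
`{y | ⟪ν, y⟫ < c}`: the flat boundary points on this plane with outward normal `ν`. -/
def flatPoints (Ω : Set (E 3)) (ν : E 3) (c : ℝ) : Set (E 3) :=
  {x | inner ℝ ν x = c ∧ ∃ r > 0, ∀ y ∈ Metric.ball x r, y ∈ Ω ↔ inner ℝ ν y < c}

/-- `f` is a (relatively open) plane face of `Ω` with outward unit normal `ν`: a connected component
of the set of flat boundary points with normal `ν` on some plane. -/
def IsFace (Ω : Set (E 3)) (ν : E 3) (f : Set (E 3)) : Prop :=
  ‖ν‖ = 1 ∧ ∃ c : ℝ, ∃ x ∈ flatPoints Ω ν c, f = connectedComponentIn (flatPoints Ω ν c) x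

/-- The nonempty sets among the interiors, relative to `f`, of `f ∩ closure T` for `T ∈ 𝒯`. -/
def traceCells (𝒯 : Set (Finset (E 3))) (f : Set (E 3)) : Set (Set (E 3)) :=
  {S | S.Nonempty ∧ ∃ s ∈ 𝒯, S = ((↑) : f → E 3) ''
    interior (((↑) : f → E 3) ⁻¹' convexHull ℝ (s : Set (E 3)))}

/-- The mesh on `f` which `𝒯` leaves there, each triangle being given by its vertex set. -/
def traceMesh (𝒯 : Set (Finset (E 3))) (f : Set (E 3)) : Set (Finset (E 3)) :=
  {t | IsSimplex 2 t ∧ openHull t ∈ traceCells 𝒯 f}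

/-! ### Lowest order finite element spaces on a plane face

Throughout `f` is a plane face with unit normal `ν`, and `𝒯` is a triangular mesh of `f`.
Functions which are determined only up to null sets are represented by the representative that
vanishes outside the union of the open triangles; functions that are defined on the closure of `f`
only are extended by zero. -/

/-- The cross product of `E 3`. -/
def cross (u v : E 3) : E 3 := WithLp.toLp 2 (u.ofLp ⨯₃ v.ofLp)

theorem cross_add_left (u v w : E 3) : cross (u + v) w = cross u w + cross v w := by
  ext i; simp [cross]

theorem cross_add_right (u v w : E 3) : cross u (v + w) = cross u v + cross u w := by
  ext i; simp [cross]

theorem cross_smul_left (c : ℝ) (u v : E 3) : cross (c • u) v = c • cross u v := by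
  ext i; simp [cross]

theorem cross_smul_right (c : ℝ) (u v : E 3) : cross u (c • v) = c • cross u v := by
  ext i; simp [cross]

/-- The union of the open triangles of the mesh. -/
def cells (𝒯 : Set (Finset (E 3))) : Set (E 3) := ⋃ t ∈ 𝒯, openHull t

/-- `n` is a unit normal of the edge `e` within the plane orthogonal to `ν`. -/
def IsEdgeNormal (ν : E 3) (e : Finset (E 3)) (n : E 3) : Prop :=
  ‖n‖ = 1 ∧ inner ℝ n ν = 0 ∧ ∀ p ∈ e, ∀ q ∈ e, inner ℝ n (p - q) = 0

/-- Continuous piecewise affine functions on the closure of `f`. -/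
def S1 (𝒯 : Set (Finset (E 3))) (f : Set (E 3)) : Submodule ℝ (E 3 → ℝ) where
  carrier := {v | (∀ x ∉ closure f, v x = 0) ∧ ContinuousOn v (closure f) ∧
    ∀ t ∈ 𝒯, ∃ g : E 3 →ᵃ[ℝ] ℝ, ∀ x ∈ openHull t, v x = g x}
  zero_mem' := ⟨fun _ _ => rfl, continuousOn_const, fun _ _ => ⟨0, fun _ _ => rfl⟩⟩
  add_mem' := by
    rintro v w ⟨hv0, hvc, hv⟩ ⟨hw0, hwc, hw⟩
    refine ⟨fun x hx => by simp [hv0 x hx, hw0 x hx], hvc.add hwc, fun t ht => ?_⟩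
    obtain ⟨g, hg⟩ := hv t ht
    obtain ⟨h, hh⟩ := hw t ht
    exact ⟨g + h, fun x hx => by simp [hg x hx, hh x hx]⟩
  smul_mem' := by
    rintro c v ⟨hv0, hvc, hv⟩
    refine ⟨fun x hx => by simp [hv0 x hx], hvc.const_smul c, fun t ht => ?_⟩
    obtain ⟨g, hg⟩ := hv t ht
    exact ⟨c • g, fun x hx => by simp [hg x hx]⟩

/-- Piecewise constant functions. -/
def S0 (𝒯 : Set (Finset (E 3))) : Submodule ℝ (E 3 → ℝ) where
  carrier := {v | (∀ x ∉ cells 𝒯, v x = 0) ∧ ∀ t ∈ 𝒯, ∃ c : ℝ, ∀ x ∈ openHull t, v x = c}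
  zero_mem' := ⟨fun _ _ => rfl, fun _ _ => ⟨0, fun _ _ => rfl⟩⟩
  add_mem' := by
    rintro v w ⟨hv0, hv⟩ ⟨hw0, hw⟩
    refine ⟨fun x hx => by simp [hv0 x hx, hw0 x hx], fun t ht => ?_⟩
    obtain ⟨a, ha⟩ := hv t ht
    obtain ⟨b, hb⟩ := hw t ht
    exact ⟨a + b, fun x hx => by simp [ha x hx, hb x hx]⟩
  smul_mem' := by
    rintro c v ⟨hv0, hv⟩
    refine ⟨fun x hx => by simp [hv0 x hx], fun t ht => ?_⟩
    obtain ⟨a, ha⟩ := hv t ht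
    exact ⟨c * a, fun x hx => by simp [ha x hx]⟩

/-- Lowest order Raviart-Thomas fields: tangential fields of the form `a + c x` on each triangle,
such that the jump of the normal component across each edge inside `f` vanishes. -/
def RT0 (𝒯 : Set (Finset (E 3))) (f : Set (E 3)) (ν : E 3) : Submodule ℝ (E 3 → E 3) where
  carrier := {v | (∀ x ∉ cells 𝒯, v x = 0) ∧
    (∀ t ∈ 𝒯, ∃ (a : E 3) (c : ℝ), ∀ x ∈ openHull t, v x = a + c • x ∧ inner ℝ (v x) ν = 0) ∧
    ∀ e ∈ edges 𝒯, openHull e ⊆ f → ∀ n, IsEdgeNormal ν e n → ∀ x ∈ openHull e,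
      Tendsto (fun ε : ℝ => inner ℝ (v (x + ε • n) - v (x - ε • n)) n) (𝓝[>] 0) (𝓝 0)}
  zero_mem' := ⟨fun _ _ => rfl, fun _ _ => ⟨0, 0, fun _ _ => by simp⟩,
    fun _ _ _ _ _ _ _ => by simp⟩
  add_mem' := by
    rintro v w ⟨hv0, hv, hvj⟩ ⟨hw0, hw, hwj⟩
    refine ⟨fun x hx => by simp [hv0 x hx, hw0 x hx], fun t ht => ?_, fun e he hef n hn x hx => ?_⟩
    · obtain ⟨a, c, h⟩ := hv t ht
      obtain ⟨a', c', h'⟩ := hw t ht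
      refine ⟨a + a', c + c', fun x hx => ⟨?_, ?_⟩⟩
      · rw [Pi.add_apply, (h x hx).1, (h' x hx).1, add_smul]; abel
      · rw [Pi.add_apply, inner_add_left, (h x hx).2, (h' x hx).2, add_zero]
    · have := (hvj e he hef n hn x hx).add (hwj e he hef n hn x hx)
      rw [add_zero] at this
      refine this.congr fun ε => ?_
      rw [← inner_add_left]
      congr 1
      simp only [Pi.add_apply]
      abel
  smul_mem' := by
    rintro k v ⟨hv0, hv, hvj⟩
    refine ⟨fun x hx => by simp [hv0 x hx], fun t ht => ?_, fun e he hef n hn x hx => ?_⟩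
    · obtain ⟨a, c, h⟩ := hv t ht
      refine ⟨k • a, k * c, fun x hx => ⟨?_, ?_⟩⟩
      · rw [Pi.smul_apply, (h x hx).1, smul_add, mul_smul]
      · rw [Pi.smul_apply, real_inner_smul_left, (h x hx).2, mul_zero]
    · have := (hvj e he hef n hn x hx).const_mul k
      rw [mul_zero] at this
      refine this.congr fun ε => ?_
      rw [← real_inner_smul_left, smul_sub]
      rfl

/-- Lowest order Nédélec fields: tangential fields of the form `a + c (ν × x)` on each triangle
(`ν ×` being the rotation by a right angle in the plane of `f`), such that the jump of the
tangential component across each edge inside `f` vanishes. -/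
def N0 (𝒯 : Set (Finset (E 3))) (f : Set (E 3)) (ν : E 3) : Submodule ℝ (E 3 → E 3) where
  carrier := {v | (∀ x ∉ cells 𝒯, v x = 0) ∧
    (∀ t ∈ 𝒯, ∃ (a : E 3) (c : ℝ), ∀ x ∈ openHull t,
      v x = a + c • cross ν x ∧ inner ℝ (v x) ν = 0) ∧
    ∀ e ∈ edges 𝒯, openHull e ⊆ f → ∀ n, IsEdgeNormal ν e n → ∀ x ∈ openHull e,
      Tendsto (fun ε : ℝ => cross (v (x + ε • n) - v (x - ε • n)) n) (𝓝[>] 0) (𝓝 0)}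
  zero_mem' := ⟨fun _ _ => rfl, fun _ _ => ⟨0, 0, fun _ _ => by simp⟩,
    fun _ _ _ _ _ _ _ => by simp [cross]⟩
  add_mem' := by
    rintro v w ⟨hv0, hv, hvj⟩ ⟨hw0, hw, hwj⟩
    refine ⟨fun x hx => by simp [hv0 x hx, hw0 x hx], fun t ht => ?_, fun e he hef n hn x hx => ?_⟩
    · obtain ⟨a, c, h⟩ := hv t ht
      obtain ⟨a', c', h'⟩ := hw t ht
      refine ⟨a + a', c + c', fun x hx => ⟨?_, ?_⟩⟩
      · rw [Pi.add_apply, (h x hx).1, (h' x hx).1, add_smul]; abel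
      · rw [Pi.add_apply, inner_add_left, (h x hx).2, (h' x hx).2, add_zero]
    · have := (hvj e he hef n hn x hx).add (hwj e he hef n hn x hx)
      rw [add_zero] at this
      refine this.congr fun ε => ?_
      rw [← cross_add_left]
      congr 1
      simp only [Pi.add_apply]
      abel
  smul_mem' := by
    rintro k v ⟨hv0, hv, hvj⟩
    refine ⟨fun x hx => by simp [hv0 x hx], fun t ht => ?_, fun e he hef n hn x hx => ?_⟩
    · obtain ⟨a, c, h⟩ := hv t ht
      refine ⟨k • a, k * c, fun x hx => ⟨?_, ?_⟩⟩
      · rw [Pi.smul_apply, (h x hx).1, smul_add, mul_smul]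
      · rw [Pi.smul_apply, real_inner_smul_left, (h x hx).2, mul_zero]
    · have := (hvj e he hef n hn x hx).const_smul k
      rw [smul_zero] at this
      refine this.congr fun ε => ?_
      rw [← cross_smul_left, smul_sub]
      rfl

/-! ### Shape functions -/

/-- The family of nodal basis functions: `θ p` is in `S1`, equal to `1` at `p` and to `0` at the
other vertices. -/
def IsNodal {𝒯 : Set (Finset (E 3))} {f : Set (E 3)} (θ : vertices 𝒯 → S1 𝒯 f) : Prop :=
  ∀ p q : vertices 𝒯, (θ p : E 3 → ℝ) q = Set.indicator {p} (fun _ => (1 : ℝ)) q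

/-- The indicator function of the open triangle `t`. -/
def shapeS0 (t : Finset (E 3)) : E 3 → ℝ := (openHull t).indicator fun _ => 1

/-- The `k`-dimensional Lebesgue measure of a `k`-simplex. -/
def simplexVol (k : ℕ) (s : Finset (E 3)) : ℝ := (μHE[k] (openHull s)).toReal

open Classical in
/-- The Raviart-Thomas shape function of the edge `e`: on each triangle `T` with edge `e` and
opposite vertex `a` it is `± |e| / (2 |T|) (x - a)`, with the sign `+` on the first triangle `t₁` and
`-` on the second triangle, if there is one. -/
def shapeRT0 (𝒯 : Set (Finset (E 3))) (e t₁ : Finset (E 3)) (x : E 3) : E 3 :=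
  ∑ᶠ a ∈ {a : E 3 | a ∉ e ∧ insert a e ∈ 𝒯}, (openHull (insert a e)).indicator
    (fun y => ((if insert a e = t₁ then 1 else -1) *
      (simplexVol 1 e / (2 * simplexVol 2 (insert a e)))) • (y - a)) x

/-- The Nédélec shape function: the Raviart-Thomas one rotated by a right angle in the plane of the
face. With `t_e = ν × n_e` this says `θ^N · t_e = θ^RT · n_e` and `θ^N · n_e = - θ^RT · t_e`. -/
def shapeN0 (ν : E 3) (𝒯 : Set (Finset (E 3))) (e t₁ : Finset (E 3)) (x : E 3) : E 3 :=
  cross ν (shapeRT0 𝒯 e t₁ x)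

/-! ### Emulation

The statements below come in two kinds: almost everywhere in `D`, with `l` the filter of conull sets,
and everywhere in the closure of `D`, with `l` the principal filter. Values in `W` are given by the
`μ` coordinates `coord`. -/

/-- The single coordinate of a real number. -/
def scalarCoord (y : ℝ) : Fin 1 → ℝ := fun _ => y

/-- The three coordinates of a vector. -/
def vectorCoord (y : E 3) : Fin 3 → ℝ := y.ofLp

/-- Whatever the enumeration of the finite index set, some network with activations in `S`, depth `L`
and size at most `M` outputs in parallel all the functions `θ i ∘ F`. -/
def EmulatesFamily (S : Set (ℝ → ℝ)) (L : ℕ) (M : ℝ) (l : Filter (E 2)) (F : E 2 → E 3)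
    {W : Type} {μ : ℕ} (coord : W → Fin μ → ℝ) {ι : Type} (θ : ι → E 3 → W) : Prop :=
  ∀ (N : ℕ) (enum : ι ≃ Fin N), ∃ Φ : NN 2 (N * μ),
    Φ.UsesOnly S ∧ Φ.depth = L ∧ (Φ.size : ℝ) ≤ M ∧
    ∀ᶠ x in l, ∀ i j, Φ.realize x.ofLp (finProdFinEquiv (enum i, j)) = coord (θ i (F x)) j

/-- There are networks `Φ v`, for all `v ∈ X`, with activations in `S`, depth `L` and size at most
`M`, such that `Φ v` realizes `v ∘ F`, and such that the set `{Φ v | v ∈ X}` is a real vector space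
with the linear operation `Φ v + c Φ w := Φ (v + c w)`. -/
def EmulatesSpace (S : Set (ℝ → ℝ)) (L : ℕ) (M : ℝ) (l : Filter (E 2)) (F : E 2 → E 3)
    {W : Type} [AddCommGroup W] [Module ℝ W] {μ : ℕ} (coord : W → Fin μ → ℝ)
    (X : Submodule ℝ (E 3 → W)) : Prop :=
  ∃ Φ : X → NN 2 μ,
    (∀ v : X, (Φ v).UsesOnly S ∧ (Φ v).depth = L ∧ ((Φ v).size : ℝ) ≤ M ∧
      ∀ᶠ x in l, (Φ v).realize x.ofLp = coord ((v : E 3 → W) (F x))) ∧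
    ∃ (_ : AddCommGroup (Set.range Φ)) (_ : Module ℝ (Set.range Φ)), ∀ (v w : X) (c : ℝ),
      Set.rangeFactorization Φ v + c • Set.rangeFactorization Φ w =
        Set.rangeFactorization Φ (v + c • w)

end TraceFEM

end

noncomputable section

namespace TraceFEM

/-! ### Networks computing scalar functions -/

/-! With step units everything is done triangle by triangle. In the plane of the face an open
triangle is the set where its three barycentric coordinates are positive, so three step units, and a
fourth one testing whether all of them fire, produce its indicator `χ`. Multiplying `χ` by a
constant is a matter of the output layer. Multiplying it by an affine `g` with `|g| ≤ κ` is possible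
because `g χ = relu (g + κ (2 χ - 1)) - κ χ`. The size counts nonzero entries and not their
magnitude, so each such piece has a size bounded by an absolute constant. Off the edges, hence
almost everywhere, every shape function and every element of the spaces is a sum of such pieces.
Running them in parallel and adding in the output layer costs a multiple of the number of triangles,
since a triangle meets at most three shape functions of each family.

It remains to compare the number of triangles with the dimensions. For `S0` they agree. A
Raviart-Thomas field has three parameters per triangle and one condition per interior edge; an
interior edge has two triangles and a triangle three edges, so the dimension is at least `3 T - 3 T
/ 2 ≥ T` (`ncard_le_finrank_RT0`). Rotation by a right angle embeds `RT0` into `N0`. The dimension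
of `S1` is the number of vertices, and there are at most `N` times as many triangles if no vertex
has more than `N` of them. Such an `N` depends only on `K`, by a packing argument
(`exists_valence_le`).

With ReLU alone, the nodal function of `p` is the maximum of `0` and of one function `a - relu b -
relu d` for each triangle `t` at `p`. This function equals the nodal function on `t` and lies below
it on the whole closed face (`exists_hat`). The reason is that two triangles of the mesh are
separated by an affine function vanishing exactly at their common vertices, among all their vertices
(`exists_affine_separating`). No convexity of the patch around `p` is needed, and a maximum of at
most `N` such terms has depth and size depending only on `N`.

That the trace is a regular mesh rests on the fact that a tetrahedron covering a piece of a plane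
face has a facet there, and that the open facet consists of flat points and hence lies in the face
(`traceCells_facet`, `isFaceMesh_traceMesh`). Finally, a network realizing `v` determines `v`, so
the vector space structure can be transported to the set of networks (`exists_module_range`). -/

theorem NN.one_le_depth : ∀ {n m : ℕ} (Φ : NN n m), 1 ≤ Φ.depth
  | _, _, .output _ _ => le_rfl
  | _, _, .hidden _ _ _ _ _ Φ => by simp [NN.depth]

theorem NN.exists_eq_output {n m : ℕ} (Φ : NN n m) (h : Φ.depth = 1) :
    ∃ A b, Φ = .output A b := by
  cases Φ with
  | output A b => exact ⟨A, b, rfl⟩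
  | hidden k hk A b ϱ Φ =>
    have := Φ.one_le_depth
    simp only [NN.depth] at h
    omega

theorem NN.exists_eq_hidden {n m L : ℕ} (Φ : NN n m) (h : Φ.depth = L + 2) :
    ∃ k hk A b ϱ, ∃ Ψ : NN k m, Φ = .hidden k hk A b ϱ Ψ ∧ Ψ.depth = L + 1 := by
  cases Φ with
  | output A b => simp [NN.depth] at h
  | hidden k hk A b ϱ Φ =>
    refine ⟨k, hk, A, b, ϱ, Φ, rfl, ?_⟩
    simp only [NN.depth] at h
    omega

/-- The number of nonzero entries of an affine layer. -/
def nnz {n m : ℕ} (A : Matrix (Fin m) (Fin n) ℝ) (b : Fin m → ℝ) : ℕ :=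
  {p : _ × _ | A p.1 p.2 ≠ 0}.ncard + {i | b i ≠ 0}.ncard

/-- The affine layer that applies the layers `(A u, b u)` in parallel, the inputs being distributed
by `e` and the outputs being added along `o`. -/
theorem exists_parallel_layer {U : Type} [Fintype U] (n k : U → ℕ) (N m : ℕ)
    (e : (Σ u, Fin (n u)) → Fin N) (o : (Σ u, Fin (k u)) → Fin m)
    (A : ∀ u, Matrix (Fin (k u)) (Fin (n u)) ℝ) (b : ∀ u, Fin (k u) → ℝ) :
    ∃ (B : Matrix (Fin m) (Fin N) ℝ) (c : Fin m → ℝ), nnz B c ≤ ∑ u, nnz (A u) (b u) ∧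
      ∀ (x : Fin N → ℝ) j, (B *ᵥ x + c) j = ∑ r : Σ u, Fin (k u),
        if o r = j then (A r.1 *ᵥ (fun i => x (e ⟨r.1, i⟩)) + b r.1) r.2 else 0 := by
  classical
  refine ⟨fun j l => ∑ r : Σ u, Fin (k u), ∑ i : Fin (n r.1),
    if o r = j ∧ e ⟨r.1, i⟩ = l then A r.1 r.2 i else 0,
    fun j => ∑ r : Σ u, Fin (k u), if o r = j then b r.1 r.2 else 0, ?_, fun x j => ?_⟩
  · unfold nnz
    rw [Finset.sum_add_distrib]
    refine Nat.add_le_add ?_ ?_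
    · refine le_trans (Set.ncard_le_ncard (t := ⋃ u, (fun q : Fin (k u) × Fin (n u) =>
        (o ⟨u, q.1⟩, e ⟨u, q.2⟩)) '' {q | A u q.1 q.2 ≠ 0}) ?_ (Set.toFinite _)) ?_
      · rintro ⟨j, l⟩ h
        obtain ⟨⟨u, r⟩, -, h⟩ := Finset.exists_ne_zero_of_sum_ne_zero h
        obtain ⟨i, -, h⟩ := Finset.exists_ne_zero_of_sum_ne_zero h
        rw [ite_ne_right_iff] at h
        exact mem_iUnion.2 ⟨u, ⟨r, i⟩, h.2, Prod.ext h.1.1 h.1.2⟩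
      · exact (Set.ncard_iUnion_le_of_fintype _).trans
          (Finset.sum_le_sum fun u _ => Set.ncard_image_le (Set.toFinite _))
    · refine le_trans (Set.ncard_le_ncard (t := ⋃ u, (fun q : Fin (k u) => o ⟨u, q⟩) ''
        {q | b u q ≠ 0}) ?_ (Set.toFinite _)) ?_
      · intro j h
        obtain ⟨⟨u, r⟩, -, h⟩ := Finset.exists_ne_zero_of_sum_ne_zero h
        rw [ite_ne_right_iff] at h
        exact mem_iUnion.2 ⟨u, r, h.2, h.1⟩
      · exact (Set.ncard_iUnion_le_of_fintype _).trans
          (Finset.sum_le_sum fun u _ => Set.ncard_image_le (Set.toFinite _))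
  · simp only [Pi.add_apply, Matrix.mulVec, dotProduct, Finset.sum_mul]
    rw [Finset.sum_comm, ← Finset.sum_add_distrib]
    refine Finset.sum_congr rfl fun r _ => ?_
    rw [Finset.sum_comm]
    by_cases h : o r = j
    · simp [h]
    · simp [h]

/-- Networks of equal depth run side by side with block-diagonal hidden layers, and the sums along
`o` are absorbed by the output layer, so neither depth nor size is lost. The map `e` is arbitrary
because the induction needs two cases: at the input the networks may share variables, while in later
layers each one reads its own block of neurons. -/
theorem exists_parallel (S : Set (ℝ → ℝ)) {U : Type} [Fintype U] [Nonempty U] (m : ℕ)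
    (o : U → Fin m) (L : ℕ) : ∀ (n : U → ℕ) (N : ℕ) (e : (Σ u, Fin (n u)) → Fin N)
    (Φ : ∀ u, NN (n u) 1), (∀ u, (Φ u).UsesOnly S) → (∀ u, (Φ u).depth = L + 1) →
    ∃ Ψ : NN N m, Ψ.UsesOnly S ∧ Ψ.depth = L + 1 ∧ Ψ.size ≤ ∑ u, (Φ u).size ∧
      ∀ x j, Ψ.realize x j =
        ∑ u, if o u = j then (Φ u).realize (fun i => x (e ⟨u, i⟩)) 0 else 0 := by
  induction L with
  | zero =>
    intro n N e Φ hS hL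
    choose A b h using fun u => (Φ u).exists_eq_output (hL u)
    obtain rfl : Φ = fun u => .output (A u) (b u) := funext h
    obtain ⟨B, c, hBc, hr⟩ := exists_parallel_layer n (fun _ => 1) N m e (fun r => o r.1) A b
    refine ⟨.output B c, trivial, rfl, hBc, fun x j => ?_⟩
    simp only [NN.realize]
    rw [hr, Fintype.sum_sigma]
    simp
  | succ L ih =>
    intro n N e Φ hS hL
    choose k hk A b ϱ Ψ h hΨ using fun u => (Φ u).exists_eq_hidden (hL u)
    obtain rfl : Φ = fun u => .hidden (k u) (hk u) (A u) (b u) (ϱ u) (Ψ u) := funext h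
    let ε := Fintype.equivFin (Σ u, Fin (k u))
    obtain ⟨Ψ', h1, h2, h3, h4⟩ := ih k _ ε Ψ (fun u => (show (∀ i, ϱ u i ∈ S) ∧ (Ψ u).UsesOnly S from hS u).2) hΨ
    obtain ⟨B, c, hBc, hr⟩ := exists_parallel_layer n k N _ e ε A b
    have : Nonempty (Σ u, Fin (k u)) := ⟨⟨Classical.arbitrary U, ⟨0, hk _⟩⟩⟩
    have hS' : ∀ u, (∀ i, ϱ u i ∈ S) ∧ (Ψ u).UsesOnly S := hS
    let act : (Σ u, Fin (k u)) → ℝ → ℝ := fun r => ϱ r.1 r.2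
    refine ⟨.hidden _ Fintype.card_pos B c (fun i => act (ε.symm i)) Ψ',
      ⟨fun i => (hS' _).1 _, h1⟩, by simp [NN.depth, h2], ?_, fun x j => ?_⟩
    · simp only [NN.size]
      rw [Finset.sum_add_distrib]
      exact Nat.add_le_add hBc h3
    · simp only [NN.realize, h4]
      refine Finset.sum_congr rfl fun u _ => ?_
      refine if_congr Iff.rfl (congrFun (congrArg _ (funext fun i => ?_)) _) rfl
      -- Since `ε` is injective, each hidden neuron receives a single summand: the blocks do not
      -- mix.
      rw [hr, ε.symm_apply_apply, Finset.sum_eq_single ⟨u, i⟩]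
      · simp [act]
      · intro r _ hne
        exact if_neg fun h => hne (ε.injective h)
      · simp

/-- Some network with activations in `S`, depth `L` and size at most `M` computes `g`. -/
def Emulates (S : Set (ℝ → ℝ)) {n : ℕ} (L M : ℕ) (g : (Fin n → ℝ) → ℝ) : Prop :=
  ∃ Φ : NN n 1, Φ.UsesOnly S ∧ Φ.depth = L ∧ Φ.size ≤ M ∧ ∀ x, Φ.realize x 0 = g x

namespace Emulates

variable {S : Set (ℝ → ℝ)} {n L M M' : ℕ} {g g' : (Fin n → ℝ) → ℝ}

theorem mono (h : Emulates S L M g) (hM : M ≤ M') : Emulates S L M' g := by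
  obtain ⟨Φ, h1, h2, h3, h4⟩ := h
  exact ⟨Φ, h1, h2, h3.trans hM, h4⟩

theorem one_le (h : Emulates S L M g) : 1 ≤ L := by
  obtain ⟨Φ, h1, h2, h3, h4⟩ := h
  exact h2 ▸ Φ.one_le_depth

theorem parallel {U : Type} [Fintype U] [Nonempty U] (m : ℕ) (o : U → Fin m)
    {g : U → (Fin n → ℝ) → ℝ} (h : ∀ u, Emulates S L M (g u)) :
    ∃ Ψ : NN n m, Ψ.UsesOnly S ∧ Ψ.depth = L ∧ Ψ.size ≤ Fintype.card U * M ∧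
      ∀ x j, Ψ.realize x j = ∑ u, if o u = j then g u x else 0 := by
  obtain ⟨L, rfl⟩ := Nat.exists_eq_add_of_le' (h (Classical.arbitrary U)).one_le
  choose Φ h1 h2 h3 h4 using h
  obtain ⟨Ψ, g1, g2, g3, g4⟩ := exists_parallel S m o L (fun _ => n) n (fun r => r.2) Φ h1 h2
  refine ⟨Ψ, g1, g2, g3.trans ?_, fun x j => ?_⟩
  · exact (Finset.sum_le_card_nsmul _ _ M fun u _ => h3 u).trans (by simp)
  · rw [g4]
    simp [h4]

theorem add (h : Emulates S L M g) (h' : Emulates S L M' g') :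
    Emulates S L (M + M') fun x => g x + g' x := by
  obtain ⟨L, rfl⟩ := Nat.exists_eq_add_of_le' h.one_le
  obtain ⟨Φ, h1, h2, h3, h4⟩ := h
  obtain ⟨Φ', h1', h2', h3', h4'⟩ := h'
  obtain ⟨Ψ, g1, g2, g3, g4⟩ := exists_parallel S 1 (fun _ : Bool => 0) L (fun _ => n) n
    (fun r => r.2) (fun b => if b then Φ else Φ') (by simp [h1, h1']) (by simp [h2, h2'])
  refine ⟨Ψ, g1, g2, ?_, fun x => ?_⟩
  · simp only [Fintype.sum_bool, if_true] at g3
    exact g3.trans (Nat.add_le_add h3 h3')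
  · simp [g4, h4, h4']

/-- Only the output layer changes, and the shift creates at most one new bias per output. -/
theorem affine_comp_aux (c d : ℝ) : ∀ {n m : ℕ} (Φ : NN n m), Φ.UsesOnly S →
    ∃ Ψ : NN n m, Ψ.UsesOnly S ∧ Ψ.depth = Φ.depth ∧ Ψ.size ≤ Φ.size + m ∧
      ∀ x j, Ψ.realize x j = c * Φ.realize x j + d
  | n, m, .output A b, _ => by
    refine ⟨.output (c • A) (fun i => c * b i + d), by simp [NN.UsesOnly], rfl, ?_, fun x j => ?_⟩
    · have h1 := Set.ncard_le_ncard (s := {p : Fin m × Fin n | (c • A) p.1 p.2 ≠ 0})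
        (t := {p | A p.1 p.2 ≠ 0}) (fun p hp h => hp (by simp [h])) (Set.toFinite _)
      have h2 : {i : Fin m | c * b i + d ≠ 0}.ncard ≤ m := by
        simpa using Set.ncard_le_card {i : Fin m | c * b i + d ≠ 0}
      simp only [NN.size]
      omega
    · simp only [NN.realize, Matrix.smul_mulVec, Pi.add_apply, Pi.smul_apply, smul_eq_mul]
      ring
  | n, m, .hidden k hk A b ϱ Φ, h => by
    obtain ⟨Ψ, h1, h2, h3, h4⟩ := affine_comp_aux c d Φ h.2
    refine ⟨.hidden k hk A b ϱ Ψ, ⟨h.1, h1⟩, by simp [NN.depth, h2], ?_, fun x j => ?_⟩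
    · simp only [NN.size]
      omega
    · simp [NN.realize, h4]

theorem affine_comp (h : Emulates S L M g) (c d : ℝ) :
    Emulates S L (M + 1) fun x => c * g x + d := by
  obtain ⟨Φ, h1, h2, h3, h4⟩ := h
  obtain ⟨Ψ, g1, g2, g3, g4⟩ := affine_comp_aux c d Φ h1
  exact ⟨Ψ, g1, g2.trans h2, g3.trans (by omega), fun x => by rw [g4, h4]⟩

/-- The output layer becomes a hidden one, and an identity matrix with `m` nonzero entries follows
it. -/
theorem activation_aux {ϱ : ℝ → ℝ} (hϱ : ϱ ∈ S) : ∀ {n m : ℕ} (_ : 0 < m) (Φ : NN n m),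
    Φ.UsesOnly S → ∃ Ψ : NN n m, Ψ.UsesOnly S ∧ Ψ.depth = Φ.depth + 1 ∧ Ψ.size ≤ Φ.size + m ∧
      ∀ x j, Ψ.realize x j = ϱ (Φ.realize x j)
  | n, m, hm, .output A b, _ => by
    refine ⟨.hidden m hm A b (fun _ => ϱ) (.output 1 0), ⟨fun _ => hϱ, trivial⟩, rfl, ?_,
      fun x j => ?_⟩
    · simp only [NN.size, Pi.zero_apply, ne_eq, not_true_eq_false, Set.ofPred_false, ncard_empty,
        add_zero]
      refine Nat.add_le_add_left ?_ _
      refine (Set.ncard_le_ncard (t := (fun i => (i, i)) '' (univ : Set (Fin m))) ?_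
        (Set.toFinite _)).trans ?_
      · rintro ⟨i, j⟩ h
        by_cases hij : i = j
        · exact ⟨i, mem_univ _, by rw [hij]⟩
        · exact absurd (Matrix.one_apply_ne hij) h
      · refine (Set.ncard_image_le (Set.toFinite _)).trans ?_
        simp [Set.ncard_univ]
    · simp [NN.realize]
  | n, m, hm, .hidden k hk A b ϱ Φ, h => by
    obtain ⟨Ψ, h1, h2, h3, h4⟩ := activation_aux hϱ hm Φ h.2
    refine ⟨.hidden k hk A b ϱ Ψ, ⟨h.1, h1⟩, by simp [NN.depth, h2], ?_, fun x j => ?_⟩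
    · simp only [NN.size]
      omega
    · simp [NN.realize, h4]

theorem activation (h : Emulates S L M g) {ϱ : ℝ → ℝ} (hϱ : ϱ ∈ S) :
    Emulates S (L + 1) (M + 1) fun x => ϱ (g x) := by
  obtain ⟨Φ, h1, h2, h3, h4⟩ := h
  obtain ⟨Ψ, g1, g2, g3, g4⟩ := activation_aux hϱ one_pos Φ h1
  exact ⟨Ψ, g1, by rw [g2, h2], g3.trans (by omega), fun x => by rw [g4, h4]⟩

theorem affine (a : (Fin n → ℝ) →ᵃ[ℝ] ℝ) : Emulates S 1 (n + 1) a := by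
  refine ⟨.output (fun _ i => a.linear (Pi.single i 1)) fun _ => a 0, trivial, rfl, ?_,
    fun x => ?_⟩
  · simp only [NN.size]
    refine Nat.add_le_add ((Set.ncard_le_card _).trans (by simp)) ((Set.ncard_le_card _).trans ?_)
    simp
  · have h : a x = a.linear x + a 0 := by
      have := a.map_vadd 0 x
      simpa using this
    rw [h]
    simp only [NN.realize, Pi.add_apply, Matrix.mulVec, dotProduct, add_left_inj]
    conv_rhs => rw [← Finset.univ_sum_single x, map_sum]
    refine Finset.sum_congr rfl fun i _ => ?_
    have : (Pi.single i (x i) : Fin n → ℝ) = x i • Pi.single i 1 := by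
      rw [← Pi.single_smul]; simp
    rw [this, map_smul, smul_eq_mul, mul_comm]

/-- The identity `y = relu y - relu (-y)` carries a value through one more layer. This equalizes
depths before networks are added. -/
theorem pad (hS : relu ∈ S) (h : Emulates S L M g) : Emulates S (L + 1) (2 * M + 4) g := by
  have h1 := h.activation hS
  have h2 := ((h.affine_comp (-1) 0).activation hS).affine_comp (-1) 0
  refine ((h1.add h2).mono (by omega) : Emulates S (L + 1) (2 * M + 4) _) |> fun H => ?_
  convert H using 2 with x
  simp only [relu]
  rcases le_total 0 (g x) with h | h
  · rw [max_eq_right h, max_eq_left (by linarith)]; ring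
  · rw [max_eq_left h, max_eq_right (by linarith)]; ring

theorem exists_pad (hS : relu ∈ S) (n L M k : ℕ) : ∃ M', ∀ g : (Fin n → ℝ) → ℝ,
    Emulates S L M g → Emulates S (L + k) M' g := by
  induction k with
  | zero => exact ⟨M, fun g h => h⟩
  | succ k ih =>
    obtain ⟨M', h⟩ := ih
    exact ⟨_, fun g hg => (h g hg).pad hS⟩

end Emulates

end TraceFEM

/-! ### Networks for indicators, cut-off affine functions and maxima -/

namespace TraceFEM

theorem bisu_of_pos {x : ℝ} (h : 0 < x) : bisu x = 1 := if_neg (not_le.2 h)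

theorem bisu_of_nonpos {x : ℝ} (h : x ≤ 0) : bisu x = 0 := if_pos h

open Classical in
-- A sum of three step units exceeds `5/2` only if all three fire, and a fourth step unit tests
-- this.
theorem exists_emulates_indicator (n : ℕ) : ∃ M, ∀ a : Fin 3 → (Fin n → ℝ) →ᵃ[ℝ] ℝ,
    Emulates {relu, bisu} 3 M fun x => if ∀ i, 0 < a i x then 1 else 0 := by
  refine ⟨3 * n + 8, fun a => ?_⟩
  have hS : bisu ∈ ({relu, bisu} : Set (ℝ → ℝ)) := by simp
  have h := fun i => (Emulates.affine (S := {relu, bisu}) (a i)).activation hS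
  have H := ((((h 0).add (h 1)).add (h 2)).affine_comp 1 (-(5 / 2))).activation hS
  convert H.mono (M' := 3 * n + 8) (by omega) using 2 with x
  by_cases h0 : 0 < a 0 x
  · by_cases h1 : 0 < a 1 x
    · by_cases h2 : 0 < a 2 x
      · simp [Fin.forall_fin_succ, h0, h1, h2, bisu_of_pos]
        rw [bisu_of_pos (by norm_num)]
      · simp [Fin.forall_fin_succ, h0, h1, h2, bisu_of_pos, bisu_of_nonpos (not_lt.1 h2)]
        rw [bisu_of_nonpos (by norm_num)]
    · have : bisu (a 2 x) ≤ 1 := by unfold bisu; split_ifs <;> norm_num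
      simp [Fin.forall_fin_succ, h0, h1, bisu_of_pos, bisu_of_nonpos (not_lt.1 h1)]
      rw [bisu_of_nonpos (by linarith)]
  · have : bisu (a 2 x) ≤ 1 := by unfold bisu; split_ifs <;> norm_num
    have : bisu (a 1 x) ≤ 1 := by unfold bisu; split_ifs <;> norm_num
    simp [Fin.forall_fin_succ, h0, bisu_of_nonpos (not_lt.1 h0)]
    rw [bisu_of_nonpos (by linarith)]

open Classical in
theorem exists_emulates_indicator_mul_const (n : ℕ) : ∃ M,
    ∀ (a : Fin 3 → (Fin n → ℝ) →ᵃ[ℝ] ℝ) (c : ℝ),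
    Emulates {relu, bisu} 3 M fun x => if ∀ i, 0 < a i x then c else 0 := by
  obtain ⟨M, hM⟩ := exists_emulates_indicator n
  refine ⟨M + 1, fun a c => ?_⟩
  convert (hM a).affine_comp c 0 using 2 with x
  split_ifs <;> simp

open Classical in
-- With `χ` the indicator, `relu (g + κ (2 χ - 1)) - κ χ` is `(g + κ) - κ` where `χ = 1`, and `0`
-- where `χ = 0`, because `-κ ≤ g ≤ κ`. The bound `κ` affects only the magnitude of the weights, so
-- `M` does not depend on it.
theorem exists_emulates_indicator_mul_affine (n : ℕ) : ∃ M,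
    ∀ (a : Fin 3 → (Fin n → ℝ) →ᵃ[ℝ] ℝ) (g : (Fin n → ℝ) →ᵃ[ℝ] ℝ) (κ : ℝ),
    ∃ h, Emulates {relu, bisu} 5 M h ∧
      ∀ x, |g x| ≤ κ → h x = if ∀ i, 0 < a i x then g x else 0 := by
  obtain ⟨M, hM⟩ := exists_emulates_indicator n
  have hS : relu ∈ ({relu, bisu} : Set (ℝ → ℝ)) := by simp
  refine ⟨20 * n + 20 * M + 100, fun a g κ =>
    ⟨fun x => relu (g x + (2 * κ * (if ∀ i, 0 < a i x then 1 else 0) + -κ)) +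
      (-κ * (if ∀ i, 0 < a i x then 1 else 0) + 0), ?_, fun x hx => ?_⟩⟩
  -- The affine map is padded to the depth 3 of the indicator; the formula then has depth 4, and the
  -- last `pad` brings it to 5.
  · refine Emulates.mono ((((((Emulates.affine g).pad hS).pad hS).add ((hM a).affine_comp (2 * κ) (-κ))).activation
      hS |>.add (((hM a).affine_comp (-κ) 0).pad hS)).pad hS) (by omega)
  · obtain ⟨h1, h2⟩ := abs_le.1 hx
    by_cases hp : ∀ i, 0 < a i x
    · simp only [relu, if_pos hp]
      rw [max_eq_right (by linarith)]
      ring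
    · simp only [relu, if_neg hp]
      rw [max_eq_left (by linarith)]
      ring

/-- This is a running maximum built from `max h φ = φ + relu (h - φ)`, with one more layer for each
term. Depth and size depend on `n` and `N` only. The form of the terms is that of the functions in
`exists_hat`, whose maximum with `0` is a nodal function. -/
theorem exists_emulates_max (n N : ℕ) : ∃ L M, ∀ a b c : Fin N → (Fin n → ℝ) →ᵃ[ℝ] ℝ, ∃ h,
    Emulates {relu} L M h ∧ ∀ x, IsGreatest
      (insert 0 (range fun i => a i x - relu (b i x) - relu (c i x))) (h x) := by
  have hS : relu ∈ ({relu} : Set (ℝ → ℝ)) := rfl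
  -- A single term already needs two layers, hence the offset in the depth.
  suffices H : ∃ L M, ∀ a b c : Fin N → (Fin n → ℝ) →ᵃ[ℝ] ℝ, ∃ h,
      Emulates {relu} (L + 2) M h ∧ ∀ x, IsGreatest
        (insert 0 (range fun i => a i x - relu (b i x) - relu (c i x))) (h x) by
    obtain ⟨L, M, H⟩ := H
    exact ⟨L + 2, M, H⟩
  induction N with
  | zero =>
    refine ⟨0, 2 * (n + 1) + 4, fun a b c => ⟨fun _ => 0, ?_, fun x => by simp⟩⟩
    have := (Emulates.affine (S := {relu}) (0 : (Fin n → ℝ) →ᵃ[ℝ] ℝ)).pad hS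
    exact this
  | succ N ih =>
    obtain ⟨L, M, H⟩ := ih
    obtain ⟨Ma, Ha⟩ := Emulates.exists_pad hS n 2 ((2 * (n + 1) + 4) + (n + 1 + 1 + 1) +
      (n + 1 + 1 + 1)) L
    refine ⟨L + 1, (2 * Ma + 4) + (M + (Ma + 1) + 1), fun a b c => ?_⟩
    obtain ⟨h, h1, h2⟩ := H (fun i => a i.castSucc) (fun i => b i.castSucc) fun i => c i.castSucc
    set φ : (Fin n → ℝ) → ℝ := fun x =>
      a (Fin.last N) x + (-1 * relu (b (Fin.last N) x) + 0) +
        (-1 * relu (c (Fin.last N) x) + 0) with hφ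
    have h3 : Emulates {relu} (2 + L) Ma φ := by
      refine Ha _ ((((Emulates.affine _).pad hS).add ?_).add ?_)
      · exact ((Emulates.affine _).activation hS).affine_comp _ _
      · exact ((Emulates.affine _).activation hS).affine_comp _ _
    rw [add_comm 2 L] at h3
    refine ⟨fun x => φ x + relu (h x + (-1 * φ x + 0)),
      (h3.pad hS).add ((h1.add (h3.affine_comp (-1) 0)).activation hS), fun x => ?_⟩
    have e : φ x + relu (h x + (-1 * φ x + 0)) = max (h x) (φ x) := by
      simp only [relu]
      rcases le_total (h x) (φ x) with h | h
      · rw [max_eq_right h, max_eq_left (by linarith), add_zero]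
      · rw [max_eq_left h, max_eq_right (by linarith)]; ring
    have e2 : φ x = a (Fin.last N) x - relu (b (Fin.last N) x) - relu (c (Fin.last N) x) := by
      simp only [hφ]; ring
    change IsGreatest _ (φ x + relu (h x + (-1 * φ x + 0)))
    rw [e]
    constructor
    · rcases max_choice (h x) (φ x) with hm | hm
      · rw [hm]
        rcases (h2 x).1 with h0 | ⟨i, hi⟩
        · exact Or.inl h0
        · exact Or.inr ⟨i.castSucc, hi⟩
      · rw [hm, e2]
        exact Or.inr ⟨Fin.last N, rfl⟩
    · rintro y (rfl | ⟨i, rfl⟩)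
      · exact le_max_of_le_left ((h2 x).2 (Or.inl rfl))
      · refine Fin.lastCases ?_ (fun i => ?_) i
        · exact le_max_of_le_right e2.ge
        · exact le_max_of_le_left ((h2 x).2 (Or.inr ⟨i, rfl⟩))

end TraceFEM

namespace TraceFEM

/-! ### Barycentric coordinates -/

theorem affine_eq_linear_add {V W : Type*} [AddCommGroup V] [Module ℝ V] [AddCommGroup W]
    [Module ℝ W] (g : V →ᵃ[ℝ] W) (x : V) : g x = g.linear x + g 0 := by
  have := g.map_vadd 0 x
  simpa using this

theorem affine_add {V W : Type*} [AddCommGroup V] [Module ℝ V] [AddCommGroup W]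
    [Module ℝ W] (g : V →ᵃ[ℝ] W) (x v : V) : g (x + v) = g x + g.linear v := by
  rw [affine_eq_linear_add g (x + v), affine_eq_linear_add g x, map_add]; abel

theorem affine_sum {V W : Type*} [AddCommGroup V] [Module ℝ V] [AddCommGroup W]
    [Module ℝ W] (g : V →ᵃ[ℝ] W) {s : Finset V} {w : V → ℝ} (hw : ∑ y ∈ s, w y = 1) :
    g (∑ y ∈ s, w y • y) = ∑ y ∈ s, w y • g y := by
  rw [affine_eq_linear_add, map_sum]
  conv_rhs => enter [2, y]; rw [affine_eq_linear_add, smul_add]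
  rw [Finset.sum_add_distrib, ← Finset.sum_smul, hw, one_smul]
  simp

theorem affine_lineMap {V W : Type*} [AddCommGroup V] [Module ℝ V] [AddCommGroup W]
    [Module ℝ W] (g : V →ᵃ[ℝ] W) (x y : V) (ε : ℝ) :
    g (x + ε • (y - x)) = g x + ε • (g y - g x) := by
  have h : g.linear (y - x) = g y - g x := by
    rw [map_sub, affine_eq_linear_add g y, affine_eq_linear_add g x]; abel
  rw [affine_add, map_smul, h]

theorem continuous_affine {V W : Type*} [NormedAddCommGroup V] [NormedSpace ℝ V]
    [FiniteDimensional ℝ V] [NormedAddCommGroup W] [NormedSpace ℝ W] (g : V →ᵃ[ℝ] W) :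
    Continuous g := AffineMap.continuous_of_finiteDimensional g

/-- Complete `s` to an affine basis of the space and use its coordinates. -/
theorem exists_affine_eq {s : Finset (E 3)} (hs : AffineIndependent ℝ ((↑) : s → E 3))
    (w : E 3 → ℝ) : ∃ g : E 3 →ᵃ[ℝ] ℝ, ∀ q ∈ s, g q = w q := by
  obtain ⟨t, hst, ht, htop⟩ := exists_subset_affineIndependent_affineSpan_eq_top (s := (s : Set (E 3))) hs
  let b : AffineBasis t ℝ (E 3) := ⟨(↑), ht, by simpa using htop⟩
  have : Finite t := finite_set_of_fin_dim_affineIndependent ℝ ht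
  have := Fintype.ofFinite t
  refine ⟨∑ i : t, w i • b.coord i, fun q hq => ?_⟩
  have h : ∀ i, b.coord i q = if i = ⟨q, hst hq⟩ then 1 else 0 := fun i => by
    classical
    have := b.coord_apply i ⟨q, hst hq⟩
    exact this
  have h2 : ∀ (u : Finset t), (∑ i ∈ u, w i • b.coord i) q = ∑ i ∈ u, w i * b.coord i q := by
    intro u
    classical
    induction u using Finset.induction_on with
    | empty => simp
    | insert a u ha ih =>
      rw [Finset.sum_insert ha, Finset.sum_insert ha, AffineMap.coe_add, Pi.add_apply, ih]
      simp
  rw [h2]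
  simp [h]

open Classical in
/-- An affine function equal to `1` at `p` and to `0` at the other points of `s`. On the affine
span of `s` this is the barycentric coordinate of `p`. -/
def bary (s : Finset (E 3)) (p : E 3) : E 3 →ᵃ[ℝ] ℝ :=
  if h : ∃ g : E 3 →ᵃ[ℝ] ℝ, ∀ q ∈ s, g q = if q = p then 1 else 0 then h.choose else 0

section Simplex

variable {s t u v : Finset (E 3)} {x p q : E 3}

open Classical in
theorem bary_apply (hs : AffineIndependent ℝ ((↑) : s → E 3)) (hq : q ∈ s) :
    bary s p q = if q = p then 1 else 0 := by
  have h := exists_affine_eq hs fun q => if q = p then 1 else 0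
  rw [bary, dif_pos h]
  exact h.choose_spec q hq

theorem bary_self (hs : AffineIndependent ℝ ((↑) : s → E 3)) (hp : p ∈ s) : bary s p p = 1 := by
  rw [bary_apply hs hp, if_pos rfl]

theorem bary_ne (hs : AffineIndependent ℝ ((↑) : s → E 3)) (hq : q ∈ s) (h : q ≠ p) :
    bary s p q = 0 := by
  rw [bary_apply hs hq, if_neg h]

/-- Affine functions on the span of a simplex are determined by their values at the vertices. -/
theorem affine_eq_sum {W : Type*} [AddCommGroup W] [Module ℝ W]
    (hs : AffineIndependent ℝ ((↑) : s → E 3)) (g : E 3 →ᵃ[ℝ] W)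
    (hx : x ∈ affineSpan ℝ (s : Set (E 3))) : g x = ∑ p ∈ s, bary s p x • g p := by
  refine affineSpan_induction (p := fun x => g x = ∑ p ∈ s, bary s p x • g p) hx
    (fun x hx => ?_) fun c u v w hu hv hw => ?_
  · rw [Finset.sum_eq_single x]
    · rw [bary_self hs hx, one_smul]
    · intro p _ hne
      rw [bary_ne hs hx hne.symm, zero_smul]
    · intro h
      exact absurd hx h
  · have h1 : g (c • (u -ᵥ v) +ᵥ w) = c • (g u - g v) + g w := by
      rw [AffineMap.map_vadd, map_smul, AffineMap.linearMap_vsub]; rfl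
    have h2 : ∀ p, bary s p (c • (u -ᵥ v) +ᵥ w) =
        c • (bary s p u - bary s p v) + bary s p w := fun p => by
      rw [AffineMap.map_vadd, map_smul, AffineMap.linearMap_vsub]; rfl
    simp only [h1, h2, hu, hv, hw]
    rw [← Finset.sum_sub_distrib, Finset.smul_sum, ← Finset.sum_add_distrib]
    refine Finset.sum_congr rfl fun p _ => ?_
    rw [add_smul, smul_assoc, sub_smul]

theorem sum_bary (hs : AffineIndependent ℝ ((↑) : s → E 3))
    (hx : x ∈ affineSpan ℝ (s : Set (E 3))) : ∑ p ∈ s, bary s p x = 1 := by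
  have := affine_eq_sum hs (AffineMap.const ℝ (E 3) (1 : ℝ)) hx
  simpa using this.symm

theorem sum_bary_smul (hs : AffineIndependent ℝ ((↑) : s → E 3))
    (hx : x ∈ affineSpan ℝ (s : Set (E 3))) : ∑ p ∈ s, bary s p x • p = x :=
  (affine_eq_sum hs (AffineMap.id ℝ (E 3)) hx).symm

theorem bary_sum (hs : AffineIndependent ℝ ((↑) : s → E 3)) (hu : u ⊆ s) {w : E 3 → ℝ}
    (hw : ∑ y ∈ u, w y = 1) (hp : p ∈ u) : bary s p (∑ y ∈ u, w y • y) = w p := by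
  rw [affine_sum _ hw, Finset.sum_eq_single p]
  · rw [bary_self hs (hu hp), smul_eq_mul, mul_one]
  · intro q hq hne
    rw [bary_ne hs (hu hq) hne, smul_zero]
  · exact fun h => absurd hp h

theorem bary_sum_of_notMem (hs : AffineIndependent ℝ ((↑) : s → E 3)) (hu : u ⊆ s) {w : E 3 → ℝ}
    (hw : ∑ y ∈ u, w y = 1) (hp : p ∉ u) : bary s p (∑ y ∈ u, w y • y) = 0 := by
  rw [affine_sum _ hw]
  refine Finset.sum_eq_zero fun q hq => ?_
  have hne : q ≠ p := fun h => hp (h ▸ hq)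
  rw [bary_ne hs (hu hq) hne, smul_zero]

theorem openHull_subset_convexHull (s : Finset (E 3)) :
    openHull s ⊆ convexHull ℝ (s : Set (E 3)) := by
  rintro x ⟨w, h1, h2, h3⟩
  exact Finset.mem_convexHull'.2 ⟨w, fun y hy => (h1 y hy).le, h2, h3⟩

theorem convexHull_subset_affineSpan' (s : Finset (E 3)) :
    convexHull ℝ (s : Set (E 3)) ⊆ affineSpan ℝ (s : Set (E 3)) :=
  convexHull_subset_affineSpan _

theorem mem_convexHull_iff_bary (hs : AffineIndependent ℝ ((↑) : s → E 3)) :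
    x ∈ convexHull ℝ (s : Set (E 3)) ↔
      x ∈ affineSpan ℝ (s : Set (E 3)) ∧ ∀ p ∈ s, 0 ≤ bary s p x := by
  constructor
  · intro hx
    refine ⟨convexHull_subset_affineSpan' s hx, fun p hp => ?_⟩
    obtain ⟨w, h1, h2, rfl⟩ := Finset.mem_convexHull'.1 hx
    rw [bary_sum hs subset_rfl h2 hp]
    exact h1 p hp
  · rintro ⟨hx, h⟩
    exact Finset.mem_convexHull'.2 ⟨fun p => bary s p x, h, sum_bary hs hx, sum_bary_smul hs hx⟩

theorem mem_openHull_iff_bary (hs : AffineIndependent ℝ ((↑) : s → E 3)) :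
    x ∈ openHull s ↔ x ∈ affineSpan ℝ (s : Set (E 3)) ∧ ∀ p ∈ s, 0 < bary s p x := by
  constructor
  · intro hx
    refine ⟨convexHull_subset_affineSpan' s (openHull_subset_convexHull s hx), fun p hp => ?_⟩
    obtain ⟨w, h1, h2, rfl⟩ := hx
    rw [bary_sum hs subset_rfl h2 hp]
    exact h1 p hp
  · rintro ⟨hx, h⟩
    exact ⟨fun p => bary s p x, h, sum_bary hs hx, sum_bary_smul hs hx⟩

theorem mem_openHull_iff_of_subset (hs : AffineIndependent ℝ ((↑) : s → E 3)) (hu : u ⊆ s) :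
    x ∈ openHull u ↔ x ∈ affineSpan ℝ (s : Set (E 3)) ∧ (∀ p ∈ u, 0 < bary s p x) ∧
      ∀ p ∈ s, p ∉ u → bary s p x = 0 := by
  constructor
  · intro hx
    refine ⟨affineSpan_mono ℝ (Finset.coe_subset.2 hu)
      (convexHull_subset_affineSpan' u (openHull_subset_convexHull u hx)), fun p hp => ?_,
      fun p _ hp => ?_⟩
    · obtain ⟨w, h1, h2, rfl⟩ := hx
      rw [bary_sum hs hu h2 hp]
      exact h1 p hp
    · obtain ⟨w, h1, h2, rfl⟩ := hx
      exact bary_sum_of_notMem hs hu h2 hp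
  · rintro ⟨hx, h, h0⟩
    refine ⟨fun p => bary s p x, h, ?_, ?_⟩
    · rw [← sum_bary hs hx]
      exact Finset.sum_subset hu h0
    · conv_rhs => rw [← sum_bary_smul hs hx]
      exact Finset.sum_subset hu fun p hp hpu => by
        simp only [h0 p hp hpu, zero_smul]

theorem mem_convexHull_iff_of_subset (hs : AffineIndependent ℝ ((↑) : s → E 3)) (hu : u ⊆ s) :
    x ∈ convexHull ℝ (u : Set (E 3)) ↔ x ∈ affineSpan ℝ (s : Set (E 3)) ∧
      (∀ p ∈ u, 0 ≤ bary s p x) ∧ ∀ p ∈ s, p ∉ u → bary s p x = 0 := by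
  constructor
  · intro hx
    refine ⟨affineSpan_mono ℝ (Finset.coe_subset.2 hu) (convexHull_subset_affineSpan' u hx),
      fun p hp => ?_, fun p _ hp => ?_⟩
    · obtain ⟨w, h1, h2, rfl⟩ := Finset.mem_convexHull'.1 hx
      rw [bary_sum hs hu h2 hp]
      exact h1 p hp
    · obtain ⟨w, h1, h2, rfl⟩ := Finset.mem_convexHull'.1 hx
      exact bary_sum_of_notMem hs hu h2 hp
  · rintro ⟨hx, h, h0⟩
    refine Finset.mem_convexHull'.2 ⟨fun p => bary s p x, h, ?_, ?_⟩
    · rw [← sum_bary hs hx]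
      exact Finset.sum_subset hu h0
    · conv_rhs => rw [← sum_bary_smul hs hx]
      exact Finset.sum_subset hu fun p hp hpu => by
        simp only [h0 p hp hpu, zero_smul]

/-- The vertices with positive coordinate span the face that carries `x`. -/
theorem exists_mem_openHull (hs : AffineIndependent ℝ ((↑) : s → E 3))
    (hx : x ∈ convexHull ℝ (s : Set (E 3))) : ∃ u ⊆ s, x ∈ openHull u := by
  classical
  refine ⟨s.filter fun p => 0 < bary s p x, Finset.filter_subset _ _, ?_⟩
  obtain ⟨h1, h2⟩ := (mem_convexHull_iff_bary hs).1 hx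
  rw [mem_openHull_iff_of_subset hs (Finset.filter_subset _ _)]
  refine ⟨h1, fun p hp => (Finset.mem_filter.1 hp).2, fun p hp hpu => ?_⟩
  exact le_antisymm (not_lt.1 fun h => hpu (Finset.mem_filter.2 ⟨hp, h⟩)) (h2 p hp)

/-- A face of a simplex which contains an interior point of another face contains that face. -/
theorem subset_of_mem_openHull (hs : AffineIndependent ℝ ((↑) : s → E 3)) (hu : u ⊆ s)
    (hv : v ⊆ s) (hxu : x ∈ openHull u) (hxv : x ∈ convexHull ℝ (v : Set (E 3))) : u ⊆ v := by
  intro p hp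
  by_contra h
  have h1 := ((mem_openHull_iff_of_subset hs hu).1 hxu).2.1 p hp
  have h2 := ((mem_convexHull_iff_of_subset hs hv).1 hxv).2.2 p (hu hp) h
  exact h1.ne' h2

theorem isClosed_convexHull_finset (s : Finset (E 3)) : IsClosed (convexHull ℝ (s : Set (E 3))) :=
  (s.finite_toSet.isCompact_convexHull (𝕜 := ℝ)).isClosed

theorem openHull_add_smul (hx : x ∈ openHull s) {y : E 3}
    (hy : y ∈ convexHull ℝ (s : Set (E 3))) {ε : ℝ} (h0 : 0 < ε) (h1 : ε ≤ 1) :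
    y + ε • (x - y) ∈ openHull s := by
  obtain ⟨w, hw, hw1, rfl⟩ := hx
  obtain ⟨w', hw', hw1', rfl⟩ := Finset.mem_convexHull'.1 hy
  refine ⟨fun p => (1 - ε) * w' p + ε * w p, fun p hp => ?_, ?_, ?_⟩
  · have := mul_pos h0 (hw p hp)
    have := mul_nonneg (sub_nonneg.2 h1) (hw' p hp)
    linarith
  · rw [Finset.sum_add_distrib, ← Finset.mul_sum, ← Finset.mul_sum, hw1, hw1']; ring
  · simp only [add_smul, mul_smul, Finset.sum_add_distrib, ← Finset.smul_sum]
    module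

theorem convex_openHull (s : Finset (E 3)) : Convex ℝ (openHull s) := by
  intro x hx y hy a b ha hb hab
  rcases eq_or_lt_of_le ha with rfl | ha
  · rw [zero_add] at hab
    rw [hab, zero_smul, one_smul, zero_add]
    exact hy
  · have := openHull_add_smul hx (openHull_subset_convexHull s hy) ha (by linarith)
    convert this using 1
    obtain rfl : b = 1 - a := by linarith
    module

theorem openHull_nonempty (hs : s.Nonempty) : (openHull s).Nonempty := by
  have : (0 : ℝ) < s.card := by exact_mod_cast hs.card_pos
  exact ⟨_, fun _ => (s.card : ℝ)⁻¹, fun _ _ => inv_pos.2 this, by simp [this.ne'], rfl⟩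

theorem closure_openHull (hs : s.Nonempty) :
    closure (openHull s) = convexHull ℝ (s : Set (E 3)) := by
  refine (closure_minimal (openHull_subset_convexHull s) (isClosed_convexHull_finset s)).antisymm
    fun y hy => ?_
  obtain ⟨x, hx⟩ := openHull_nonempty hs
  have h1 : Tendsto (fun ε : ℝ => y + ε • (x - y)) (𝓝[>] 0) (𝓝 y) := by
    have : Continuous fun ε : ℝ => y + ε • (x - y) := by fun_prop
    have := this.tendsto 0
    rw [zero_smul, add_zero] at this
    exact this.mono_left nhdsWithin_le_nhds
  refine mem_closure_of_tendsto h1 ?_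
  have : Ioo (0 : ℝ) 1 ∈ 𝓝[>] (0 : ℝ) := Ioo_mem_nhdsGT one_pos
  filter_upwards [this] with ε hε
  exact openHull_add_smul hx hy hε.1 hε.2.le

/-- A vertex `p` of `s` is extreme: on the hull its coordinate equals one only at `p`. If `p` were
not in `t`, this coordinate would be less than one on `t`, hence on the hull of `t`, which contains
`p`. -/
theorem subset_of_convexHull_subset (hs : AffineIndependent ℝ ((↑) : s → E 3))
    (hst : convexHull ℝ (s : Set (E 3)) = convexHull ℝ (t : Set (E 3))) : s ⊆ t := by
  intro p hp
  by_contra hpt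
  have hp' : p ∈ convexHull ℝ (t : Set (E 3)) := hst ▸ subset_convexHull ℝ _ hp
  obtain ⟨w, h1, h2, h3⟩ := Finset.mem_convexHull'.1 hp'
  have hlt : ∀ q ∈ t, bary s p q < 1 := by
    intro q hq
    have hq' : q ∈ convexHull ℝ (s : Set (E 3)) := hst ▸ subset_convexHull ℝ _ hq
    obtain ⟨hq1, hq2⟩ := (mem_convexHull_iff_bary hs).1 hq'
    by_contra hle
    rw [not_lt] at hle
    refine hpt ?_
    have h0 : ∀ r ∈ s, r ≠ p → bary s r q = 0 := by
      intro r hr hne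
      have hsum := sum_bary hs hq1
      rw [← Finset.add_sum_erase _ _ hp] at hsum
      have := Finset.single_le_sum (f := fun r => bary s r q)
        (fun r hr => hq2 r (Finset.mem_of_mem_erase hr)) (Finset.mem_erase.2 ⟨hne, hr⟩)
      exact le_antisymm (by linarith) (hq2 r hr)
    have hq3 := sum_bary_smul hs hq1
    have hq4 := sum_bary hs hq1
    rw [Finset.sum_eq_single p (fun r hr hne => by rw [h0 r hr hne, zero_smul])
      (fun h => absurd hp h)] at hq3
    rw [Finset.sum_eq_single p (fun r hr hne => h0 r hr hne) (fun h => absurd hp h)] at hq4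
    rw [hq4, one_smul] at hq3
    exact hq3 ▸ hq
  have hb := bary_self hs hp
  rw [show bary s p p = bary s p (∑ y ∈ t, w y • y) by rw [h3], affine_sum _ h2] at hb
  have hle : ∀ q ∈ t, w q • bary s p q ≤ w q := fun q hq =>
    mul_le_of_le_one_right (h1 q hq) (hlt q hq).le
  obtain ⟨q, hq, hwq⟩ : ∃ q ∈ t, 0 < w q := by
    by_contra! h
    have := Finset.sum_nonpos h
    linarith
  have := Finset.sum_lt_sum hle ⟨q, hq, mul_lt_of_lt_one_right hwq (hlt q hq)⟩
  linarith

theorem openHull_injective (hs : AffineIndependent ℝ ((↑) : s → E 3))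
    (ht : AffineIndependent ℝ ((↑) : t → E 3)) (hs0 : s.Nonempty) (ht0 : t.Nonempty)
    (h : openHull s = openHull t) : s = t := by
  have h' : convexHull ℝ (s : Set (E 3)) = convexHull ℝ (t : Set (E 3)) := by
    rw [← closure_openHull hs0, ← closure_openHull ht0, h]
  exact (subset_of_convexHull_subset hs h').antisymm (subset_of_convexHull_subset ht h'.symm)

theorem IsSimplex.nonempty {k : ℕ} (h : IsSimplex k s) : s.Nonempty :=
  Finset.card_pos.1 (by rw [h.1]; omega)

theorem IsSimplex.subset {k l : ℕ} (h : IsSimplex k s) (hu : u ⊆ s) (hc : u.card = l + 1) :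
    IsSimplex l u :=
  ⟨hc, h.2.mono (s := (u : Set (E 3))) (t := (s : Set (E 3))) hu⟩

end Simplex

/-- In a regular partition, a simplex containing an interior point of a face of another simplex has
this face. -/
theorem IsRegularPartition.subset_of_mem_openHull {k : ℕ} {𝒯 : Set (Finset (E 3))}
    {G : Set (E 3)} (h : IsRegularPartition k 𝒯 G) {s t u : Finset (E 3)} (hs : s ∈ 𝒯)
    (ht : t ∈ 𝒯) (hu : u ⊆ s) {x : E 3} (hx : x ∈ openHull u)
    (hxt : x ∈ convexHull ℝ (t : Set (E 3))) : u ⊆ t := by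
  classical
  by_cases hst : s = t
  · exact hst ▸ hu
  · have hxs := convexHull_mono (Finset.coe_subset.2 hu) (openHull_subset_convexHull u hx)
    have : x ∈ convexHull ℝ ((s ∩ t : Finset (E 3)) : Set (E 3)) := by
      rw [Finset.coe_inter, ← h.inter s hs t ht hst]
      exact ⟨hxs, hxt⟩
    exact (TraceFEM.subset_of_mem_openHull (h.simplex s hs).2 hu Finset.inter_subset_left hx
      this).trans Finset.inter_subset_right

end TraceFEM

namespace TraceFEM

/-! ### The trace of a tetrahedral mesh on a plane face -/

/-- The signed distance to a plane. -/
def planeDist (ν : E 3) (c : ℝ) : E 3 →ᵃ[ℝ] ℝ :=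
  (innerₗ (E 3) ν).toAffineMap - AffineMap.const ℝ (E 3) c

theorem planeDist_apply (ν : E 3) (c : ℝ) (y : E 3) : planeDist ν c y = inner ℝ ν y - c := rfl

/-- An affine function with a local minimum on the plane at `x` has zero slope in all directions of
the plane, so only its slope along `ν` is left. It will be applied to barycentric coordinates. -/
theorem eq_mul_planeDist {ν x : E 3} {c r : ℝ} (hν : ‖ν‖ = 1) (g : E 3 →ᵃ[ℝ] ℝ)
    (hx : inner ℝ ν x = c) (hr : 0 < r)
    (h : ∀ y ∈ Metric.ball x r, inner ℝ ν y = c → 0 ≤ g y) (hg : g x = 0) (y : E 3) :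
    g y = g.linear ν * planeDist ν c y := by
  have key : ∀ u : E 3, inner ℝ ν u = 0 → 0 ≤ g.linear u := by
    intro u hu
    have hpos : 0 < r / (2 * (‖u‖ + 1)) := by positivity
    have h1 := h (x + (r / (2 * (‖u‖ + 1))) • u) (by
      rw [Metric.mem_ball, dist_eq_norm, add_sub_cancel_left, norm_smul, Real.norm_of_nonneg hpos.le,
        div_mul_eq_mul_div, div_lt_iff₀ (by positivity)]
      nlinarith [norm_nonneg u]) (by rw [inner_add_right, inner_smul_right, hu, hx]; simp)
    rw [affine_add, hg, zero_add, map_smul, smul_eq_mul] at h1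
    exact nonneg_of_mul_nonneg_right h1 hpos
  have key' : ∀ u : E 3, inner ℝ ν u = 0 → g.linear u = 0 := fun u hu =>
    le_antisymm (by have := key (-u) (by simp [hu]); rw [map_neg] at this; linarith) (key u hu)
  have hy : y = x + (inner ℝ ν (y - x) • ν + (y - x - inner ℝ ν (y - x) • ν)) := by abel
  have h0 : inner ℝ ν (y - x - inner ℝ ν (y - x) • ν) = (0 : ℝ) := by
    rw [inner_sub_right, inner_smul_right, real_inner_self_eq_norm_sq, hν]; ring
  conv_lhs => rw [hy]
  rw [affine_add, hg, map_add, key' _ h0, map_smul, planeDist_apply, inner_sub_right, hx]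
  simp [mul_comm]

theorem affineSpan_eq_top {s : Finset (E 3)} (hs : IsSimplex 3 s) :
    affineSpan ℝ (s : Set (E 3)) = ⊤ := by
  have := (hs.2.affineSpan_eq_top_iff_card_eq_finrank_add_one).2 (by simp [hs.1])
  simpa using this

theorem mem_affineSpan_of_isSimplex {s : Finset (E 3)} (hs : IsSimplex 3 s) (x : E 3) :
    x ∈ affineSpan ℝ (s : Set (E 3)) := by
  rw [affineSpan_eq_top hs]; trivial

/-- The vertices of the tetrahedron `s` other than `a` lie on the plane, and `a` lies below. -/
structure IsFacet (ν : E 3) (c : ℝ) (s : Finset (E 3)) (a : E 3) : Prop where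
  mem : a ∈ s
  lt : planeDist ν c a < 0
  eq : ∀ q ∈ s, q ≠ a → planeDist ν c q = 0

section Facet

variable {Ω : Set (E 3)} {𝒯 : Set (Finset (E 3))} {ν : E 3} {c : ℝ} {s : Finset (E 3)} {a x y : E 3}

theorem IsFacet.planeDist_eq (h : IsFacet ν c s a) (hs : IsSimplex 3 s) (y : E 3) :
    planeDist ν c y = bary s a y * planeDist ν c a := by
  rw [affine_eq_sum hs.2 (planeDist ν c) (mem_affineSpan_of_isSimplex hs y),
    Finset.sum_eq_single a (fun q hq hne => by rw [h.eq q hq hne, smul_zero])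
      (fun h' => absurd h.mem h')]
  rfl

theorem IsFacet.mem_openHull_iff [DecidableEq (E 3)] (h : IsFacet ν c s a) (hs : IsSimplex 3 s) :
    y ∈ openHull (s.erase a) ↔ planeDist ν c y = 0 ∧ ∀ q ∈ s, q ≠ a → 0 < bary s q y := by
  rw [mem_openHull_iff_of_subset hs.2 (Finset.erase_subset _ _), h.planeDist_eq hs y]
  constructor
  · rintro ⟨-, h1, h2⟩
    refine ⟨?_, fun q hq hne => h1 q (Finset.mem_erase.2 ⟨hne, hq⟩)⟩
    rw [h2 a h.mem (Finset.notMem_erase a s), zero_mul]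
  · rintro ⟨h1, h2⟩
    refine ⟨mem_affineSpan_of_isSimplex hs y, fun q hq => h2 q (Finset.mem_of_mem_erase hq)
      (Finset.ne_of_mem_erase hq), fun q hq hne => ?_⟩
    obtain rfl : q = a := by
      by_contra h'
      exact hne (Finset.mem_erase.2 ⟨h', hq⟩)
    exact (mul_eq_zero.1 h1).resolve_right h.lt.ne

theorem eventually_bary_pos
    (hx : ∀ q ∈ s, q ≠ a → 0 < bary s q x) :
    ∀ᶠ y in 𝓝 x, ∀ q ∈ s, q ≠ a → 0 < bary s q y := by
  rw [eventually_all_finset s]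
  intro q hq
  by_cases hne : q = a
  · simp [hne]
  · filter_upwards [(continuous_affine (bary s q)).continuousAt.eventually (lt_mem_nhds (hx q hq hne))]
      with y hy _ using hy

theorem flatPoints_planeDist (hx : x ∈ flatPoints Ω ν c) : planeDist ν c x = 0 := by
  rw [planeDist_apply, hx.1, sub_self]

theorem convexHull_subset_closure (h𝒯 : IsRegularPartition 3 𝒯 Ω) (hs : s ∈ 𝒯) :
    convexHull ℝ (s : Set (E 3)) ⊆ closure Ω := by
  rw [← h𝒯.cover]
  exact subset_biUnion_of_mem (u := fun s : Finset (E 3) => convexHull ℝ (s : Set (E 3))) hs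

theorem eventually_planeDist_nonpos (hx : x ∈ flatPoints Ω ν c) :
    ∀ᶠ y in 𝓝 x, y ∈ closure Ω → planeDist ν c y ≤ 0 := by
  obtain ⟨-, r, hr, h⟩ := hx
  filter_upwards [Metric.ball_mem_nhds x hr] with y hy hyΩ
  by_contra hlt
  rw [not_le] at hlt
  have : ∀ᶠ z in 𝓝 y, z ∈ Metric.ball x r ∧ 0 < planeDist ν c z :=
    (show ∀ᶠ z in 𝓝 y, z ∈ Metric.ball x r from Metric.isOpen_ball.mem_nhds hy).and
      ((continuous_affine (planeDist ν c)).continuousAt.eventually (lt_mem_nhds hlt))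
  obtain ⟨z, hz, hzΩ⟩ := mem_closure_iff_nhds.1 hyΩ _ this
  have := (h z hz.1).1 hzΩ
  rw [← sub_neg, ← planeDist_apply] at this
  exact (hz.2.trans this).false

theorem exists_small_step {p : E 3 → Prop} (x q : E 3) (h : ∀ᶠ y in 𝓝 x, p y) :
    ∃ ε : ℝ, 0 < ε ∧ ε ≤ 1 ∧ p (x + ε • (q - x)) := by
  have h1 : Tendsto (fun ε : ℝ => x + ε • (q - x)) (𝓝[>] 0) (𝓝 x) := by
    have : Continuous fun ε : ℝ => x + ε • (q - x) := by fun_prop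
    have := this.tendsto 0
    rw [zero_smul, add_zero] at this
    exact this.mono_left nhdsWithin_le_nhds
  obtain ⟨ε, h2, h3⟩ := ((h1.eventually h).and (Ioo_mem_nhdsGT one_pos)).exists
  exact ⟨ε, h3.1, h3.2.le, h2⟩

/-- A short step from `x` towards `q` stays in the closure of `Ω`, which near `x` does not reach
above the plane. -/
theorem planeDist_vertex_nonpos (h𝒯 : IsRegularPartition 3 𝒯 Ω) (hs : s ∈ 𝒯)
    (hx : x ∈ flatPoints Ω ν c) (hxs : x ∈ convexHull ℝ (s : Set (E 3))) {q : E 3} (hq : q ∈ s) :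
    planeDist ν c q ≤ 0 := by
  obtain ⟨ε, h0, h1, h2⟩ := exists_small_step x q (eventually_planeDist_nonpos hx)
  have h3 := h2 (convexHull_subset_closure h𝒯 hs ((convex_convexHull ℝ _).add_smul_sub_mem hxs
    (subset_convexHull ℝ _ hq) ⟨h0.le, h1⟩))
  rw [affine_lineMap, flatPoints_planeDist hx, zero_add, sub_zero, smul_eq_mul] at h3
  exact nonpos_of_mul_nonpos_right h3 h0

/-- A tetrahedron that covers a neighbourhood of a point of a plane face has a facet there. -/
theorem exists_isFacet [DecidableEq (E 3)] (hν : ‖ν‖ = 1) (h𝒯 : IsRegularPartition 3 𝒯 Ω)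
    (hs : s ∈ 𝒯) (hx : x ∈ flatPoints Ω ν c) {r : ℝ} (hr : 0 < r)
    (h : ∀ y ∈ Metric.ball x r, inner ℝ ν y = c → y ∈ convexHull ℝ (s : Set (E 3))) :
    ∃ a, IsFacet ν c s a ∧ x ∈ openHull (s.erase a) := by
  have hsS := h𝒯.simplex s hs
  have hxs := h x (Metric.mem_ball_self hr) hx.1
  have hle : ∀ q ∈ s, planeDist ν c q ≤ 0 := fun q hq => planeDist_vertex_nonpos h𝒯 hs hx hxs hq
  have hb : ∀ y ∈ Metric.ball x r, inner ℝ ν y = c → ∀ q ∈ s, 0 ≤ bary s q y := fun y hy hyc q hq =>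
    ((mem_convexHull_iff_bary hsS.2).1 (h y hy hyc)).2 q hq
  have hmul : ∀ q ∈ s, bary s q x = 0 → ∀ y,
      bary s q y = (bary s q).linear ν * planeDist ν c y := fun q hq h0 =>
    eq_mul_planeDist hν _ hx.1 hr (fun y hy hyc => hb y hy hyc q hq) h0
  have hpos : ∀ q ∈ s, planeDist ν c q = 0 → 0 < bary s q x := by
    intro q hq hq0
    refine lt_of_le_of_ne (hb x (Metric.mem_ball_self hr) hx.1 q hq) fun h0 => ?_
    have := hmul q hq h0.symm q
    rw [bary_self hsS.2 hq, hq0, mul_zero] at this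
    exact one_ne_zero this
  obtain ⟨a, ha, ha0⟩ : ∃ a ∈ s, planeDist ν c a ≠ 0 := by
    by_contra! h0
    have hz : ∀ y, planeDist ν c y = 0 := fun y => by
      rw [affine_eq_sum hsS.2 _ (mem_affineSpan_of_isSimplex hsS y)]
      exact Finset.sum_eq_zero fun q hq => by rw [h0 q hq, smul_zero]
    have h1 := hz (x + ν)
    rw [planeDist_apply, inner_add_right, hx.1, real_inner_self_eq_norm_sq, hν] at h1
    norm_num at h1
  have hsum := affine_eq_sum hsS.2 (planeDist ν c) (mem_affineSpan_of_isSimplex hsS x)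
  rw [flatPoints_planeDist hx] at hsum
  -- The distance of `x` from the plane is zero and a sum of nonpositive terms. So vertices off the
  -- plane have coordinate zero at `x`, and by `hmul` these coordinates are multiples of the
  -- distance.
  have hterm := (Finset.sum_eq_zero_iff_of_nonpos fun q hq => mul_nonpos_of_nonneg_of_nonpos
    (hb x (Metric.mem_ball_self hr) hx.1 q hq) (hle q hq)).1 hsum.symm
  have hbz : ∀ q ∈ s, planeDist ν c q ≠ 0 → bary s q x = 0 := fun q hq hq0 =>
    (mul_eq_zero.1 (hterm q hq)).resolve_right hq0
  -- Were `q` a second vertex off the plane, its coordinate would be a multiple of the distance that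
  -- vanishes at `a`, hence identically zero, although it is one at `q`.
  have hfac : IsFacet ν c s a := by
    refine ⟨ha, lt_of_le_of_ne (hle a ha) ha0, fun q hq hne => ?_⟩
    by_contra hq0
    have h1 := hmul q hq (hbz q hq hq0)
    have h2 := h1 a
    rw [bary_ne hsS.2 ha hne.symm] at h2
    have h3 := h1 q
    rw [(mul_eq_zero.1 h2.symm).resolve_right ha0, zero_mul, bary_self hsS.2 hq] at h3
    exact one_ne_zero h3
  refine ⟨a, hfac, (hfac.mem_openHull_iff hsS).2 ⟨flatPoints_planeDist hx, fun q hq hne => ?_⟩⟩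
  exact hpos q hq (hfac.eq q hq hne)

/-- No other tetrahedron touches a facet on a plane face from the inside of the facet. -/
theorem IsFacet.notMem_convexHull [DecidableEq (E 3)] (hν : ‖ν‖ = 1)
    (h𝒯 : IsRegularPartition 3 𝒯 Ω) (hs : s ∈ 𝒯)
    (h : IsFacet ν c s a) (hx : x ∈ flatPoints Ω ν c) (hxs : x ∈ openHull (s.erase a))
    {t : Finset (E 3)} (ht : t ∈ 𝒯) (hst : s ≠ t) (hy : y ∈ openHull (s.erase a)) :
    y ∉ convexHull ℝ (t : Set (E 3)) := by
  intro hyt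
  have hsS := h𝒯.simplex s hs
  have htS := h𝒯.simplex t ht
  -- By conformity `t` has all vertices of the facet, so it consists of them and one further vertex
  -- `b`, which also lies below the plane. Both tetrahedra then contain points just below `x`,
  -- against disjointness.
  have hsub := h𝒯.subset_of_mem_openHull hs ht (Finset.erase_subset a s) hy hyt
  have hat : a ∉ t := by
    intro hat
    refine hst (Finset.eq_of_subset_of_card_le ?_ (by rw [hsS.1, htS.1]))
    rw [← Finset.insert_erase h.mem]
    exact Finset.insert_subset hat hsub
  obtain ⟨b, hb, hbs⟩ : ∃ b ∈ t, b ∉ s.erase a := by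
    by_contra! h'
    have h1 := Finset.card_le_card (h' : t ⊆ s.erase a)
    rw [Finset.card_erase_of_mem h.mem, hsS.1, htS.1] at h1
    omega
  have hte : t.erase b = s.erase a := by
    symm
    refine Finset.eq_of_subset_of_card_le (fun q hq => Finset.mem_erase.2 ⟨?_, hsub hq⟩) ?_
    · exact fun h' => hbs (h' ▸ hq)
    · rw [Finset.card_erase_of_mem hb, Finset.card_erase_of_mem h.mem, hsS.1, htS.1]
  have hxt : x ∈ convexHull ℝ (t : Set (E 3)) :=
    convexHull_mono (Finset.coe_subset.2 hsub) (openHull_subset_convexHull _ hxs)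
  have hble := planeDist_vertex_nonpos h𝒯 ht hx hxt hb
  have htq : ∀ q ∈ t, q ≠ b → planeDist ν c q = 0 := fun q hq hne => by
    have := Finset.mem_erase.2 ⟨hne, hq⟩
    rw [hte] at this
    exact h.eq q (Finset.mem_of_mem_erase this) (Finset.ne_of_mem_erase this)
  have hb0 : planeDist ν c b ≠ 0 := by
    intro hb0
    have h1 : planeDist ν c (x + ν) = 0 := by
      rw [affine_eq_sum htS.2 _ (mem_affineSpan_of_isSimplex htS (x + ν))]
      refine Finset.sum_eq_zero fun q hq => ?_
      by_cases hqb : q = b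
      · rw [hqb, hb0, smul_zero]
      · rw [htq q hq hqb, smul_zero]
    rw [planeDist_apply, inner_add_right, hx.1, real_inner_self_eq_norm_sq, hν] at h1
    norm_num at h1
  have h' : IsFacet ν c t b := ⟨hb, lt_of_le_of_ne hble hb0, htq⟩
  have hx1 := (h.mem_openHull_iff hsS).1 hxs
  have hx2 := (h'.mem_openHull_iff htS).1 (hte ▸ hxs)
  obtain ⟨ε, h0, -, h3, h4⟩ := exists_small_step x (x - ν)
    ((eventually_bary_pos hx1.2).and (eventually_bary_pos hx2.2))
  set z := x + ε • (x - ν - x) with hz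
  have hdz : planeDist ν c z < 0 := by
    rw [hz, planeDist_apply, inner_add_right, hx.1, inner_smul_right, sub_sub_cancel_left,
      inner_neg_right, real_inner_self_eq_norm_sq, hν]
    linarith
  have hmem : ∀ {u : Finset (E 3)} {d : E 3}, IsSimplex 3 u → IsFacet ν c u d →
      (∀ q ∈ u, q ≠ d → 0 < bary u q z) → z ∈ openHull u := by
    intro u d huS hu hz'
    refine (mem_openHull_iff_bary huS.2).2 ⟨mem_affineSpan_of_isSimplex huS z, fun q hq => ?_⟩
    by_cases hqd : q = d
    · rw [hu.planeDist_eq huS z] at hdz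
      rw [hqd]
      exact pos_of_mul_neg_left hdz hu.lt.le
    · exact hz' q hq hqd
  exact Set.disjoint_left.1 (h𝒯.disjoint s hs t ht hst) (hmem hsS h h3) (hmem htS h' h4)

theorem IsFacet.openHull_subset_flatPoints [DecidableEq (E 3)] (hν : ‖ν‖ = 1)
    (hΩ : IsPolytopalDomain Ω)
    (h𝒯 : IsRegularPartition 3 𝒯 Ω) (hs : s ∈ 𝒯)
    (h : IsFacet ν c s a) (hx : x ∈ flatPoints Ω ν c) (hxs : x ∈ openHull (s.erase a)) :
    openHull (s.erase a) ⊆ flatPoints Ω ν c := by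
  intro y hy
  have hsS := h𝒯.simplex s hs
  have hy1 := (h.mem_openHull_iff hsS).1 hy
  have hyc : inner ℝ ν y = c := sub_eq_zero.1 hy1.1
  -- Near `y` no tetrahedron but `s` is present and the coordinates of the facet vertices stay
  -- positive, so the closure of `Ω` is the closed half-space there.
  have hothers : ∀ᶠ z in 𝓝 y, ∀ t ∈ 𝒯, s ≠ t → z ∉ convexHull ℝ (t : Set (E 3)) := by
    rw [eventually_all_finite h𝒯.finite]
    intro t ht
    by_cases hst : s = t
    · simp [hst]
    · filter_upwards [(isClosed_convexHull_finset t).isOpen_compl.mem_nhds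
        (h.notMem_convexHull hν h𝒯 hs hx hxs ht hst hy)] with z hz _ using hz
  obtain ⟨r, hr, hball⟩ := Metric.eventually_nhds_iff_ball.1
    (hothers.and (eventually_bary_pos hy1.2))
  have hcl : ∀ z ∈ Metric.ball y r, (z ∈ closure Ω ↔ planeDist ν c z ≤ 0) := by
    intro z hz
    obtain ⟨h1, h2⟩ := hball z hz
    have : z ∈ closure Ω ↔ z ∈ convexHull ℝ (s : Set (E 3)) := by
      refine ⟨fun hz' => ?_, fun hz' => convexHull_subset_closure h𝒯 hs hz'⟩
      rw [← h𝒯.cover] at hz'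
      obtain ⟨t, ht, hzt⟩ := mem_iUnion₂.1 hz'
      by_contra hzs
      exact h1 t ht (fun hst => hzs (hst ▸ hzt)) hzt
    rw [this, mem_convexHull_iff_bary hsS.2, h.planeDist_eq hsS z]
    constructor
    · rintro ⟨-, h3⟩
      exact mul_nonpos_of_nonneg_of_nonpos (h3 a h.mem) h.lt.le
    · refine fun h3 => ⟨mem_affineSpan_of_isSimplex hsS z, fun q hq => ?_⟩
      by_cases hqa : q = a
      · rw [hqa]
        by_contra h4
        exact (mul_pos_of_neg_of_neg (not_le.1 h4) h.lt).not_ge h3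
      · exact (h2 q hq hqa).le
  refine ⟨hyc, r, hr, fun z hz => ?_⟩
  rw [← sub_neg, ← planeDist_apply]
  constructor
  · intro hzΩ
    have hev : ∀ᶠ w in 𝓝 z, planeDist ν c w ≤ 0 := by
      filter_upwards [hΩ.isOpen.mem_nhds hzΩ, Metric.isOpen_ball.mem_nhds hz] with w h1 h2
      exact (hcl w h2).1 (subset_closure h1)
    obtain ⟨ε, h0, -, h3⟩ := exists_small_step z (z + ν) hev
    rw [planeDist_apply, inner_add_right, inner_smul_right, add_sub_cancel_left,
      real_inner_self_eq_norm_sq, hν] at h3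
    rw [planeDist_apply]
    linarith
  · intro hz0
    -- A point strictly below the plane is interior to the closure of `Ω`, hence in `Ω`.
    rw [← hΩ.interior_closure, mem_interior_iff_mem_nhds]
    filter_upwards [Metric.isOpen_ball.mem_nhds hz,
      (continuous_affine (planeDist ν c)).continuousAt.eventually (gt_mem_nhds hz0)] with w h1 h2
    exact (hcl w h1).2 h2.le

end Facet

/-- A small disc of the plane around a flat point is connected and consists of flat points, so it
stays within one component. Hence a face is relatively open in its plane. -/
theorem exists_ball_inter_plane_subset {Ω f : Set (E 3)} {ν : E 3} {c : ℝ} {x₀ x : E 3}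
    (hf : f = connectedComponentIn (flatPoints Ω ν c) x₀) (hx : x ∈ f) :
    ∃ r > 0, ∀ y ∈ Metric.ball x r, inner ℝ ν y = c → y ∈ f := by
  subst hf
  have hxf := connectedComponentIn_subset _ _ hx
  obtain ⟨hxc, r, hr, h⟩ := id hxf
  refine ⟨r, hr, fun y hy hyc => ?_⟩
  rw [connectedComponentIn_eq hx]
  have hconv : Convex ℝ (Metric.ball x r ∩ {y | inner ℝ ν y = c}) :=
    (convex_ball x r).inter (convex_hyperplane (innerₗ (E 3) ν).isLinear c)
  have hsub : Metric.ball x r ∩ {y | inner ℝ ν y = c} ⊆ flatPoints Ω ν c := by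
    rintro z ⟨hz, hzc⟩
    refine ⟨hzc, r - dist z x, sub_pos.2 hz, fun w hw => h w ?_⟩
    rw [Metric.mem_ball] at hw ⊢
    linarith [dist_triangle w z x]
  exact hconv.isPreconnected.subset_connectedComponentIn ⟨Metric.mem_ball_self hr, hxc⟩ hsub
    ⟨hy, hyc⟩

/-- The properties of a triangular mesh on a plane face that matter for finite elements. -/
structure IsFaceMesh (ν : E 3) (c : ℝ) (f : Set (E 3)) (𝒯 : Set (Finset (E 3))) : Prop where
  norm_eq : ‖ν‖ = 1
  regular : IsRegularPartition 2 𝒯 f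
  nonempty : f.Nonempty
  plane : ∀ x ∈ f, inner ℝ ν x = c
  isOpen : ∀ x ∈ f, ∃ r > 0, ∀ y ∈ Metric.ball x r, inner ℝ ν y = c → y ∈ f
  openHull_subset : ∀ t ∈ 𝒯, openHull t ⊆ f

/-- The cells of the trace mesh are the open facets of the tetrahedra on the face. -/
theorem traceCells_facet [DecidableEq (E 3)] {Ω f : Set (E 3)} {𝒯 : Set (Finset (E 3))} {ν : E 3}
    {c : ℝ} {x₀ : E 3}
    (hν : ‖ν‖ = 1) (hΩ : IsPolytopalDomain Ω) (h𝒯 : IsRegularPartition 3 𝒯 Ω)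
    (hf : f = connectedComponentIn (flatPoints Ω ν c) x₀)
    {s : Finset (E 3)} (hs : s ∈ 𝒯) {x : E 3} (hx : x ∈ ((↑) : f → E 3) ''
      interior (((↑) : f → E 3) ⁻¹' convexHull ℝ (s : Set (E 3)))) :
    ∃ a, IsFacet ν c s a ∧ openHull (s.erase a) ⊆ f ∧ ((↑) : f → E 3) ''
      interior (((↑) : f → E 3) ⁻¹' convexHull ℝ (s : Set (E 3))) = openHull (s.erase a) := by
  have hsS := h𝒯.simplex s hs
  have hflat : f ⊆ flatPoints Ω ν c := hf ▸ connectedComponentIn_subset _ _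
  have hfac : ∀ y ∈ ((↑) : f → E 3) ''
      interior (((↑) : f → E 3) ⁻¹' convexHull ℝ (s : Set (E 3))),
      ∃ a, IsFacet ν c s a ∧ y ∈ openHull (s.erase a) := by
    rintro _ ⟨⟨y, hyf⟩, hy, rfl⟩
    obtain ⟨r, hr, h1⟩ := exists_ball_inter_plane_subset hf hyf
    obtain ⟨r', hr', h2⟩ := Metric.mem_nhds_iff.1 (mem_interior_iff_mem_nhds.1 hy)
    refine exists_isFacet hν h𝒯 hs (hflat hyf) (lt_min hr hr') fun z hz hzc => ?_
    have hzf := h1 z (Metric.ball_subset_ball (min_le_left _ _) hz) hzc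
    have hz' : dist z y < r' := lt_of_lt_of_le hz (min_le_right r r')
    exact @h2 ⟨z, hzf⟩ hz'
  obtain ⟨a, ha, hxa⟩ := hfac x hx
  have hxf : x ∈ f := by
    obtain ⟨⟨y, hyf⟩, hy, rfl⟩ := hx
    exact hyf
  -- The open facet is convex and consists of flat points, so it lies in the component of `x`.
  have hsub : openHull (s.erase a) ⊆ f := by
    rw [hf, connectedComponentIn_eq (hf ▸ hxf)]
    exact (convex_openHull _).isPreconnected.subset_connectedComponentIn hxa
      (ha.openHull_subset_flatPoints hν hΩ h𝒯 hs (hflat hxf) hxa)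
  refine ⟨a, ha, hsub, Subset.antisymm (fun y hy => ?_) fun y hy => ?_⟩
  · obtain ⟨b, hb, hyb⟩ := hfac y hy
    obtain rfl : b = a := by
      by_contra hne
      exact hb.lt.ne (ha.eq b hb.mem hne)
    exact hyb
  · refine ⟨⟨y, hsub hy⟩, mem_interior_iff_mem_nhds.2 ?_, rfl⟩
    have h1 := eventually_bary_pos ((ha.mem_openHull_iff hsS).1 hy).2
    have h2 := (continuous_subtype_val (p := (· ∈ f))).continuousAt (x := ⟨y, hsub hy⟩) h1
    filter_upwards [h2] with z hz
    refine convexHull_mono (Finset.coe_subset.2 (Finset.erase_subset a s))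
      (openHull_subset_convexHull _ ((ha.mem_openHull_iff hsS).2 ⟨?_, hz⟩))
    exact flatPoints_planeDist (hflat z.2)

theorem mem_traceMesh_iff [DecidableEq (E 3)] {Ω f : Set (E 3)} {𝒯 : Set (Finset (E 3))} {ν : E 3}
    {c : ℝ} {x₀ : E 3}
    (hν : ‖ν‖ = 1) (hΩ : IsPolytopalDomain Ω) (h𝒯 : IsRegularPartition 3 𝒯 Ω)
    (hf : f = connectedComponentIn (flatPoints Ω ν c) x₀) {t : Finset (E 3)}
    (ht : t ∈ traceMesh 𝒯 f) : openHull t ⊆ f ∧ ∃ s ∈ 𝒯, ∃ a, IsFacet ν c s a ∧ t = s.erase a := by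
  obtain ⟨htS, hne, s, hs, h⟩ := ht
  obtain ⟨x, hx⟩ := h ▸ hne
  obtain ⟨a, ha, hsub, heq⟩ := traceCells_facet hν hΩ h𝒯 hf hs hx
  have hsS := (h𝒯.simplex s hs).subset (l := 2) (Finset.erase_subset a s) (by
    rw [Finset.card_erase_of_mem ha.mem, (h𝒯.simplex s hs).1])
  have := openHull_injective htS.2 hsS.2 htS.nonempty hsS.nonempty (h.trans heq)
  exact ⟨this ▸ hsub, s, hs, a, ha, this⟩

theorem openHull_image_traceMesh {Ω f : Set (E 3)} {𝒯 : Set (Finset (E 3))} {ν : E 3}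
    {c : ℝ} {x₀ : E 3}
    (hν : ‖ν‖ = 1) (hΩ : IsPolytopalDomain Ω) (h𝒯 : IsRegularPartition 3 𝒯 Ω)
    (hf : f = connectedComponentIn (flatPoints Ω ν c) x₀) :
    openHull '' traceMesh 𝒯 f = traceCells 𝒯 f := by
  classical
  refine Subset.antisymm (by rintro _ ⟨t, ht, rfl⟩; exact ht.2) ?_
  rintro S ⟨hne, s, hs, rfl⟩
  obtain ⟨x, hx⟩ := id hne
  obtain ⟨a, ha, hsub, heq⟩ := traceCells_facet hν hΩ h𝒯 hf hs hx
  exact ⟨s.erase a, ⟨(h𝒯.simplex s hs).subset (Finset.erase_subset a s) (by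
    rw [Finset.card_erase_of_mem ha.mem, (h𝒯.simplex s hs).1]), heq ▸ hne, s, hs, heq.symm⟩,
    heq.symm⟩

/-- The trace of a regular partition on a plane face is a regular partition of the face. -/
theorem isFaceMesh_traceMesh {Ω f : Set (E 3)} {𝒯 : Set (Finset (E 3))} {ν : E 3}
    {c : ℝ} {x₀ : E 3}
    (hν : ‖ν‖ = 1) (hΩ : IsPolytopalDomain Ω) (h𝒯 : IsRegularPartition 3 𝒯 Ω)
    (hf : f = connectedComponentIn (flatPoints Ω ν c) x₀) (hx₀ : x₀ ∈ flatPoints Ω ν c) :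
    IsFaceMesh ν c f (traceMesh 𝒯 f) := by
  classical
  have hflat : f ⊆ flatPoints Ω ν c := hf ▸ connectedComponentIn_subset _ _
  have hmesh := fun t (ht : t ∈ traceMesh 𝒯 f) => mem_traceMesh_iff hν hΩ h𝒯 hf ht
  -- Faces of trace triangles are faces of tetrahedra, so conformity is inherited from the
  -- tetrahedral mesh. Disjointness and the intersection property both follow from this.
  have hcarrier : ∀ t ∈ traceMesh 𝒯 f, ∀ u ⊆ t, ∀ x ∈ openHull u, ∀ t' ∈ traceMesh 𝒯 f,
      x ∈ convexHull ℝ (t' : Set (E 3)) → u ⊆ t' := by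
    intro t ht u hu x hx t' ht' hxt'
    obtain ⟨-, s, hs, a, ha, rfl⟩ := hmesh t ht
    obtain ⟨-, s', hs', a', ha', rfl⟩ := hmesh t' ht'
    have hus := hu.trans (Finset.erase_subset a s)
    have h1 := h𝒯.subset_of_mem_openHull hs hs' hus hx
      (convexHull_mono (Finset.coe_subset.2 (Finset.erase_subset a' s')) hxt')
    exact subset_of_mem_openHull (h𝒯.simplex s' hs').2 h1 (Finset.erase_subset a' s') hx hxt'
  have hfin : (traceMesh 𝒯 f).Finite := by
    refine (h𝒯.finite.biUnion fun s _ => (s.powerset : Finset _).finite_toSet).subset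
      fun t ht => ?_
    obtain ⟨-, s, hs, a, ha, rfl⟩ := hmesh t ht
    exact mem_iUnion₂.2 ⟨s, hs, Finset.mem_coe.2 (Finset.mem_powerset.2 (Finset.erase_subset a s))⟩
  refine ⟨hν, ⟨hfin, fun t ht => ht.1, ?_, ?_, ?_⟩, ?_, fun x hx => (hflat hx).1,
    fun x hx => exists_ball_inter_plane_subset hf hx, fun t ht => (hmesh t ht).1⟩
  · refine Subset.antisymm (iUnion₂_subset fun t ht => ?_) (closure_minimal ?_ ?_)
    · rw [← closure_openHull ht.1.nonempty]
      exact closure_mono (hmesh t ht).1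
    · intro x hx
      have hcov : ∀ y ∈ f, ∃ s ∈ 𝒯, y ∈ convexHull ℝ (s : Set (E 3)) := by
        intro y hy
        have : y ∈ closure Ω := by
          obtain ⟨hyc, r, hr, h⟩ := hflat hy
          rw [Metric.mem_closure_iff]
          intro ε hε
          have hpos : 0 < min r ε / 2 := by positivity
          have hd : dist (y - (min r ε / 2) • ν) y < min r ε := by
            rw [dist_eq_norm, sub_sub_cancel_left, norm_neg, norm_smul, hν,
              Real.norm_of_nonneg hpos.le]
            linarith
          refine ⟨y - (min r ε / 2) • ν, (h _ (hd.trans_le (min_le_left _ _))).2 ?_, ?_⟩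
          · rw [inner_sub_right, hyc, inner_smul_right, real_inner_self_eq_norm_sq, hν]
            linarith
          · rw [dist_comm]
            exact hd.trans_le (min_le_right _ _)
        rw [← h𝒯.cover] at this
        simpa using this
      by_contra hxt
      have hU : IsOpen (⋃ t ∈ traceMesh 𝒯 f, convexHull ℝ (t : Set (E 3)))ᶜ :=
        (hfin.isClosed_biUnion fun t _ => isClosed_convexHull_finset t).isOpen_compl
      set U : Set f := ((↑) : f → E 3) ⁻¹' (⋃ t ∈ traceMesh 𝒯 f, convexHull ℝ (t : Set (E 3)))ᶜ
        with hUdef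
      have hUo : IsOpen U := hU.preimage continuous_subtype_val
      -- A finite Baire argument: what the tetrahedron `s` leaves of `V` is open and covered by the
      -- remaining ones, hence empty by induction. So `V` is contained in the interior of `f ∩ s`,
      -- which is an open trace triangle, whereas `V ⊆ U` avoids the trace mesh.
      have key : ∀ 𝒮 : Set (Finset (E 3)), 𝒮.Finite → 𝒮 ⊆ 𝒯 → ∀ V : Set f, IsOpen V → V ⊆ U →
          V ⊆ ((↑) : f → E 3) ⁻¹' (⋃ s ∈ 𝒮, convexHull ℝ (s : Set (E 3))) → V = ∅ := by
        intro 𝒮 h𝒮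
        induction 𝒮, h𝒮 using Set.Finite.induction_on with
        | empty =>
          intro _ V _ _ hV
          simpa [subset_empty_iff] using hV
        | @insert s 𝒮 _ _ ih =>
          intro hsub V hVo hVU hV
          have hs : s ∈ 𝒯 := hsub (mem_insert _ _)
          have hC : IsClosed (((↑) : f → E 3) ⁻¹' convexHull ℝ (s : Set (E 3))) :=
            (isClosed_convexHull_finset s).preimage continuous_subtype_val
          have h0 := ih ((subset_insert _ _).trans hsub) (V \ _) (hVo.sdiff hC)
            (sdiff_subset.trans hVU) fun y hy => by
              have := hV hy.1
              rw [biUnion_insert] at this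
              exact this.resolve_left hy.2
          rw [sdiff_eq_empty] at h0
          rw [eq_empty_iff_forall_notMem]
          rintro ⟨y, hyf⟩ hyV
          have hy := interior_maximal h0 hVo hyV
          obtain ⟨a, ha, hsub', heq⟩ := traceCells_facet hν hΩ h𝒯 hf hs ⟨_, hy, rfl⟩
          have hy' : y ∈ openHull (s.erase a) := heq ▸ ⟨_, hy, rfl⟩
          refine hVU hyV (mem_iUnion₂.2 ⟨s.erase a, ⟨?_, ⟨y, hy'⟩, s, hs, heq.symm⟩,
            openHull_subset_convexHull _ hy'⟩)
          exact (h𝒯.simplex s hs).subset (Finset.erase_subset a s) (by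
            rw [Finset.card_erase_of_mem ha.mem, (h𝒯.simplex s hs).1])
      have hU0 := key 𝒯 h𝒯.finite subset_rfl U hUo subset_rfl fun y _ => by
        obtain ⟨s, hs, hys⟩ := hcov y y.2
        exact mem_iUnion₂.2 ⟨s, hs, hys⟩
      exact eq_empty_iff_forall_notMem.1 hU0 ⟨x, hx⟩ hxt
    · exact hfin.isClosed_biUnion fun t _ => isClosed_convexHull_finset t
  · intro s hs t ht hst
    rw [Set.disjoint_left]
    intro x hxs hxt
    refine hst (Finset.eq_of_subset_of_card_le (hcarrier s hs s subset_rfl x hxs t ht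
      (openHull_subset_convexHull t hxt)) (by rw [hs.1.1, ht.1.1]))
  · intro s hs t ht hst
    refine Subset.antisymm ?_ (subset_inter (convexHull_mono inter_subset_left)
      (convexHull_mono inter_subset_right))
    rintro x ⟨hxs, hxt⟩
    obtain ⟨u, hu, hxu⟩ := exists_mem_openHull hs.1.2 hxs
    refine convexHull_mono ?_ (openHull_subset_convexHull u hxu)
    exact subset_inter (Finset.coe_subset.2 hu)
      (Finset.coe_subset.2 (hcarrier s hs u hu x hxu t ht hxt))
  · exact ⟨x₀, hf ▸ mem_connectedComponentIn hx₀⟩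

end TraceFEM

namespace TraceFEM

/-! ### Continuous piecewise affine functions on a face mesh -/

theorem vertices_finite {𝒯 : Set (Finset (E 3))} (h : 𝒯.Finite) : (vertices 𝒯).Finite := by
  refine (h.biUnion fun t _ => t.finite_toSet).subset ?_
  rintro p ⟨t, ht, hp⟩
  exact mem_iUnion₂.2 ⟨t, ht, hp⟩

/-- Values of the piecewise affine interpolant. -/
theorem sum_bary_mul_eq {s u : Finset (E 3)} (hs : AffineIndependent ℝ ((↑) : s → E 3))
    (hu : u ⊆ s) {w' : E 3 → ℝ} (hw : ∑ y ∈ u, w' y = 1) (w : E 3 → ℝ) :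
    ∑ q ∈ s, bary s q (∑ y ∈ u, w' y • y) * w q = ∑ q ∈ u, w' q * w q := by
  rw [← Finset.sum_subset hu fun q _ hqu => by rw [bary_sum_of_notMem hs hu hw hqu, zero_mul]]
  exact Finset.sum_congr rfl fun q hq => by rw [bary_sum hs hu hw hq]

open Classical in
/-- The piecewise affine interpolant of `w` at the vertices of the mesh `𝒯`. -/
def interpolant (𝒯 : Set (Finset (E 3))) (w : E 3 → ℝ) (x : E 3) : ℝ :=
  if h : ∃ t ∈ 𝒯, x ∈ convexHull ℝ (t : Set (E 3)) then
    ∑ q ∈ h.choose, bary h.choose q x * w q else 0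

namespace IsFaceMesh

variable {ν : E 3} {c : ℝ} {f : Set (E 3)} {𝒯 : Set (Finset (E 3))} {t : Finset (E 3)}
  {x p q : E 3}

theorem inner_eq_of_mem_closure (h : IsFaceMesh ν c f 𝒯) (hx : x ∈ closure f) :
    inner ℝ ν x = c := by
  have : IsClosed {x : E 3 | inner ℝ ν x = c} :=
    isClosed_eq (by fun_prop) continuous_const
  exact closure_minimal h.plane this hx

theorem indep (h : IsFaceMesh ν c f 𝒯) (ht : t ∈ 𝒯) : AffineIndependent ℝ ((↑) : t → E 3) :=
  (h.regular.simplex t ht).2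

theorem convexHull_subset (h : IsFaceMesh ν c f 𝒯) (ht : t ∈ 𝒯) :
    convexHull ℝ (t : Set (E 3)) ⊆ closure f := by
  rw [← h.regular.cover]
  exact subset_biUnion_of_mem (u := fun s : Finset (E 3) => convexHull ℝ (s : Set (E 3))) ht

theorem exists_mem_convexHull (h : IsFaceMesh ν c f 𝒯) (hx : x ∈ closure f) :
    ∃ t ∈ 𝒯, x ∈ convexHull ℝ (t : Set (E 3)) := by
  rw [← h.regular.cover] at hx
  simpa using hx

theorem mesh_nonempty (h : IsFaceMesh ν c f 𝒯) : 𝒯.Nonempty := by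
  obtain ⟨x, hx⟩ := h.nonempty
  obtain ⟨t, ht, -⟩ := h.exists_mem_convexHull (subset_closure hx)
  exact ⟨t, ht⟩

theorem inner_vertex (h : IsFaceMesh ν c f 𝒯) (ht : t ∈ 𝒯) (hp : p ∈ t) : inner ℝ ν p = c :=
  h.inner_eq_of_mem_closure (h.convexHull_subset ht (subset_convexHull ℝ _ hp))

/-- The direction of a triangle is a two-dimensional subspace of the orthogonal complement of `ν`,
hence all of it. Barycentric expansions with respect to `t` therefore hold on the whole plane, also
outside the triangle. -/
theorem mem_span (h : IsFaceMesh ν c f 𝒯) (ht : t ∈ 𝒯) (hx : inner ℝ ν x = c) :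
    x ∈ affineSpan ℝ (t : Set (E 3)) := by
  have htS := h.regular.simplex t ht
  obtain ⟨p, hp⟩ := htS.nonempty
  have hν0 : ν ≠ 0 := by
    intro h0
    have := h.norm_eq
    simp [h0] at this
  have hle : vectorSpan ℝ (t : Set (E 3)) ≤ (ℝ ∙ ν)ᗮ := by
    rw [vectorSpan_def, Submodule.span_le]
    rintro _ ⟨a, ha, b, hb, rfl⟩
    rw [SetLike.mem_coe, Submodule.mem_orthogonal_singleton_iff_inner_right]
    change inner ℝ ν (a - b) = 0
    rw [inner_sub_right, h.inner_vertex ht ha, h.inner_vertex ht hb, sub_self]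
  have hfin : Module.finrank ℝ (ℝ ∙ ν)ᗮ = 2 :=
    have : Fact (Module.finrank ℝ (E 3) = 2 + 1) := ⟨by simp⟩
    Submodule.finrank_orthogonal_span_singleton hν0
  have hfin' : Module.finrank ℝ (vectorSpan ℝ (t : Set (E 3))) = 2 := by
    have := htS.2.finrank_vectorSpan (n := 2) (by simp [htS.1])
    have e : vectorSpan ℝ (range ((↑) : t → E 3)) = vectorSpan ℝ (t : Set (E 3)) := by
      congr 1
      exact Subtype.range_coe
    rw [← this]
    exact (LinearEquiv.ofEq _ _ e).symm.finrank_eq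
  have heq := Submodule.eq_of_le_of_finrank_eq hle (hfin'.trans hfin.symm)
  have : x -ᵥ p ∈ vectorSpan ℝ (t : Set (E 3)) := by
    rw [heq, Submodule.mem_orthogonal_singleton_iff_inner_right]
    change inner ℝ ν (x - p) = 0
    rw [inner_sub_right, h.inner_vertex ht hp, hx, sub_self]
  rw [← direction_affineSpan] at this
  exact (AffineSubspace.vsub_right_mem_direction_iff_mem (mem_affineSpan ℝ hp) x).1 this

theorem mem_openHull (h : IsFaceMesh ν c f 𝒯) (ht : t ∈ 𝒯) (hx : inner ℝ ν x = c) :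
    x ∈ openHull t ↔ ∀ p ∈ t, 0 < bary t p x := by
  rw [mem_openHull_iff_bary (h.indep ht)]
  exact and_iff_right (h.mem_span ht hx)

theorem cells_subset (h : IsFaceMesh ν c f 𝒯) : cells 𝒯 ⊆ f :=
  iUnion₂_subset h.openHull_subset

/-- A continuous piecewise affine function in terms of its values at the vertices. -/
theorem S1_apply (h : IsFaceMesh ν c f 𝒯) (v : S1 𝒯 f) (ht : t ∈ 𝒯)
    (hx : x ∈ convexHull ℝ (t : Set (E 3))) :
    (v : E 3 → ℝ) x = ∑ p ∈ t, bary t p x * (v : E 3 → ℝ) p := by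
  obtain ⟨v, hv0, hvc, hv⟩ := v
  obtain ⟨g, hg⟩ := hv t ht
  have hne := (h.regular.simplex t ht).nonempty
  have heq : EqOn v g (convexHull ℝ (t : Set (E 3))) :=
    EqOn.of_subset_closure hg (hvc.mono (h.convexHull_subset ht)) (continuous_affine g).continuousOn
      (openHull_subset_convexHull t) (closure_openHull hne).ge
  change v x = _
  rw [heq hx, affine_eq_sum (h.indep ht) g (convexHull_subset_affineSpan' t hx)]
  refine Finset.sum_congr rfl fun p hp => ?_
  exact congrArg _ (heq (subset_convexHull ℝ _ hp)).symm

theorem S1_ext (h : IsFaceMesh ν c f 𝒯) {v w : S1 𝒯 f}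
    (hvw : ∀ p ∈ vertices 𝒯, (v : E 3 → ℝ) p = (w : E 3 → ℝ) p) : v = w := by
  refine Subtype.ext (funext fun x => ?_)
  by_cases hx : x ∈ closure f
  · obtain ⟨t, ht, hxt⟩ := h.exists_mem_convexHull hx
    rw [h.S1_apply v ht hxt, h.S1_apply w ht hxt]
    exact Finset.sum_congr rfl fun p hp => by rw [hvw p ⟨t, ht, hp⟩]
  · rw [v.2.1 x hx, w.2.1 x hx]

/-- The value does not depend on the chosen triangle: all triangles containing `x` have the face
that carries `x`, and only the vertices of this face have nonzero coordinates at `x`. -/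
theorem interpolant_apply (h : IsFaceMesh ν c f 𝒯) (w : E 3 → ℝ) (ht : t ∈ 𝒯)
    (hx : x ∈ convexHull ℝ (t : Set (E 3))) :
    interpolant 𝒯 w x = ∑ p ∈ t, bary t p x * w p := by
  have hex : ∃ t ∈ 𝒯, x ∈ convexHull ℝ (t : Set (E 3)) := ⟨t, ht, hx⟩
  rw [interpolant, dif_pos hex]
  obtain ⟨ht', hx'⟩ := hex.choose_spec
  obtain ⟨u, hu, hxu⟩ := exists_mem_openHull (h.indep ht) hx
  have hu' := h.regular.subset_of_mem_openHull ht ht' hu hxu hx'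
  obtain ⟨w', -, hw1, hw2⟩ := hxu
  have h1 := sum_bary_mul_eq (h.indep ht) hu hw1 w
  have h2 := sum_bary_mul_eq (h.indep ht') hu' hw1 w
  rw [hw2] at h1 h2
  rw [h1, h2]

theorem interpolant_mem (h : IsFaceMesh ν c f 𝒯) (w : E 3 → ℝ) : interpolant 𝒯 w ∈ S1 𝒯 f := by
  have haff : ∀ t ∈ 𝒯, ∃ g : E 3 →ᵃ[ℝ] ℝ, ∀ x ∈ convexHull ℝ (t : Set (E 3)),
      interpolant 𝒯 w x = g x := by
    intro t ht
    obtain ⟨g, hg⟩ := exists_affine_eq (h.indep ht) w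
    refine ⟨g, fun x hx => ?_⟩
    rw [h.interpolant_apply w ht hx, affine_eq_sum (h.indep ht) g (convexHull_subset_affineSpan' t hx)]
    exact Finset.sum_congr rfl fun p hp => by rw [hg p hp, smul_eq_mul]
  refine ⟨fun x hx => ?_, ?_, fun t ht => ?_⟩
  · rw [interpolant, dif_neg]
    rintro ⟨t, ht, hxt⟩
    exact hx (h.convexHull_subset ht hxt)
  · rw [← h.regular.cover, biUnion_eq_iUnion]
    have := h.regular.finite.to_subtype
    refine (locallyFinite_of_finite _).continuousOn_iUnion
      (fun t : 𝒯 => isClosed_convexHull_finset t) fun t => ?_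
    obtain ⟨g, hg⟩ := haff t t.2
    exact (continuous_affine g).continuousOn.congr hg
  · obtain ⟨g, hg⟩ := haff t ht
    exact ⟨g, fun x hx => hg x (openHull_subset_convexHull t hx)⟩

theorem interpolant_vertex (h : IsFaceMesh ν c f 𝒯) (w : E 3 → ℝ) (hp : p ∈ vertices 𝒯) :
    interpolant 𝒯 w p = w p := by
  obtain ⟨t, ht, hpt⟩ := hp
  rw [h.interpolant_apply w ht (subset_convexHull ℝ _ hpt), Finset.sum_eq_single p]
  · rw [bary_self (h.indep ht) hpt, one_mul]
  · intro q _ hne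
    rw [bary_ne (h.indep ht) hpt hne.symm, zero_mul]
  · exact fun h' => absurd hpt h'

/-- The values at the vertices are coordinates of the continuous piecewise affine functions. -/
def S1Equiv (h : IsFaceMesh ν c f 𝒯) : S1 𝒯 f ≃ₗ[ℝ] (vertices 𝒯 → ℝ) :=
  LinearEquiv.ofBijective
    ({ toFun := fun (v : S1 𝒯 f) (p : vertices 𝒯) => (v : E 3 → ℝ) (p : E 3)
       map_add' := fun _ _ => rfl
       map_smul' := fun _ _ => rfl } : S1 𝒯 f →ₗ[ℝ] vertices 𝒯 → ℝ)
    ⟨fun v w hvw => h.S1_ext fun p hp => congrFun hvw ⟨p, hp⟩, fun w => by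
      classical
      refine ⟨⟨_, h.interpolant_mem fun p => if hp : p ∈ vertices 𝒯 then w ⟨p, hp⟩ else 0⟩,
        funext fun p => ?_⟩
      change interpolant 𝒯 _ (p : E 3) = _
      rw [h.interpolant_vertex _ p.2, dif_pos p.2]⟩

theorem S1Equiv_apply (h : IsFaceMesh ν c f 𝒯) (v : S1 𝒯 f) (p : vertices 𝒯) :
    h.S1Equiv v p = (v : E 3 → ℝ) p := rfl

theorem finrank_S1 (h : IsFaceMesh ν c f 𝒯) :
    Module.finrank ℝ (S1 𝒯 f) = (vertices 𝒯).ncard := by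
  have := (vertices_finite h.regular.finite).fintype
  rw [h.S1Equiv.finrank_eq, Module.finrank_pi, ← Nat.card_eq_fintype_card, Nat.card_coe_set_eq]

theorem existsUnique_isNodal (h : IsFaceMesh ν c f 𝒯) :
    ∃! θ : vertices 𝒯 → S1 𝒯 f, IsNodal θ := by
  refine ⟨fun p => h.S1Equiv.symm fun q => Set.indicator {p} (fun _ => (1 : ℝ)) q,
    fun p q => ?_, fun θ hθ => funext fun p => ?_⟩
  · rw [← h.S1Equiv_apply, LinearEquiv.apply_symm_apply]
  · rw [LinearEquiv.eq_symm_apply]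
    exact funext fun q => (h.S1Equiv_apply (θ p) q).trans (hθ p q)

theorem _root_.TraceFEM.IsNodal.self {θ : vertices 𝒯 → S1 𝒯 f} (hθ : IsNodal θ)
    (p : vertices 𝒯) : (θ p : E 3 → ℝ) p = 1 := by
  rw [hθ p p, indicator_of_mem (mem_singleton _)]

theorem _root_.TraceFEM.IsNodal.ne {θ : vertices 𝒯 → S1 𝒯 f} (hθ : IsNodal θ)
    (p : vertices 𝒯) (hq : q ∈ vertices 𝒯) (hne : q ≠ p) : (θ p : E 3 → ℝ) q = 0 := by
  have h1 : (⟨q, hq⟩ : vertices 𝒯) ∉ ({p} : Set (vertices 𝒯)) := fun h' =>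
    hne (congrArg Subtype.val (mem_singleton_iff.1 h'))
  have := hθ p ⟨q, hq⟩
  rwa [indicator_of_notMem h1] at this

theorem isNodal_apply (h : IsFaceMesh ν c f 𝒯) {θ : vertices 𝒯 → S1 𝒯 f} (hθ : IsNodal θ)
    (p : vertices 𝒯) (ht : t ∈ 𝒯) (hp : (p : E 3) ∈ t) (hx : x ∈ convexHull ℝ (t : Set (E 3))) :
    (θ p : E 3 → ℝ) x = bary t p x := by
  rw [h.S1_apply _ ht hx, Finset.sum_eq_single (p : E 3)]
  · rw [hθ.self, mul_one]
  · intro q hq hne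
    rw [hθ.ne p ⟨t, ht, hq⟩ hne, mul_zero]
  · exact fun h' => absurd hp h'

theorem isNodal_apply_of_notMem (h : IsFaceMesh ν c f 𝒯) {θ : vertices 𝒯 → S1 𝒯 f}
    (hθ : IsNodal θ) (p : vertices 𝒯) (ht : t ∈ 𝒯) (hp : (p : E 3) ∉ t)
    (hx : x ∈ convexHull ℝ (t : Set (E 3))) : (θ p : E 3 → ℝ) x = 0 := by
  rw [h.S1_apply _ ht hx]
  refine Finset.sum_eq_zero fun q hq => ?_
  rw [hθ.ne p ⟨t, ht, hq⟩ fun h' => hp (h' ▸ hq), mul_zero]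

theorem isNodal_nonneg (h : IsFaceMesh ν c f 𝒯) {θ : vertices 𝒯 → S1 𝒯 f}
    (hθ : IsNodal θ) (p : vertices 𝒯) (hx : x ∈ closure f) : 0 ≤ (θ p : E 3 → ℝ) x := by
  obtain ⟨t, ht, hxt⟩ := h.exists_mem_convexHull hx
  by_cases hp : (p : E 3) ∈ t
  · rw [h.isNodal_apply hθ p ht hp hxt]
    exact ((mem_convexHull_iff_bary (h.indep ht)).1 hxt).2 p hp
  · rw [h.isNodal_apply_of_notMem hθ p ht hp hxt]

theorem eq_sum_isNodal (h : IsFaceMesh ν c f 𝒯) [Fintype (vertices 𝒯)]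
    {θ : vertices 𝒯 → S1 𝒯 f} (hθ : IsNodal θ) (v : S1 𝒯 f) (x : E 3) :
    (v : E 3 → ℝ) x = ∑ p : vertices 𝒯, (v : E 3 → ℝ) (p : E 3) * (θ p : E 3 → ℝ) x := by
  have key : ∀ y, ((∑ p : vertices 𝒯, (v : E 3 → ℝ) (p : E 3) • θ p : S1 𝒯 f) : E 3 → ℝ) y =
      ∑ p : vertices 𝒯, (v : E 3 → ℝ) (p : E 3) * (θ p : E 3 → ℝ) y := fun y => by
    rw [Submodule.coe_sum, Finset.sum_apply]
    rfl
  rw [← key]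
  refine congrFun (congrArg Subtype.val (h.S1_ext (v := v) fun q hq => ?_)) x
  rw [key, Finset.sum_eq_single ⟨q, hq⟩]
  · have := hθ.self ⟨q, hq⟩
    simp only at this
    rw [this, mul_one]
  · intro p _ hne
    rw [hθ.ne p hq fun h' => hne (Subtype.ext h'.symm), mul_zero]
  · exact fun h' => absurd (Finset.mem_univ _) h'

end IsFaceMesh

end TraceFEM

namespace TraceFEM

/-! ### Shape regularity bounds the number of triangles at a vertex -/

/-- Cover the unit ball by finitely many balls of radius `δ / 2`; each of them contains at most one
of the separated points. -/
theorem exists_card_le_of_separated {V : Type*} [NormedAddCommGroup V] [ProperSpace V] {δ : ℝ}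
    (hδ : 0 < δ) : ∃ N : ℕ, ∀ {ι : Type} (T : Finset ι) (y : ι → V),
      (∀ i ∈ T, ‖y i‖ ≤ 1) → (∀ i ∈ T, ∀ j ∈ T, i ≠ j → δ ≤ dist (y i) (y j)) → T.card ≤ N := by
  obtain ⟨C, -, hC, hcov⟩ := (isCompact_closedBall (0 : V) 1).finite_cover_balls (half_pos hδ)
  refine ⟨hC.toFinset.card, fun {ι} T y h1 h2 => ?_⟩
  have h3 : ∀ i : T, ∃ z ∈ C, dist (y i) z < δ / 2 := fun i => by
    have := hcov (mem_closedBall_zero_iff.2 (h1 i i.2))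
    simpa using this
  choose z hz hzd using h3
  rw [← Finset.card_attach]
  refine Finset.card_le_card_of_injOn z (fun i _ => by simpa using hz i) fun i _ j _ hij => ?_
  by_contra hne
  have h4 := h2 i i.2 j j.2 fun h => hne (Subtype.ext h)
  have h5 := hzd i
  have h6 := hzd j
  rw [← hij, dist_comm] at h6
  linarith [dist_triangle (y i) (z i) (y j)]

namespace IsFaceMesh

variable {ν : E 3} {c : ℝ} {f : Set (E 3)} {𝒯 : Set (Finset (E 3))} {s t e : Finset (E 3)}
  {x p q n : E 3}

theorem eq_of_mem_openHull (h : IsFaceMesh ν c f 𝒯) (hs : s ∈ 𝒯) (ht : t ∈ 𝒯)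
    (hxs : x ∈ openHull s) (hxt : x ∈ convexHull ℝ (t : Set (E 3))) : s = t :=
  Finset.eq_of_subset_of_card_le (h.regular.subset_of_mem_openHull hs ht subset_rfl hxs hxt)
    (by rw [(h.regular.simplex s hs).1, (h.regular.simplex t ht).1])

theorem isBounded_convexHull (t : Finset (E 3)) :
    Bornology.IsBounded (convexHull ℝ (t : Set (E 3))) :=
  (t.finite_toSet.isCompact_convexHull (𝕜 := ℝ)).isBounded

/-- Without a bound the `sSup` in `inradius` would take its default value. A disc of radius `r` in
the triangle contains two points at distance `r`, so the diameter is a bound. -/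
theorem inradius_bddAbove (ht : IsSimplex 2 t) : BddAbove {r | 0 ≤ r ∧
    ∃ x ∈ affineSpan ℝ (t : Set (E 3)), Metric.closedBall x r ∩ affineSpan ℝ (t : Set (E 3)) ⊆
      convexHull ℝ (t : Set (E 3))} := by
  refine ⟨Metric.diam (convexHull ℝ (t : Set (E 3))), ?_⟩
  rintro r ⟨hr, x, hx, hsub⟩
  obtain ⟨p, hp, q, hq, hpq⟩ := Finset.one_lt_card.1 (by rw [ht.1]; norm_num : 1 < t.card)
  have hn : 0 < ‖q - p‖ := norm_pos_iff.2 (sub_ne_zero.2 hpq.symm)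
  set y := x + (r / ‖q - p‖) • (q - p) with hy
  have hd : dist y x = r := by
    rw [hy, dist_eq_norm, add_sub_cancel_left, norm_smul, Real.norm_of_nonneg (by positivity),
      div_mul_cancel₀ _ hn.ne']
  have hys : y ∈ affineSpan ℝ (t : Set (E 3)) := by
    have := AffineSubspace.smul_vsub_vadd_mem _ (r / ‖q - p‖)
      (mem_affineSpan ℝ (Finset.mem_coe.2 hq)) (mem_affineSpan ℝ (Finset.mem_coe.2 hp)) hx
    rw [hy, add_comm]
    exact this
  have h1 := hsub ⟨Metric.mem_closedBall.2 hd.le, hys⟩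
  have h2 := hsub ⟨Metric.mem_closedBall_self hr, hx⟩
  rw [← hd]
  exact Metric.dist_le_diam_of_mem (isBounded_convexHull t) h1 h2

theorem inradius_pos (ht : IsSimplex 2 t) : 0 < inradius t := by
  obtain ⟨x, hx⟩ := openHull_nonempty ht.nonempty
  obtain ⟨hxs, hb⟩ := (mem_openHull_iff_bary ht.2).1 hx
  have hev : ∀ᶠ y in 𝓝 x, ∀ p ∈ t, 0 < bary t p y := by
    rw [eventually_all_finset]
    exact fun p hp => (continuous_affine (bary t p)).continuousAt.eventually
      (lt_mem_nhds (hb p hp))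
  obtain ⟨r, hr, hball⟩ := Metric.eventually_nhds_iff_ball.1 hev
  refine lt_of_lt_of_le (half_pos hr) (le_csSup (inradius_bddAbove ht)
    ⟨(half_pos hr).le, x, hxs, ?_⟩)
  rintro y ⟨hy, hys⟩
  refine (mem_convexHull_iff_bary ht.2).2 ⟨hys, fun p hp => (hball y ?_ p hp).le⟩
  exact Metric.closedBall_subset_ball (half_lt_self hr) hy

theorem diam_le (h : IsFaceMesh ν c f 𝒯) {K : ℝ} (hK : shapeRegularity 𝒯 ≤ K) (ht : t ∈ 𝒯) :
    Metric.diam (convexHull ℝ (t : Set (E 3))) ≤ K * inradius t := by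
  have := h.regular.finite.to_subtype
  have h1 := (le_ciSup (f := fun t : 𝒯 => Metric.diam (convexHull ℝ
    ((t : Finset (E 3)) : Set (E 3))) / inradius t) (Set.finite_range _).bddAbove ⟨t, ht⟩).trans hK
  exact (div_le_iff₀ (inradius_pos (h.regular.simplex t ht))).1 h1

/-- Normalize each triangle at `p` by the homothety with centre `p` and factor one over its
diameter. By shape regularity it then contains a disc of fixed radius `δ` whose centre is in the
unit ball around `p`. Since the triangles do not overlap, these centres are `δ`-separated, and
packing bounds their number. -/
theorem exists_valence_le (K : ℝ) : ∃ N : ℕ, ∀ {ν : E 3} {c : ℝ} {f : Set (E 3)}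
    {𝒯 : Set (Finset (E 3))}, IsFaceMesh ν c f 𝒯 → shapeRegularity 𝒯 ≤ K → ∀ p,
      {t ∈ 𝒯 | p ∈ t}.ncard ≤ N := by
  -- The maximum keeps `δ` positive. The factor 2 in `δ` makes room for a disc of more than half the
  -- inradius, so that the supremum need not be attained.
  set K' := max K 1
  have hK' : 0 < K' := lt_max_of_lt_right one_pos
  set δ := 1 / (2 * K') with hδ
  have hδ0 : 0 < δ := by positivity
  obtain ⟨N, hN⟩ := exists_card_le_of_separated (V := E 3) hδ0
  refine ⟨N, fun {ν c f 𝒯} h hK p => ?_⟩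
  have hfin : {t ∈ 𝒯 | p ∈ t}.Finite := h.regular.finite.subset (sep_subset _ _)
  rw [Set.ncard_eq_toFinset_card _ hfin]
  set d : Finset (E 3) → ℝ := fun t => Metric.diam (convexHull ℝ (t : Set (E 3))) with hd
  have hmem : ∀ t ∈ hfin.toFinset, t ∈ 𝒯 ∧ p ∈ t := fun t ht => by simpa using ht
  have hdpos : ∀ t ∈ 𝒯, 0 < d t := by
    intro t ht
    obtain ⟨p, hp, q, hq, hpq⟩ := Finset.one_lt_card.1
      (by rw [(h.regular.simplex t ht).1]; norm_num : 1 < t.card)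
    exact (dist_pos.2 hpq).trans_le (Metric.dist_le_diam_of_mem (isBounded_convexHull t)
      (subset_convexHull ℝ _ hp) (subset_convexHull ℝ _ hq))
  have hex : ∀ t : Finset (E 3), ∃ z : E 3, t ∈ 𝒯 → inner ℝ ν z = c ∧
      z ∈ convexHull ℝ (t : Set (E 3)) ∧
      ∀ w, inner ℝ ν w = c → dist w z < d t * δ → w ∈ convexHull ℝ (t : Set (E 3)) := by
    intro t
    by_cases ht : t ∈ 𝒯
    · have hpos := inradius_pos (h.regular.simplex t ht)
      obtain ⟨r, ⟨hr0, z, hz, hsub⟩, hr⟩ := exists_lt_of_lt_csSup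
        (s := {r | 0 ≤ r ∧ ∃ x ∈ affineSpan ℝ (t : Set (E 3)), Metric.closedBall x r ∩
          affineSpan ℝ (t : Set (E 3)) ⊆ convexHull ℝ (t : Set (E 3))})
        (by
          by_contra hne
          rw [not_nonempty_iff_eq_empty] at hne
          rw [inradius, hne, Real.sSup_empty] at hpos
          exact hpos.false) (half_lt_self hpos)
      have hzt := hsub ⟨Metric.mem_closedBall_self hr0, hz⟩
      refine ⟨z, fun _ => ⟨h.inner_eq_of_mem_closure (h.convexHull_subset ht hzt), hzt,
        fun w hw hwz => hsub ⟨Metric.mem_closedBall.2 (hwz.le.trans ?_), h.mem_span ht hw⟩⟩⟩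
      refine le_trans ?_ hr.le
      have h1 : d t ≤ K' * inradius t := (h.diam_le hK ht).trans
        (mul_le_mul_of_nonneg_right (le_max_left _ _) hpos.le)
      change d t * δ ≤ inradius t / 2
      rw [hδ, mul_one_div, div_le_iff₀ (by positivity)]
      linarith
    · exact ⟨0, fun h => absurd h ht⟩
  choose z hz using hex
  refine hN hfin.toFinset (fun t => (d t)⁻¹ • (z t - p)) (fun t ht => ?_) fun s hs t ht hst => ?_
  · obtain ⟨ht, hp⟩ := hmem t ht
    rw [norm_smul, norm_inv, Real.norm_of_nonneg (hdpos t ht).le, inv_mul_le_iff₀ (hdpos t ht),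
      mul_one, ← dist_eq_norm]
    exact Metric.dist_le_diam_of_mem (isBounded_convexHull t) (hz t ht).2.1
      (subset_convexHull ℝ _ hp)
  · obtain ⟨hs, hps⟩ := hmem s hs
    obtain ⟨ht, hpt⟩ := hmem t ht
    by_contra hlt
    rw [not_le] at hlt
    -- Bring both triangles to the common size `r`. A homothety towards the vertex `p` with factor
    -- at most one maps a triangle into itself, so the shrunken discs stay in the original
    -- triangles, which then would overlap.
    set r := min (d s) (d t) with hr
    have hr0 : 0 < r := lt_min (hdpos s hs) (hdpos t ht)
    have hpc := h.inner_vertex hs hps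
    set y : Finset (E 3) → E 3 := fun t => p + r • (d t)⁻¹ • (z t - p) with hy
    have hyt : y t ∈ convexHull ℝ (t : Set (E 3)) := by
      rw [hy]
      simp only
      rw [smul_smul]
      refine (convex_convexHull ℝ _).add_smul_sub_mem (subset_convexHull ℝ _ hpt) (hz t ht).2.1
        ⟨mul_nonneg hr0.le (inv_nonneg.2 (hdpos t ht).le), ?_⟩
      rw [← div_eq_mul_inv, div_le_one (hdpos t ht)]
      exact min_le_right _ _
    have hys : ∀ w, inner ℝ ν w = c → dist w (y s) < r * δ →
        w ∈ convexHull ℝ (s : Set (E 3)) := by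
      intro w hwc hw
      have hds := hdpos s hs
      have hw' : w = p + (r / d s) • ((p + (d s / r) • (w - p)) - p) := by
        rw [add_sub_cancel_left, smul_smul, div_mul_div_cancel₀ hds.ne', div_self hr0.ne', one_smul]
        abel
      rw [hw']
      refine (convex_convexHull ℝ _).add_smul_sub_mem (subset_convexHull ℝ _ hps)
        ((hz s hs).2.2 _ ?_ ?_) ⟨by positivity, (div_le_one hds).2 (min_le_left _ _)⟩
      · rw [inner_add_right, inner_smul_right, inner_sub_right, hwc, hpc]; ring
      · have e1 : p + (d s / r) • (w - p) - z s = (d s / r) • (w - y s) := by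
          have e2 : z s - p = (d s / r) • (r • (d s)⁻¹ • (z s - p)) := by
            rw [smul_smul, smul_smul, show d s / r * r * (d s)⁻¹ = 1 by field_simp, one_smul]
          rw [hy]
          simp only
          rw [← sub_sub, smul_sub (d s / r) (w - p), ← e2]
          abel
        rw [dist_eq_norm, e1, norm_smul, Real.norm_of_nonneg (by positivity), ← dist_eq_norm,
          div_mul_eq_mul_div, div_lt_iff₀ hr0, mul_assoc]
        exact mul_lt_mul_of_pos_left (by linarith) hds
    have hd' : dist (y t) (y s) < r * δ := by
      rw [dist_comm, dist_eq_norm, hy]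
      simp only
      rw [add_sub_add_left_eq_sub, ← smul_sub, norm_smul, Real.norm_of_nonneg hr0.le,
        ← dist_eq_norm]
      exact mul_lt_mul_of_pos_left hlt hr0
    -- The centre belongs only to the closed triangle `t`; a nearby point of the open triangle still
    -- lies in the disc in `s`.
    rw [← closure_openHull (h.regular.simplex t ht).nonempty] at hyt
    obtain ⟨w, hw, hwt⟩ := mem_closure_iff_nhds.1 hyt _ (Metric.isOpen_ball.mem_nhds hd')
    have hwc := h.plane w (h.openHull_subset t ht hwt)
    exact hst (h.eq_of_mem_openHull ht hs hwt (hys w hwc hw)).symm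

/-- Select one vertex of each triangle; each vertex is selected at most `N` times. -/
theorem ncard_le_mul_ncard_vertices (h : IsFaceMesh ν c f 𝒯) {N : ℕ}
    (hN : ∀ p, {t ∈ 𝒯 | p ∈ t}.ncard ≤ N) : 𝒯.ncard ≤ N * (vertices 𝒯).ncard := by
  classical
  have hfin := h.regular.finite
  have hex : ∀ t : Finset (E 3), ∃ p, t ∈ 𝒯 → p ∈ t := fun t => by
    by_cases ht : t ∈ 𝒯
    · obtain ⟨p, hp⟩ := (h.regular.simplex t ht).nonempty
      exact ⟨p, fun _ => hp⟩
    · exact ⟨0, fun h => absurd h ht⟩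
  choose g hg using hex
  rw [Set.ncard_eq_toFinset_card _ hfin]
  refine (Finset.card_le_mul_card_image (f := g) hfin.toFinset N fun p _ => ?_).trans
    (Nat.mul_le_mul_left N ?_)
  · refine le_trans ?_ (hN p)
    rw [← Set.ncard_coe_finset]
    refine Set.ncard_le_ncard (fun t ht => ?_) (hfin.subset (sep_subset _ _))
    simp only [Finset.coe_filter, Set.Finite.mem_toFinset, mem_ofPred_eq] at ht
    exact ⟨ht.1, ht.2 ▸ hg t ht.1⟩
  · rw [← Set.ncard_coe_finset]
    refine Set.ncard_le_ncard ?_ (vertices_finite hfin)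
    intro p hp
    simp only [Finset.coe_image, mem_image, Finset.mem_coe, Set.Finite.mem_toFinset] at hp
    obtain ⟨t, ht, rfl⟩ := hp
    exact ⟨t, ht, hg t ht⟩

end IsFaceMesh

end TraceFEM

namespace TraceFEM

/-! ### Dimensions of the spaces of discontinuous functions -/

theorem inner_cross_left (u v : E 3) : inner ℝ (cross u v) u = (0 : ℝ) := by
  simp [cross, PiLp.inner_apply, Fin.sum_univ_three, cross_apply]
  ring

theorem cross_cross_left (u v w : E 3) :
    cross (cross u v) w = (inner ℝ u w : ℝ) • v - (inner ℝ v w : ℝ) • u := by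
  ext i
  fin_cases i <;>
    simp [cross, PiLp.inner_apply, Fin.sum_univ_three, cross_apply] <;> ring

theorem cross_cross_self (u v : E 3) :
    cross u (cross u v) = (inner ℝ u v : ℝ) • u - (inner ℝ u u : ℝ) • v := by
  rw [real_inner_self_eq_norm_sq, EuclideanSpace.norm_sq_eq, Fin.sum_univ_three]
  ext i
  fin_cases i <;>
    simp [cross, PiLp.inner_apply, Fin.sum_univ_three, cross_apply] <;> ring

/-- The cross product with a fixed vector. -/
def crossₗ (u : E 3) : E 3 →ₗ[ℝ] E 3 where
  toFun := cross u
  map_add' := cross_add_right u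
  map_smul' := fun c v => cross_smul_right c u v

theorem crossₗ_apply (u v : E 3) : crossₗ u v = cross u v := rfl

/-- The function that coincides with `g t` on the open triangle `t`, for all triangles of a mesh,
and vanishes elsewhere. -/
def piecewise {W : Type*} [AddCommGroup W] (𝒯 : Set (Finset (E 3))) [Fintype 𝒯]
    (g : 𝒯 → E 3 → W) (x : E 3) : W :=
  ∑ t : 𝒯, (openHull (t : Finset (E 3))).indicator (g t) x

theorem piecewise_of_notMem {W : Type*} [AddCommGroup W] {𝒯 : Set (Finset (E 3))} [Fintype 𝒯]
    (g : 𝒯 → E 3 → W) {x : E 3} (hx : x ∉ cells 𝒯) : piecewise 𝒯 g x = 0 :=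
  Finset.sum_eq_zero fun t _ => indicator_of_notMem
    (fun h => hx (mem_iUnion₂.2 ⟨t, t.2, h⟩)) _

namespace IsFaceMesh

variable {ν : E 3} {c : ℝ} {f : Set (E 3)} {𝒯 : Set (Finset (E 3))} {s t e : Finset (E 3)}
  {x p q n : E 3} {W : Type*} [AddCommGroup W]

theorem piecewise_apply [Fintype 𝒯] (h : IsFaceMesh ν c f 𝒯) (g : 𝒯 → E 3 → W) (t : 𝒯)
    (hx : x ∈ openHull (t : Finset (E 3))) : piecewise 𝒯 g x = g t x := by
  rw [piecewise, Finset.sum_eq_single t]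
  · rw [indicator_of_mem hx]
  · intro s _ hne
    exact indicator_of_notMem (fun hs => hne (Subtype.ext (h.eq_of_mem_openHull s.2 t.2 hs
      (openHull_subset_convexHull _ hx)))) _
  · exact fun h' => absurd (Finset.mem_univ _) h'

/-- The values on the triangles are coordinates of the piecewise constant functions. -/
theorem finrank_S0 (h : IsFaceMesh ν c f 𝒯) : Module.finrank ℝ (S0 𝒯) = 𝒯.ncard := by
  have := h.regular.finite.fintype
  choose z hz using fun t : 𝒯 => openHull_nonempty (h.regular.simplex t t.2).nonempty
  let L : S0 𝒯 →ₗ[ℝ] (𝒯 → ℝ) :=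
    { toFun := fun (v : S0 𝒯) (t : 𝒯) => (v : E 3 → ℝ) (z t)
      map_add' := fun _ _ => rfl
      map_smul' := fun _ _ => rfl }
  have hL : Function.Bijective L := by
    constructor
    · intro v w hvw
      refine Subtype.ext (funext fun x => ?_)
      by_cases hx : x ∈ cells 𝒯
      · obtain ⟨t, ht, hxt⟩ := mem_iUnion₂.1 hx
        obtain ⟨a, ha⟩ := v.2.2 t ht
        obtain ⟨b, hb⟩ := w.2.2 t ht
        have : (v : E 3 → ℝ) (z ⟨t, ht⟩) = (w : E 3 → ℝ) (z ⟨t, ht⟩) := congrFun hvw ⟨t, ht⟩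
        rw [ha _ (hz ⟨t, ht⟩), hb _ (hz ⟨t, ht⟩)] at this
        rw [ha x hxt, hb x hxt, this]
      · rw [v.2.1 x hx, w.2.1 x hx]
    · intro w
      refine ⟨⟨piecewise 𝒯 fun t _ => w t, fun x hx => piecewise_of_notMem _ hx,
        fun t ht => ⟨w ⟨t, ht⟩, fun x hx => h.piecewise_apply _ ⟨t, ht⟩ hx⟩⟩, funext fun t => ?_⟩
      exact h.piecewise_apply (fun t _ => w t) t (hz t)
  rw [(LinearEquiv.ofBijective L hL).finrank_eq, Module.finrank_pi, ← Nat.card_eq_fintype_card,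
    Nat.card_coe_set_eq]

/-- Piecewise fields of the form `a + c A x`. -/
def pieceField (𝒯 : Set (Finset (E 3))) [Fintype 𝒯] (A : E 3 →ₗ[ℝ] E 3) :
    (𝒯 → E 3 × ℝ) →ₗ[ℝ] (E 3 → E 3) where
  toFun ξ := piecewise 𝒯 fun t y => (ξ t).1 + (ξ t).2 • A y
  map_add' ξ η := by
    funext x
    rw [Pi.add_apply, piecewise, piecewise, piecewise, ← Finset.sum_add_distrib]
    refine Finset.sum_congr rfl fun t _ => ?_
    by_cases hx : x ∈ openHull (t : Finset (E 3))
    · simp only [indicator_of_mem hx, Pi.add_apply, Prod.fst_add, Prod.snd_add, add_smul]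
      abel
    · simp [indicator_of_notMem hx]
  map_smul' k ξ := by
    funext x
    rw [RingHom.id_apply, Pi.smul_apply, piecewise, piecewise, Finset.smul_sum]
    refine Finset.sum_congr rfl fun t _ => ?_
    by_cases hx : x ∈ openHull (t : Finset (E 3))
    · simp only [indicator_of_mem hx, Pi.smul_apply, Prod.smul_fst, Prod.smul_snd, smul_add,
        smul_assoc]
    · simp [indicator_of_notMem hx]

theorem pieceField_apply [Fintype 𝒯] (h : IsFaceMesh ν c f 𝒯) (A : E 3 →ₗ[ℝ] E 3)
    (ξ : 𝒯 → E 3 × ℝ) (t : 𝒯) (hx : x ∈ openHull (t : Finset (E 3))) :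
    pieceField 𝒯 A ξ x = (ξ t).1 + (ξ t).2 • A x :=
  h.piecewise_apply (fun t y => (ξ t).1 + (ξ t).2 • A y) t hx

theorem mem_range_pieceField [Fintype 𝒯] (h : IsFaceMesh ν c f 𝒯) (A : E 3 →ₗ[ℝ] E 3)
    {v : E 3 → E 3} (h0 : ∀ x ∉ cells 𝒯, v x = 0)
    (hv : ∀ t ∈ 𝒯, ∃ (a : E 3) (c : ℝ), ∀ x ∈ openHull t, v x = a + c • A x) :
    v ∈ LinearMap.range (pieceField 𝒯 A) := by
  choose a k hak using fun t : 𝒯 => hv t t.2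
  refine ⟨fun t => (a t, k t), funext fun x => ?_⟩
  by_cases hx : x ∈ cells 𝒯
  · obtain ⟨t, ht, hxt⟩ := mem_iUnion₂.1 hx
    rw [h.pieceField_apply A _ ⟨t, ht⟩ hxt, hak ⟨t, ht⟩ x hxt]
  · rw [h0 x hx]
    exact piecewise_of_notMem _ hx

theorem finiteDimensional_RT0 (h : IsFaceMesh ν c f 𝒯) : FiniteDimensional ℝ (RT0 𝒯 f ν) := by
  have := h.regular.finite.fintype
  refine Submodule.finiteDimensional_of_le (S₂ := LinearMap.range (pieceField 𝒯 LinearMap.id))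
    fun v hv => h.mem_range_pieceField _ hv.1 fun t ht => ?_
  obtain ⟨a, k, hak⟩ := hv.2.1 t ht
  exact ⟨a, k, fun x hx => (hak x hx).1⟩

theorem finiteDimensional_N0 (h : IsFaceMesh ν c f 𝒯) : FiniteDimensional ℝ (N0 𝒯 f ν) := by
  have := h.regular.finite.fintype
  refine Submodule.finiteDimensional_of_le (S₂ := LinearMap.range (pieceField 𝒯 (crossₗ ν)))
    fun v hv => h.mem_range_pieceField _ hv.1 fun t ht => ?_
  obtain ⟨a, k, hak⟩ := hv.2.1 t ht
  exact ⟨a, k, fun x hx => (hak x hx).1⟩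

/-- For `n` orthogonal to `ν` one has `(ν × w) × n = -(w · n) ν`, so rotation turns the jump of the
normal component into that of the tangential component. -/
theorem cross_mem_N0 {v : E 3 → E 3} (hv : v ∈ RT0 𝒯 f ν) :
    (fun x => cross ν (v x)) ∈ N0 𝒯 f ν := by
  refine ⟨fun x hx => ?_, fun t ht => ?_, fun e he hef n hn x hx => ?_⟩
  · change cross ν (v x) = 0
    rw [hv.1 x hx, ← crossₗ_apply, map_zero]
  · obtain ⟨a, k, hak⟩ := hv.2.1 t ht
    refine ⟨cross ν a, k, fun x hx => ⟨?_, inner_cross_left _ _⟩⟩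
    change cross ν (v x) = _
    rw [(hak x hx).1, cross_add_right, cross_smul_right]
  · have h1 := ((hv.2.2 e he hef n hn x hx).neg).smul_const ν
    rw [neg_zero, zero_smul] at h1
    refine h1.congr fun ε => ?_
    change _ = cross (crossₗ ν (v (x + ε • n)) - crossₗ ν (v (x - ε • n))) n
    rw [← map_sub, crossₗ_apply, cross_cross_left, real_inner_comm n ν, hn.2.1, zero_smul, zero_sub,
      neg_smul]

/-- Rotation is injective on tangential fields, as its square is minus the identity there. -/
theorem finrank_RT0_le_N0 (h : IsFaceMesh ν c f 𝒯) :
    Module.finrank ℝ (RT0 𝒯 f ν) ≤ Module.finrank ℝ (N0 𝒯 f ν) := by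
  have := h.finiteDimensional_N0
  let L : RT0 𝒯 f ν →ₗ[ℝ] N0 𝒯 f ν :=
    { toFun := fun v => ⟨fun x => cross ν ((v : E 3 → E 3) x), cross_mem_N0 v.2⟩
      map_add' := fun v w => Subtype.ext (funext fun x => cross_add_right _ _ _)
      map_smul' := fun k v => Subtype.ext (funext fun x => cross_smul_right _ _ _) }
  refine LinearMap.finrank_le_finrank_of_injective (f := L) fun v w hvw => ?_
  refine Subtype.ext (funext fun x => ?_)
  by_cases hx : x ∈ cells 𝒯
  · have h1 : cross ν ((v : E 3 → E 3) x) = cross ν ((w : E 3 → E 3) x) :=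
      congrFun (congrArg Subtype.val hvw) x
    have h2 : ∀ v : RT0 𝒯 f ν, (v : E 3 → E 3) x = -cross ν (cross ν ((v : E 3 → E 3) x)) := by
      intro v
      obtain ⟨t, ht, hxt⟩ := mem_iUnion₂.1 hx
      obtain ⟨a, k, hak⟩ := v.2.2.1 t ht
      rw [cross_cross_self, real_inner_comm, (hak x hxt).2, real_inner_self_eq_norm_sq, h.norm_eq]
      simp
    rw [h2 v, h2 w, h1]
  · rw [v.2.1 x hx, w.2.1 x hx]

/-! ### The two sides of an interior edge -/

/-- The triangle `t` lies on that side of its edge `e` to which `n` points. -/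
def OnSide (e : Finset (E 3)) (n : E 3) (t : Finset (E 3)) : Prop :=
  e ⊆ t ∧ ∀ x ∈ openHull e, ∀ᶠ ε : ℝ in 𝓝[>] 0, x + ε • n ∈ openHull t

theorem exists_eq_pair (he : e.card = 2) : ∃ p q, p ≠ q ∧ p ∈ e ∧ q ∈ e ∧ ∀ r ∈ e, r = p ∨ r = q := by
  classical
  obtain ⟨p, q, hpq, rfl⟩ := Finset.card_eq_two.1 he
  exact ⟨p, q, hpq, by simp, by simp, by simp⟩

theorem inner_sub_eq_zero (hn : IsEdgeNormal ν e n) (hx : x ∈ openHull e)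
    {y : E 3} (hy : y ∈ openHull e) : inner ℝ n (x - y) = (0 : ℝ) := by
  have key : ∀ p ∈ e, ∀ x ∈ openHull e, inner ℝ n x = inner ℝ n p := by
    rintro p hp _ ⟨w, -, hw, rfl⟩
    rw [inner_sum]
    have : ∀ q ∈ e, inner ℝ n (w q • q) = w q * inner ℝ n p := fun q hq => by
      have := hn.2.2 q hq p hp
      rw [inner_sub_right, sub_eq_zero] at this
      rw [inner_smul_right, this]
    rw [Finset.sum_congr rfl this, ← Finset.sum_mul, hw, one_mul]
  rw [inner_sub_right, sub_eq_zero]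
  have hne : e.Nonempty := by
    obtain ⟨w, -, hw, -⟩ := hx
    by_contra h0
    rw [Finset.not_nonempty_iff_eq_empty] at h0
    simp [h0] at hw
  obtain ⟨p, hp⟩ := hne
  rw [key p hp x hx, key p hp y hy]

/-- Points `x + ε n` with small `ε` lie in the relatively open face, hence in triangles, and as
these are finitely many, one triangle occurs for arbitrarily small `ε`. It is closed, so it contains
`x` and has `e` as an edge. -/
theorem exists_onSide (h : IsFaceMesh ν c f 𝒯) (he : e ∈ edges 𝒯) (hef : openHull e ⊆ f)
    (hn : IsEdgeNormal ν e n) : ∃ t ∈ 𝒯, OnSide e n t := by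
  classical
  obtain ⟨he2, t₀, ht₀, het₀⟩ := he
  obtain ⟨x, hx⟩ := openHull_nonempty (Finset.card_pos.1 (by omega : 0 < e.card))
  have hnν : inner ℝ ν n = (0 : ℝ) := by rw [real_inner_comm]; exact hn.2.1
  have hplane : ∀ y ∈ openHull e, ∀ ε : ℝ, inner ℝ ν (y + ε • n) = c := fun y hy ε => by
    rw [inner_add_right, inner_smul_right, hnν, h.plane y (hef hy)]; simp
  have hcont : ∀ y : E 3, Tendsto (fun ε : ℝ => y + ε • n) (𝓝[>] 0) (𝓝 y) := fun y => by
    have : Continuous fun ε : ℝ => y + ε • n := by fun_prop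
    have := this.tendsto 0
    rw [zero_smul, add_zero] at this
    exact this.mono_left nhdsWithin_le_nhds
  obtain ⟨r, hr, hball⟩ := h.isOpen x (hef hx)
  have h1 : ∀ᶠ ε : ℝ in 𝓝[>] 0, ∃ t ∈ 𝒯, x + ε • n ∈ convexHull ℝ (t : Set (E 3)) := by
    filter_upwards [(hcont x) (Metric.ball_mem_nhds x hr)] with ε hε
    exact h.exists_mem_convexHull (subset_closure (hball _ hε (hplane x hx ε)))
  obtain ⟨t, ht, hfreq⟩ : ∃ t ∈ 𝒯, ∃ᶠ ε : ℝ in 𝓝[>] 0, x + ε • n ∈ convexHull ℝ (t : Set (E 3)) := by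
    by_contra! hno
    have h2 : ∀ᶠ ε : ℝ in 𝓝[>] 0, ∀ t ∈ 𝒯, x + ε • n ∉ convexHull ℝ (t : Set (E 3)) := by
      rw [eventually_all_finite h.regular.finite]
      exact fun t ht => hno t ht
    obtain ⟨ε, ⟨t, ht, h3⟩, h4⟩ := (h1.and h2).exists
    exact h4 t ht h3
  have hxt : x ∈ convexHull ℝ (t : Set (E 3)) :=
    (isClosed_convexHull_finset t).mem_of_frequently_of_tendsto hfreq (hcont x)
  have het := h.regular.subset_of_mem_openHull ht₀ ht het₀ hx hxt
  have hti := h.indep ht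
  -- The coordinate of the opposite vertex increases strictly along `n`: if it stayed zero, `x + n`
  -- would be on the line of `e`, to which `n` is orthogonal. Its slope does not depend on the
  -- point, so the statement extends from `x` to the whole open edge.
  have hpos : ∀ a ∈ t, a ∉ e → 0 < (bary t a).linear n := by
    intro a ha hae
    have hxa := ((mem_openHull_iff_of_subset hti het).1 hx).2.2 a ha hae
    refine lt_of_le_of_ne ?_ fun h0 => ?_
    · obtain ⟨ε, h3, hε⟩ := (hfreq.and_eventually self_mem_nhdsWithin).exists
      have h4 := ((mem_convexHull_iff_bary hti).1 h3).2 a ha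
      rw [affine_add, hxa, zero_add, map_smul, smul_eq_mul] at h4
      exact nonneg_of_mul_nonneg_right h4 hε
    · have hte : ∀ q ∈ t, q = a ∨ q ∈ e := by
        intro q hq
        by_contra! hq'
        have hcard := Finset.card_le_card (s := insert q (insert a e)) (t := t)
          (Finset.insert_subset hq (Finset.insert_subset ha het))
        rw [Finset.card_insert_of_notMem (by simp [hq'.1, hq'.2]),
          Finset.card_insert_of_notMem hae, he2, (h.regular.simplex t ht).1] at hcard
        omega
      have hy : inner ℝ ν (x + (1 : ℝ) • n) = c := hplane x hx 1
      rw [one_smul] at hy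
      have hya : bary t a (x + n) = 0 := by rw [affine_add, hxa, ← h0, add_zero]
      obtain ⟨p, hp⟩ := Finset.card_pos.1 (by omega : 0 < e.card)
      have hval : ∀ y, inner ℝ ν y = c → bary t a y = 0 → inner ℝ n y = inner ℝ n p := by
        intro y hyc hya
        have h5 := affine_eq_sum hti ((innerₗ (E 3) n).toAffineMap) (h.mem_span ht hyc)
        have h6 := sum_bary hti (h.mem_span ht hyc)
        have h7 : ∀ q ∈ t, bary t q y • (innerₗ (E 3) n).toAffineMap q =
            bary t q y * inner ℝ n p := by
          intro q hq
          rcases hte q hq with rfl | hqe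
          · rw [hya]; simp
          · have := hn.2.2 q hqe p hp
            rw [inner_sub_right, sub_eq_zero] at this
            simp [this]
        rw [Finset.sum_congr rfl h7, ← Finset.sum_mul, h6, one_mul] at h5
        exact h5
      have h8 := hval (x + n) hy hya
      rw [inner_add_right, hval x (h.plane x (hef hx)) hxa, real_inner_self_eq_norm_sq, hn.1] at h8
      norm_num at h8
  refine ⟨t, ht, het, fun y hy => ?_⟩
  have hyt := (mem_openHull_iff_of_subset hti het).1 hy
  have hev : ∀ a ∈ t, ∀ᶠ ε : ℝ in 𝓝[>] 0, 0 < bary t a (y + ε • n) := by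
    intro a ha
    by_cases hae : a ∈ e
    · exact ((continuous_affine (bary t a)).continuousAt.tendsto.comp (hcont y)).eventually
        (lt_mem_nhds (hyt.2.1 a hae))
    · filter_upwards [self_mem_nhdsWithin] with ε hε
      rw [affine_add, hyt.2.2 a ha hae, zero_add, map_smul, smul_eq_mul]
      exact mul_pos hε (hpos a ha hae)
  filter_upwards [(eventually_all_finset t).2 hev] with ε hε
  exact (h.mem_openHull ht (hplane y hy ε)).2 hε

theorem OnSide.eq (h : IsFaceMesh ν c f 𝒯) (he : e.Nonempty) (hs : s ∈ 𝒯) (ht : t ∈ 𝒯)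
    (h1 : OnSide e n s) (h2 : OnSide e n t) : s = t := by
  obtain ⟨x, hx⟩ := openHull_nonempty he
  obtain ⟨ε, h3, h4⟩ := ((h1.2 x hx).and (h2.2 x hx)).exists
  exact h.eq_of_mem_openHull hs ht h3 (openHull_subset_convexHull _ h4)

/-- Otherwise a point of the open edge would be the midpoint of two points of the open triangle. -/
theorem OnSide.ne_neg (h : IsFaceMesh ν c f 𝒯) (he : e.card = 2) (ht : t ∈ 𝒯)
    (h1 : OnSide e n t) : ¬OnSide e (-n) t := by
  intro h2
  obtain ⟨x, hx⟩ := openHull_nonempty (Finset.card_pos.1 (by omega : 0 < e.card))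
  obtain ⟨ε, h3, h4⟩ := ((h1.2 x hx).and (h2.2 x hx)).exists
  have h5 := convex_openHull t h3 h4 (by norm_num : (0 : ℝ) ≤ 1 / 2)
    (by norm_num : (0 : ℝ) ≤ 1 / 2) (by norm_num)
  have h6 : (1 / 2 : ℝ) • (x + ε • n) + (1 / 2 : ℝ) • (x + ε • -n) = x := by module
  rw [h6] at h5
  have := Finset.card_le_card (subset_of_mem_openHull (h.indep ht) subset_rfl h1.1 h5
    (openHull_subset_convexHull _ hx))
  rw [(h.regular.simplex t ht).1, he] at this
  omega

theorem isEdgeNormal_neg (hn : IsEdgeNormal ν e n) : IsEdgeNormal ν e (-n) := by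
  refine ⟨by rw [norm_neg, hn.1], by rw [inner_neg_left, hn.2.1, neg_zero], fun p hp q hq => ?_⟩
  rw [inner_neg_left, hn.2.2 p hp q hq, neg_zero]

theorem exists_isEdgeNormal (h : IsFaceMesh ν c f 𝒯) (he : e ∈ edges 𝒯) :
    ∃ n, IsEdgeNormal ν e n := by
  classical
  obtain ⟨he2, t, ht, het⟩ := he
  obtain ⟨p, q, hpq, hp, hq, hpq'⟩ := exists_eq_pair he2
  obtain ⟨a, ha, hae⟩ : ∃ a ∈ t, a ∉ e := by
    by_contra! h'
    have := Finset.card_le_card (h' : t ⊆ e)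
    rw [(h.regular.simplex t ht).1, he2] at this
    omega
  set d := q - p with hd
  have hd0 : inner ℝ d d ≠ (0 : ℝ) := by
    rw [Ne, inner_self_eq_zero, hd, sub_eq_zero]
    exact hpq.symm
  -- The normal is the normalized component of `a - p` orthogonal to the edge, with `a` the opposite
  -- vertex.
  set k : ℝ := inner ℝ d (a - p) / inner ℝ d d with hk
  set m := a - p - k • d with hm
  have hm0 : m ≠ 0 := by
    intro h0
    have h1 : a = p + k • (q - p) := by
      rw [hm, sub_eq_zero, sub_eq_iff_eq_add] at h0
      rw [h0, hd]; abel
    have h2 := bary_self (h.indep ht) ha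
    have h3 := affine_lineMap (bary t a) p q k
    rw [← h1, h2, bary_ne (h.indep ht) (het hp) (fun h' : p = a => hae (h' ▸ hp)),
      bary_ne (h.indep ht) (het hq) (fun h' : q = a => hae (h' ▸ hq))] at h3
    simp at h3
  have hmd : inner ℝ m d = (0 : ℝ) := by
    rw [hm, inner_sub_left, real_inner_smul_left, real_inner_comm, hk, div_mul_cancel₀ _ hd0,
      sub_self]
  have hmν : inner ℝ m ν = (0 : ℝ) := by
    rw [real_inner_comm, hm, hd, inner_sub_right, inner_smul_right, inner_sub_right, inner_sub_right,
      h.inner_vertex ht ha, h.inner_vertex ht (het hp), h.inner_vertex ht (het hq)]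
    ring
  refine ⟨‖m‖⁻¹ • m, ?_, ?_, fun r hr r' hr' => ?_⟩
  · rw [norm_smul, norm_inv, norm_norm, inv_mul_cancel₀ (norm_ne_zero_iff.2 hm0)]
  · rw [inner_smul_left, hmν, mul_zero]
  · have h1 : inner ℝ m p = inner ℝ m q := by
      rw [hd, inner_sub_right, sub_eq_zero] at hmd
      exact hmd.symm
    rw [inner_smul_left, inner_sub_right]
    rcases hpq' r hr with rfl | rfl <;> rcases hpq' r' hr' with rfl | rfl <;> simp [h1]

/-- Otherwise `ν`, `n`, the edge direction and the part of `n'` orthogonal to `n` would be four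
nonzero orthogonal vectors in three-dimensional space. -/
theorem isEdgeNormal_eq_or_neg (h : IsFaceMesh ν c f 𝒯) (he : e ∈ edges 𝒯) {n' : E 3}
    (hn : IsEdgeNormal ν e n) (hn' : IsEdgeNormal ν e n') : n' = n ∨ n' = -n := by
  obtain ⟨he2, t, ht, het⟩ := he
  obtain ⟨p, q, hpq, hp, hq, -⟩ := exists_eq_pair he2
  set w := n' - (inner ℝ n n' : ℝ) • n with hw
  have hnn : inner ℝ n n = (1 : ℝ) := by rw [real_inner_self_eq_norm_sq, hn.1]; norm_num
  have hνν : inner ℝ ν ν = (1 : ℝ) := by rw [real_inner_self_eq_norm_sq, h.norm_eq]; norm_num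
  have hνn : inner ℝ ν n = (0 : ℝ) := by rw [real_inner_comm]; exact hn.2.1
  have hνn' : inner ℝ ν n' = (0 : ℝ) := by rw [real_inner_comm]; exact hn'.2.1
  have hdν : inner ℝ ν (q - p) = (0 : ℝ) := by
    rw [inner_sub_right, h.inner_vertex ht (het hp), h.inner_vertex ht (het hq), sub_self]
  have hw0 : w = 0 := by
    by_contra hw0
    have hli : LinearIndependent ℝ ![ν, n, q - p, w] := by
      refine linearIndependent_of_ne_zero_of_inner_eq_zero (𝕜 := ℝ) (fun i => ?_) ?_
      · fin_cases i
        · exact fun h0 => by simp_all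
        · exact fun h0 => by simp_all
        · exact sub_ne_zero.2 hpq.symm
        · exact hw0
      · have h1 : inner ℝ ν w = (0 : ℝ) := by rw [hw, inner_sub_right, inner_smul_right, hνn, hνn']; simp
        have h2 : inner ℝ n w = (0 : ℝ) := by rw [hw, inner_sub_right, inner_smul_right, hnn]; simp
        have h3 : inner ℝ n (q - p) = (0 : ℝ) := hn.2.2 q hq p hp
        have h4 : inner ℝ (q - p) w = (0 : ℝ) := by
          rw [real_inner_comm, hw, inner_sub_left, inner_smul_left, h3, hn'.2.2 q hq p hp]; simp
        intro i j hij
        fin_cases i <;> fin_cases j <;>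
          first
            | exact absurd rfl hij
            | assumption
            | (rw [real_inner_comm]; assumption)
    have := hli.fintype_card_le_finrank
    simp at this
  have h1 : n' = (inner ℝ n n' : ℝ) • n := sub_eq_zero.1 hw0
  have h2 : |(inner ℝ n n' : ℝ)| = 1 := by
    have := congrArg norm h1
    rw [norm_smul, hn.1, hn'.1, mul_one] at this
    exact this.symm
  rcases (abs_eq zero_le_one).1 h2 with h3 | h3
  · left; rw [h1, h3, one_smul]
  · right; rw [h1, h3, neg_one_smul]

end IsFaceMesh

end TraceFEM

/-! ### Interior edges and lower bounds for the dimensions of `RT0` and `N0` -/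

namespace TraceFEM

/-- The edges of a mesh that lie in the interior of `f`. -/
def interiorEdges (𝒯 : Set (Finset (E 3))) (f : Set (E 3)) : Set (Finset (E 3)) :=
  {e ∈ edges 𝒯 | openHull e ⊆ f}

theorem edges_finite {𝒯 : Set (Finset (E 3))} (h : 𝒯.Finite) : (edges 𝒯).Finite := by
  refine (h.biUnion fun t _ => (t.powerset : Finset (Finset (E 3))).finite_toSet).subset ?_
  rintro e ⟨-, t, ht, het⟩
  exact mem_iUnion₂.2 ⟨t, ht, Finset.mem_coe.2 (Finset.mem_powerset.2 het)⟩

namespace IsFaceMesh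

variable {ν : E 3} {c : ℝ} {f : Set (E 3)} {𝒯 : Set (Finset (E 3))} {s t e : Finset (E 3)}
  {x p q n : E 3}

theorem edge_nonempty (he : e ∈ edges 𝒯) : e.Nonempty :=
  Finset.card_pos.1 (by rw [he.1]; norm_num)

/-- Double counting of incidences: an interior edge has a triangle on each of its two sides, and a
triangle has three edges. -/
theorem two_mul_ncard_interiorEdges_le (h : IsFaceMesh ν c f 𝒯) :
    (interiorEdges 𝒯 f).ncard * 2 ≤ 𝒯.ncard * 3 := by
  classical
  have hfin := h.regular.finite
  have hefin : (interiorEdges 𝒯 f).Finite := (edges_finite hfin).subset (sep_subset _ _)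
  rw [Set.ncard_eq_toFinset_card _ hfin, Set.ncard_eq_toFinset_card _ hefin]
  refine Finset.card_mul_le_card_mul (fun e t : Finset (E 3) => e ⊆ t) (fun e he => ?_)
    fun t ht => ?_
  · rw [Set.Finite.mem_toFinset] at he
    obtain ⟨n, hn⟩ := h.exists_isEdgeNormal he.1
    obtain ⟨t₁, ht₁, h1⟩ := h.exists_onSide he.1 he.2 hn
    obtain ⟨t₂, ht₂, h2⟩ := h.exists_onSide he.1 he.2 (isEdgeNormal_neg hn)
    have hne : t₁ ≠ t₂ := fun h' => h1.ne_neg h he.1.1 ht₁ (h' ▸ h2)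
    rw [← Finset.card_pair hne]
    refine Finset.card_le_card ?_
    intro t ht
    rw [Finset.mem_bipartiteAbove, Set.Finite.mem_toFinset]
    rcases Finset.mem_insert.1 ht with rfl | ht
    · exact ⟨ht₁, h1.1⟩
    · rw [Finset.mem_singleton.1 ht]
      exact ⟨ht₂, h2.1⟩
  · rw [Set.Finite.mem_toFinset] at ht
    have h1 : (t.powersetCard 2).card = 3 := by
      rw [Finset.card_powersetCard, (h.regular.simplex t ht).1]; rfl
    refine (Finset.card_le_card fun e he => ?_).trans h1.le
    rw [Finset.mem_bipartiteBelow, Set.Finite.mem_toFinset] at he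
    exact Finset.mem_powersetCard.2 ⟨he.2, he.1.1.1⟩

/-- The normal component of `a + k x` is constant along an edge, so one point of each edge suffices.
One normal suffices too, since the opposite one only exchanges the two sides. -/
theorem mem_RT0_of_forall_jump [Fintype 𝒯] (h : IsFaceMesh ν c f 𝒯) (ξ : 𝒯 → E 3 × ℝ)
    (htan : ∀ t, inner ℝ (ξ t).1 ν + (ξ t).2 * c = 0)
    (hjump : ∀ e ∈ interiorEdges 𝒯 f, ∃ n x, IsEdgeNormal ν e n ∧ x ∈ openHull e ∧
      ∀ t₁ t₂ : 𝒯, OnSide e n t₁ → OnSide e (-n) t₂ →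
        inner ℝ ((ξ t₁).1 + (ξ t₁).2 • x - ((ξ t₂).1 + (ξ t₂).2 • x)) n = (0 : ℝ)) :
    pieceField 𝒯 LinearMap.id ξ ∈ RT0 𝒯 f ν := by
  refine ⟨fun x hx => piecewise_of_notMem _ hx, fun t ht => ⟨(ξ ⟨t, ht⟩).1, (ξ ⟨t, ht⟩).2,
    fun x hx => ?_⟩, fun e he hef n hn x hx => ?_⟩
  · have h1 := h.pieceField_apply LinearMap.id ξ ⟨t, ht⟩ hx
    refine ⟨h1, ?_⟩
    rw [h1, inner_add_left, LinearMap.id_apply, real_inner_smul_left, real_inner_comm ν x,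
      h.plane x (h.openHull_subset t ht hx)]
    exact htan ⟨t, ht⟩
  · obtain ⟨m, y, hm, hy, hmy⟩ := hjump e ⟨he, hef⟩
    have key : ∀ m, IsEdgeNormal ν e m → (∀ t₁ t₂ : 𝒯, OnSide e m t₁ → OnSide e (-m) t₂ →
        inner ℝ ((ξ t₁).1 + (ξ t₁).2 • y - ((ξ t₂).1 + (ξ t₂).2 • y)) m = (0 : ℝ)) →
        Tendsto (fun ε : ℝ => inner ℝ (pieceField 𝒯 LinearMap.id ξ (x + ε • m) -
          pieceField 𝒯 LinearMap.id ξ (x - ε • m)) m) (𝓝[>] 0) (𝓝 (0 : ℝ)) := by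
      intro m hm hmy
      obtain ⟨t₁, ht₁, h1⟩ := h.exists_onSide he hef hm
      obtain ⟨t₂, ht₂, h2⟩ := h.exists_onSide he hef (isEdgeNormal_neg hm)
      have hj := hmy ⟨t₁, ht₁⟩ ⟨t₂, ht₂⟩ h1 h2
      have hlim : Tendsto (fun ε : ℝ => inner ℝ ((ξ ⟨t₁, ht₁⟩).1 + (ξ ⟨t₁, ht₁⟩).2 • (x + ε • m) -
          ((ξ ⟨t₂, ht₂⟩).1 + (ξ ⟨t₂, ht₂⟩).2 • (x - ε • m))) m) (𝓝[>] 0) (𝓝 (0 : ℝ)) := by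
        have hc : Continuous (fun ε : ℝ => (inner ℝ ((ξ ⟨t₁, ht₁⟩).1 +
          (ξ ⟨t₁, ht₁⟩).2 • (x + ε • m) - ((ξ ⟨t₂, ht₂⟩).1 + (ξ ⟨t₂, ht₂⟩).2 • (x - ε • m))) m : ℝ)) := by
          fun_prop
        have := hc.tendsto 0
        refine (this.mono_left nhdsWithin_le_nhds).trans (le_of_eq (congrArg _ ?_))
        have h3 := inner_sub_eq_zero hm hx hy
        have e1 : (ξ ⟨t₁, ht₁⟩).1 + (ξ ⟨t₁, ht₁⟩).2 • (x + (0 : ℝ) • m) -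
            ((ξ ⟨t₂, ht₂⟩).1 + (ξ ⟨t₂, ht₂⟩).2 • (x - (0 : ℝ) • m)) =
            ((ξ ⟨t₁, ht₁⟩).1 + (ξ ⟨t₁, ht₁⟩).2 • y - ((ξ ⟨t₂, ht₂⟩).1 + (ξ ⟨t₂, ht₂⟩).2 • y)) +
            ((ξ ⟨t₁, ht₁⟩).2 - (ξ ⟨t₂, ht₂⟩).2) • (x - y) := by module
        rw [e1, inner_add_left, hj, real_inner_smul_left, real_inner_comm, h3]
        simp
      refine hlim.congr' ?_
      filter_upwards [h1.2 x hx, h2.2 x hx] with ε h4 h5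
      rw [smul_neg, ← sub_eq_add_neg] at h5
      rw [h.pieceField_apply _ ξ ⟨t₁, ht₁⟩ h4, h.pieceField_apply _ ξ ⟨t₂, ht₂⟩ h5]
      rfl
    rcases h.isEdgeNormal_eq_or_neg he hm hn with rfl | rfl
    · exact key _ hm hmy
    · refine key _ hn fun t₁ t₂ h1 h2 => ?_
      rw [neg_neg] at h2
      have := hmy t₂ t₁ h2 h1
      rw [inner_neg_right, ← inner_neg_left, neg_sub]
      exact this

/-- Three parameters per triangle minus one linear condition per interior edge leave at least half
as many dimensions again as there are triangles. -/
theorem ncard_le_finrank_RT0 (h : IsFaceMesh ν c f 𝒯) :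
    𝒯.ncard ≤ Module.finrank ℝ (RT0 𝒯 f ν) := by
  classical
  have := h.regular.finite.fintype
  have hefin : (interiorEdges 𝒯 f).Finite :=
    (edges_finite h.regular.finite).subset (sep_subset _ _)
  have := hefin.fintype
  have := h.finiteDimensional_RT0
  obtain ⟨x₀, hx₀⟩ := h.nonempty
  have hx₀c := h.plane x₀ hx₀
  have hν0 : ν ≠ 0 := by
    intro h0
    have := h.norm_eq
    simp [h0] at this
  have hW : Module.finrank ℝ (ℝ ∙ ν)ᗮ = 2 :=
    have : Fact (Module.finrank ℝ (E 3) = 2 + 1) := ⟨by simp⟩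
    Submodule.finrank_orthogonal_span_singleton hν0
  -- The field on a triangle is written as `a + k (x - x₀)` with `a` orthogonal to `ν`, which makes
  -- it tangential: two parameters for `a` and one for `k`.
  let Q : (𝒯 → ((ℝ ∙ ν)ᗮ : Submodule ℝ (E 3)) × ℝ) →ₗ[ℝ] (𝒯 → E 3 × ℝ) :=
    { toFun := fun ξ t => ((ξ t).1 - (ξ t).2 • x₀, (ξ t).2)
      map_add' := fun ξ η => funext fun t => by
        refine Prod.ext ?_ rfl
        change ((ξ t).1 : E 3) + (η t).1 - ((ξ t).2 + (η t).2) • x₀ =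
          ((ξ t).1 : E 3) - (ξ t).2 • x₀ + ((η t).1 - (η t).2 • x₀)
        module
      map_smul' := fun k ξ => funext fun t => by
        refine Prod.ext ?_ rfl
        change k • ((ξ t).1 : E 3) - (k * (ξ t).2) • x₀ = k • (((ξ t).1 : E 3) - (ξ t).2 • x₀)
        module }
  choose n hn using fun e : interiorEdges 𝒯 f => h.exists_isEdgeNormal e.2.1
  choose y hy using fun e : interiorEdges 𝒯 f => openHull_nonempty (edge_nonempty e.2.1)
  choose t₁ ht₁ h1 using fun e : interiorEdges 𝒯 f => h.exists_onSide e.2.1 e.2.2 (hn e)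
  choose t₂ ht₂ h2 using fun e : interiorEdges 𝒯 f =>
    h.exists_onSide e.2.1 e.2.2 (isEdgeNormal_neg (hn e))
  -- The normal jumps at one point of each interior edge; the kernel of `J` embeds into `RT0`.
  let J : (𝒯 → ((ℝ ∙ ν)ᗮ : Submodule ℝ (E 3)) × ℝ) →ₗ[ℝ] (interiorEdges 𝒯 f → ℝ) := LinearMap.pi fun e =>
    (innerₗ (E 3) (n e)) ∘ₗ
      { toFun := fun ξ : 𝒯 → E 3 × ℝ => (ξ ⟨t₁ e, ht₁ e⟩).1 + (ξ ⟨t₁ e, ht₁ e⟩).2 • y e -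
          ((ξ ⟨t₂ e, ht₂ e⟩).1 + (ξ ⟨t₂ e, ht₂ e⟩).2 • y e)
        map_add' := fun ξ η => by
          simp only [Pi.add_apply, Prod.fst_add, Prod.snd_add]
          module
        map_smul' := fun k ξ => by
          simp only [Pi.smul_apply, Prod.smul_fst, Prod.smul_snd, RingHom.id_apply, smul_eq_mul]
          module } ∘ₗ Q
  have hmem : ∀ ξ : LinearMap.ker J, pieceField 𝒯 LinearMap.id (Q ξ) ∈ RT0 𝒯 f ν := by
    intro ξ
    refine h.mem_RT0_of_forall_jump (Q ξ) (fun t => ?_) fun e he => ⟨n ⟨e, he⟩, y ⟨e, he⟩,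
      hn ⟨e, he⟩, hy ⟨e, he⟩, fun s₁ s₂ hs₁ hs₂ => ?_⟩
    · have h3 := (Submodule.mem_orthogonal_singleton_iff_inner_left).1 (ξ.1 t).1.2
      change inner ℝ (((ξ.1 t).1 : E 3) - (ξ.1 t).2 • x₀) ν + (ξ.1 t).2 * c = 0
      rw [inner_sub_left, h3, real_inner_smul_left, real_inner_comm, hx₀c]
      ring
    · obtain rfl : s₁ = ⟨t₁ ⟨e, he⟩, ht₁ ⟨e, he⟩⟩ :=
        Subtype.ext (OnSide.eq h (edge_nonempty he.1) s₁.2 (ht₁ ⟨e, he⟩) hs₁ (h1 ⟨e, he⟩))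
      obtain rfl : s₂ = ⟨t₂ ⟨e, he⟩, ht₂ ⟨e, he⟩⟩ :=
        Subtype.ext (OnSide.eq h (edge_nonempty he.1) s₂.2 (ht₂ ⟨e, he⟩) hs₂ (h2 ⟨e, he⟩))
      rw [real_inner_comm]
      exact congrFun (LinearMap.mem_ker.1 ξ.2) ⟨e, he⟩
  let L : LinearMap.ker J →ₗ[ℝ] RT0 𝒯 f ν :=
    LinearMap.codRestrict _ (pieceField 𝒯 LinearMap.id ∘ₗ Q ∘ₗ (LinearMap.ker J).subtype) hmem
  have hL : Function.Injective L := by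
    rw [injective_iff_map_eq_zero]
    intro ξ hξ
    refine Subtype.ext (funext fun t => ?_)
    have h3 : ∀ x ∈ openHull (t : Finset (E 3)),
        ((ξ.1 t).1 : E 3) - (ξ.1 t).2 • x₀ + (ξ.1 t).2 • x = 0 := fun x hx => by
      have h4 : pieceField 𝒯 LinearMap.id (Q ξ) x = 0 := congrFun (congrArg Subtype.val hξ) x
      rwa [h.pieceField_apply _ _ t hx] at h4
    have htS := h.regular.simplex t t.2
    obtain ⟨x, hx⟩ := openHull_nonempty htS.nonempty
    obtain ⟨p, hp, q, hq, hpq⟩ := Finset.one_lt_card.1 (by rw [htS.1]; norm_num : 1 < t.1.card)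
    have h5 : ∀ p ∈ t.1, (ξ.1 t).2 • (x - p) = 0 := by
      intro p hp
      have h6 := h3 x hx
      have h7 := h3 _ (openHull_add_smul hx (subset_convexHull ℝ _ hp)
        (by norm_num : (0 : ℝ) < 1 / 2) (by norm_num))
      have h8 : (ξ.1 t).2 • (x - p) = (2 : ℝ) • ((((ξ.1 t).1 : E 3) - (ξ.1 t).2 • x₀ +
        (ξ.1 t).2 • x) - (((ξ.1 t).1 : E 3) - (ξ.1 t).2 • x₀ +
        (ξ.1 t).2 • (p + (1 / 2 : ℝ) • (x - p)))) := by module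
      rw [h8, h6, h7, sub_self, smul_zero]
    have h9 : (ξ.1 t).2 = 0 := by
      have h10 : (ξ.1 t).2 • (q - p) = 0 := by
        have : (ξ.1 t).2 • (q - p) = (ξ.1 t).2 • (x - p) - (ξ.1 t).2 • (x - q) := by module
        rw [this, h5 p hp, h5 q hq, sub_self]
      exact (smul_eq_zero.1 h10).resolve_right (sub_ne_zero.2 hpq.symm)
    have h11 := h3 x hx
    rw [h9, zero_smul, sub_zero, zero_smul, add_zero] at h11
    exact Prod.ext (Subtype.ext h11) h9
  have hdim := LinearMap.finrank_le_finrank_of_injective hL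
  have hrank := J.finrank_range_add_finrank_ker
  have hrange : Module.finrank ℝ (LinearMap.range J) ≤ (interiorEdges 𝒯 f).ncard := by
    refine (Submodule.finrank_le _).trans ?_
    rw [Module.finrank_pi, ← Nat.card_eq_fintype_card, Nat.card_coe_set_eq]
  have hP : Module.finrank ℝ (𝒯 → ((ℝ ∙ ν)ᗮ : Submodule ℝ (E 3)) × ℝ) = 𝒯.ncard * 3 := by
    rw [Module.finrank_pi_fintype]
    simp only [Module.finrank_prod, hW, Module.finrank_self, Finset.sum_const, Finset.card_univ,
      smul_eq_mul]
    rw [← Nat.card_eq_fintype_card, Nat.card_coe_set_eq]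
  have := h.two_mul_ncard_interiorEdges_le
  omega

theorem ncard_le_finrank_N0 (h : IsFaceMesh ν c f 𝒯) :
    𝒯.ncard ≤ Module.finrank ℝ (N0 𝒯 f ν) :=
  h.ncard_le_finrank_RT0.trans h.finrank_RT0_le_N0

end IsFaceMesh

end TraceFEM

namespace TraceFEM

/-! ### Separation of simplices and nodal functions as maxima -/

/-- Two simplices which intersect in a common face are separated by an affine function which
vanishes on this face only. -/
theorem exists_affine_separating [DecidableEq (E 3)] {s t : Finset (E 3)}
    (hs : AffineIndependent ℝ ((↑) : s → E 3)) (ht : AffineIndependent ℝ ((↑) : t → E 3))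
    (hst : convexHull ℝ (s : Set (E 3)) ∩ convexHull ℝ (t : Set (E 3)) =
      convexHull ℝ ((s : Set (E 3)) ∩ (t : Set (E 3)))) :
    ∃ g : E 3 →ᵃ[ℝ] ℝ, (∀ q ∈ s ∩ t, g q = 0) ∧ (∀ q ∈ s \ t, 0 < g q) ∧ ∀ q ∈ t \ s, g q < 0 := by
  set u := (s \ t) ∪ (t \ s) with hu
  -- In homogeneous coordinates, the vertices of `t` outside `s` are taken with the opposite sign. A
  -- linear functional that is negative on all `v q`, `q ∈ u`, and zero on the span `Z` of the
  -- common vertices is the negative of the desired function. Hahn-Banach yields it once the hull is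
  -- known to miss `Z`.
  let v : E 3 → E 3 × ℝ := fun q => if q ∈ s then (q, 1) else (-q, -1)
  have hvinj : Set.InjOn v u := by
    intro x _ y _ hxy
    simp only [v] at hxy
    split_ifs at hxy with h1 h2 h2
    · exact (Prod.ext_iff.1 hxy).1
    · have := (Prod.ext_iff.1 hxy).2
      norm_num at this
    · have := (Prod.ext_iff.1 hxy).2
      norm_num at this
    · exact neg_injective (Prod.ext_iff.1 hxy).1
  let Z : Submodule ℝ (E 3 × ℝ) := Submodule.span ℝ ((fun q : E 3 => (q, (1 : ℝ))) '' ((s ∩ t : Finset (E 3)) : Set (E 3)))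
  have hdisj : Disjoint (convexHull ℝ ((u.image v : Finset (E 3 × ℝ)) : Set (E 3 × ℝ)))
      (Z : Set (E 3 × ℝ)) := by
    rw [Set.disjoint_left]
    intro z hz hzZ
    obtain ⟨w₀, hw0, hw1, hwz⟩ := Finset.mem_convexHull'.1 hz
    obtain ⟨k, hk⟩ := (Submodule.mem_span_image_finset_iff_exists_fun' ℝ).1 hzZ
    rw [Finset.sum_image hvinj] at hw1 hwz
    set w := fun q => w₀ (v q) with hw
    have hw0' : ∀ q ∈ u, 0 ≤ w q := fun q hq => hw0 _ (Finset.mem_image_of_mem v hq)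
    have hdu : Disjoint (s \ t) (t \ s) := by
      rw [Finset.disjoint_left]
      intro q h1 h2
      exact (Finset.mem_sdiff.1 h1).2 (Finset.mem_sdiff.1 h2).1
    -- Splitting the coefficients of the common vertices by sign turns the relation into an equality
    -- of nonnegative combinations over `s` and over `t`. Normalized, it is a common point of both
    -- simplices, hence in the common face, so the weights off this face vanish. But these weights
    -- sum to one.
    let α : E 3 → ℝ := fun q => if q ∈ t then max (-k q) 0 else w q
    let β : E 3 → ℝ := fun q => if q ∈ s then max (k q) 0 else w q
    have hα0 : ∀ q ∈ s, 0 ≤ α q := by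
      intro q hq
      simp only [α]
      split_ifs with h
      · exact le_max_right _ _
      · exact hw0' q (Finset.mem_union_left _ (Finset.mem_sdiff.2 ⟨hq, h⟩))
    have hβ0 : ∀ q ∈ t, 0 ≤ β q := by
      intro q hq
      simp only [β]
      split_ifs with h
      · exact le_max_right _ _
      · exact hw0' q (Finset.mem_union_right _ (Finset.mem_sdiff.2 ⟨hq, h⟩))
    have hsum : ∀ {V : Type} [AddCommGroup V] [Module ℝ V] (y : E 3 → V),
        ∑ q ∈ u, w q • (if q ∈ s then y q else -y q) = ∑ q ∈ s ∩ t, k q • y q →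
        ∑ q ∈ s, α q • y q = ∑ q ∈ t, β q • y q := by
      intro V _ _ y hy
      rw [hu, Finset.sum_union hdu] at hy
      rw [← Finset.sum_inter_add_sum_sdiff s t, ← Finset.sum_inter_add_sum_sdiff t s,
        Finset.inter_comm t s]
      have e1 : ∑ q ∈ s \ t, α q • y q = ∑ q ∈ s \ t, w q • (if q ∈ s then y q else -y q) :=
        Finset.sum_congr rfl fun q hq => by
          simp only [α]
          rw [if_neg (Finset.mem_sdiff.1 hq).2, if_pos (Finset.mem_sdiff.1 hq).1]
      have e2 : ∑ q ∈ t \ s, β q • y q = -∑ q ∈ t \ s, w q • (if q ∈ s then y q else -y q) := by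
        rw [← Finset.sum_neg_distrib]
        refine Finset.sum_congr rfl fun q hq => ?_
        simp only [β]
        rw [if_neg (Finset.mem_sdiff.1 hq).2, if_neg (Finset.mem_sdiff.1 hq).2, smul_neg, neg_neg]
      have e3 : ∑ q ∈ s ∩ t, β q • y q = ∑ q ∈ s ∩ t, α q • y q + ∑ q ∈ s ∩ t, k q • y q := by
        rw [← Finset.sum_add_distrib]
        refine Finset.sum_congr rfl fun q hq => ?_
        simp only [α, β]
        rw [if_pos (Finset.mem_inter.1 hq).2, if_pos (Finset.mem_inter.1 hq).1, ← add_smul]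
        congr 1
        rcases le_total (k q) 0 with h | h
        · rw [max_eq_right h, max_eq_left (by linarith)]; ring
        · rw [max_eq_left h, max_eq_right (by linarith)]; ring
      rw [e1, e2, e3, ← hy]
      abel
    have hkz : ∑ q ∈ u, w q • v q = ∑ q ∈ s ∩ t, k q • (q, (1 : ℝ)) := hwz.trans hk.symm
    have hx := hsum (fun q => q) (by
      have := congrArg (LinearMap.fst ℝ (E 3) ℝ) hkz
      rw [map_sum, map_sum] at this
      convert this using 2 with q hq
      · simp only [v]
        split_ifs <;> simp
      · simp)
    have hm := hsum (fun _ => (1 : ℝ)) (by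
      have := congrArg (LinearMap.snd ℝ (E 3) ℝ) hkz
      rw [map_sum, map_sum] at this
      convert this using 2 with q hq
      · simp only [v]
        split_ifs <;> simp
      · simp)
    simp only [smul_eq_mul, mul_one] at hm
    set m := ∑ q ∈ s, α q with hmdef
    have hm0 : 0 ≤ m := Finset.sum_nonneg hα0
    have hcontra : (∀ q ∈ s \ t, w q = 0) → (∀ q ∈ t \ s, w q = 0) → False := by
      intro h1 h2
      rw [hu, Finset.sum_union hdu, Finset.sum_eq_zero h1, Finset.sum_eq_zero h2] at hw1
      norm_num at hw1
    rcases hm0.eq_or_lt with hm0 | hm0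
    · refine hcontra (fun q hq => ?_) fun q hq => ?_
      · have := (Finset.sum_eq_zero_iff_of_nonneg hα0).1 hm0.symm q (Finset.mem_sdiff.1 hq).1
        simpa only [α, if_neg (Finset.mem_sdiff.1 hq).2] using this
      · have := (Finset.sum_eq_zero_iff_of_nonneg hβ0).1 (hm.symm.trans hm0.symm) q
          (Finset.mem_sdiff.1 hq).1
        simpa only [β, if_neg (Finset.mem_sdiff.1 hq).2] using this
    · have h1s : ∑ q ∈ s, m⁻¹ * α q = 1 := by rw [← Finset.mul_sum]; exact inv_mul_cancel₀ hm0.ne'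
      have h1t : ∑ q ∈ t, m⁻¹ * β q = 1 := by
        rw [← Finset.mul_sum, ← hm]; exact inv_mul_cancel₀ hm0.ne'
      have hxeq : ∑ q ∈ s, (m⁻¹ * α q) • q = ∑ q ∈ t, (m⁻¹ * β q) • q := by
        simp only [mul_smul, ← Finset.smul_sum]
        rw [hx]
      have hxs : ∑ q ∈ s, (m⁻¹ * α q) • q ∈ convexHull ℝ (s : Set (E 3)) :=
        Finset.mem_convexHull'.2 ⟨_, fun q hq => mul_nonneg (inv_nonneg.2 hm0.le) (hα0 q hq),
          h1s, rfl⟩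
      have hxt : ∑ q ∈ s, (m⁻¹ * α q) • q ∈ convexHull ℝ (t : Set (E 3)) :=
        Finset.mem_convexHull'.2 ⟨_, fun q hq => mul_nonneg (inv_nonneg.2 hm0.le) (hβ0 q hq),
          h1t, hxeq.symm⟩
      have hxst : ∑ q ∈ s, (m⁻¹ * α q) • q ∈ convexHull ℝ ((s ∩ t : Finset (E 3)) : Set (E 3)) := by
        rw [Finset.coe_inter, ← hst]
        exact ⟨hxs, hxt⟩
      refine hcontra (fun q hq => ?_) fun q hq => ?_
      · obtain ⟨hq1, hq2⟩ := Finset.mem_sdiff.1 hq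
        have := ((mem_convexHull_iff_of_subset hs Finset.inter_subset_left).1 hxst).2.2 q hq1
          fun h => hq2 (Finset.mem_inter.1 h).2
        rw [bary_sum hs subset_rfl h1s hq1] at this
        have := (mul_eq_zero.1 this).resolve_left (inv_ne_zero hm0.ne')
        simpa only [α, if_neg hq2] using this
      · obtain ⟨hq1, hq2⟩ := Finset.mem_sdiff.1 hq
        have := ((mem_convexHull_iff_of_subset ht Finset.inter_subset_right).1 hxst).2.2 q hq1
          fun h => hq2 (Finset.mem_inter.1 h).1
        rw [hxeq, bary_sum ht subset_rfl h1t hq1] at this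
        have := (mul_eq_zero.1 this).resolve_left (inv_ne_zero hm0.ne')
        simpa only [β, if_neg hq2] using this
  obtain ⟨φ, a, b, h1, hab, h2⟩ := geometric_hahn_banach_compact_closed (convex_convexHull ℝ _)
    ((u.image v).finite_toSet.isCompact_convexHull (𝕜 := ℝ)) Z.convex Z.closed_of_finiteDimensional
    hdisj
  have hb0 : b < 0 := by simpa using h2 0 Z.zero_mem
  -- A functional bounded below on a subspace vanishes there.
  have hZ : ∀ z ∈ Z, φ z = 0 := by
    intro z hz
    by_contra hne
    have := h2 (((b - 1) / φ z) • z) (Z.smul_mem _ hz)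
    rw [map_smul, smul_eq_mul, div_mul_cancel₀ _ hne] at this
    linarith
  have hC : ∀ q ∈ u, φ (v q) < 0 := fun q hq =>
    ((h1 _ (subset_convexHull ℝ _ (Finset.mem_coe.2 (Finset.mem_image_of_mem v hq)))).trans
      hab).trans hb0
  have hsplit : ∀ q : E 3, φ (q, 1) = φ (q, 0) + φ (0, 1) := fun q => by
    rw [← map_add]; simp
  refine ⟨-((φ.toLinearMap ∘ₗ LinearMap.inl ℝ (E 3) ℝ).toAffineMap +
    AffineMap.const ℝ (E 3) (φ (0, 1))), fun q hq => ?_, fun q hq => ?_, fun q hq => ?_⟩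
  · change -(φ (q, 0) + φ (0, 1)) = 0
    rw [← hsplit, hZ _ (Submodule.subset_span ⟨q, hq, rfl⟩), neg_zero]
  · change 0 < -(φ (q, 0) + φ (0, 1))
    have := hC q (Finset.mem_union_left _ hq)
    simp only [v, if_pos (Finset.mem_sdiff.1 hq).1] at this
    rw [← hsplit]
    linarith
  · change -(φ (q, 0) + φ (0, 1)) < 0
    have := hC q (Finset.mem_union_right _ hq)
    simp only [v, if_neg (Finset.mem_sdiff.1 hq).2] at this
    rw [show (-q, (-1 : ℝ)) = -(q, 1) from rfl, map_neg] at this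
    rw [← hsplit]
    linarith

namespace IsFaceMesh

variable {ν : E 3} {c : ℝ} {f : Set (E 3)} {𝒯 : Set (Finset (E 3))} {t t' : Finset (E 3)}
  {x q r : E 3}

theorem relu_neg_mul {κ y : ℝ} (hκ : 0 ≤ κ) : relu (-κ * y) = κ * relu (-y) := by
  simp only [relu]
  rw [mul_max_of_nonneg _ _ hκ, mul_zero, neg_mul, mul_neg]

theorem neg_mul_le_mul_relu {a y : ℝ} (ha : 0 ≤ a) : -(y * a) ≤ a * relu (-y) := by
  have : -y ≤ relu (-y) := le_max_right _ _
  nlinarith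

/-- Let `g` separate `t` from `t'`. If `p ∈ t'`, then `g p = 0`, so `g` involves only the
coordinates of `q` and `r`; adding a large multiple of `g` to the coordinate of `p` brings it below
the nodal function at the vertices of `t'`, hence on `t'`, and the ReLU penalty dominates minus that
multiple. If `p ∉ t'`, the nodal function vanishes on `t'`, and `g ≤ 0` there bounds the coordinate
of `p` by the penalty. -/
theorem exists_hat_le_on (h : IsFaceMesh ν c f 𝒯) {θ : vertices 𝒯 → S1 𝒯 f} (hθ : IsNodal θ)
    (p : vertices 𝒯) (ht : t ∈ 𝒯) (hp : (p : E 3) ∈ t) (hq : q ∈ t) (hr : r ∈ t)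
    (hqp : q ≠ p) (hrp : r ≠ p) (hqr : q ≠ r) (ht' : t' ∈ 𝒯) :
    ∃ κ, 0 ≤ κ ∧ ∀ x ∈ convexHull ℝ (t' : Set (E 3)),
      bary t p x - κ * (relu (-bary t q x) + relu (-bary t r x)) ≤ (θ p : E 3 → ℝ) x := by
  classical
  by_cases htt : t = t'
  · subst htt
    refine ⟨0, le_rfl, fun x hx => ?_⟩
    rw [h.isNodal_apply hθ p ht hp hx, zero_mul, sub_zero]
  have hteq : t = {(p : E 3), q, r} := by
    symm
    refine Finset.eq_of_subset_of_card_le ?_ ?_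
    · intro y hy
      simp only [Finset.mem_insert, Finset.mem_singleton] at hy
      rcases hy with rfl | rfl | rfl <;> assumption
    · rw [(h.regular.simplex t ht).1, Finset.card_insert_of_notMem (by simp [hqp.symm, hrp.symm]),
        Finset.card_pair hqr]
  obtain ⟨g, hg0, hgpos, hgneg⟩ := exists_affine_separating (h.indep ht) (h.indep ht')
    (h.regular.inter t ht t' ht' htt)
  have hgt : ∀ y ∈ t, 0 ≤ g y := fun y hy => by
    by_cases hy' : y ∈ t'
    · exact (hg0 y (Finset.mem_inter.2 ⟨hy, hy'⟩)).ge
    · exact (hgpos y (Finset.mem_sdiff.2 ⟨hy, hy'⟩)).le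
  have hgt' : ∀ y ∈ t', g y ≤ 0 := fun y hy => by
    by_cases hy' : y ∈ t
    · exact (hg0 y (Finset.mem_inter.2 ⟨hy', hy⟩)).le
    · exact (hgneg y (Finset.mem_sdiff.2 ⟨hy, hy'⟩)).le
  have hexp : ∀ x ∈ convexHull ℝ (t' : Set (E 3)),
      g x = bary t p x * g p + (bary t q x * g q + bary t r x * g r) := by
    intro x hx
    rw [affine_eq_sum (h.indep ht) g
      (h.mem_span ht (h.inner_eq_of_mem_closure (h.convexHull_subset ht' hx)))]
    conv_lhs => rw [show (∑ y ∈ t, bary t y x • g y) = ∑ y ∈ {(p : E 3), q, r}, bary t y x • g y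
      from Finset.sum_congr hteq fun _ _ => rfl]
    rw [Finset.sum_insert (by simp [hqp.symm, hrp.symm]), Finset.sum_pair hqr]
    simp only [smul_eq_mul]
  have hgq := hgt q hq
  have hgr := hgt r hr
  by_cases hpt' : (p : E 3) ∈ t'
  · have hgp : g p = 0 := hg0 p (Finset.mem_inter.2 ⟨hp, hpt'⟩)
    -- This makes the coordinate of `p` plus `κ g` nonpositive at the vertices of `t'` outside `t`.
    -- Common vertices have `g y = 0` and contribute zero by the convention for division.
    set κ := ∑ y ∈ t', |bary t p y / g y| with hκ
    have hκ0 : 0 ≤ κ := Finset.sum_nonneg fun _ _ => abs_nonneg _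
    refine ⟨κ * (g q + g r), mul_nonneg hκ0 (add_nonneg hgq hgr), fun x hx => ?_⟩
    have hb := ((mem_convexHull_iff_bary (h.indep ht')).1 hx)
    have hle : bary t p x + κ * g x ≤ (θ p : E 3 → ℝ) x := by
      rw [h.S1_apply _ ht' hx, affine_eq_sum (h.indep ht') g hb.1,
        affine_eq_sum (h.indep ht') (bary t p) hb.1, Finset.mul_sum, ← Finset.sum_add_distrib]
      refine Finset.sum_le_sum fun y hy => ?_
      have hterm : bary t p y + κ * g y ≤ (θ p : E 3 → ℝ) y := by
        by_cases hyt : y ∈ t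
        · rw [hg0 y (Finset.mem_inter.2 ⟨hyt, hy⟩), mul_zero, add_zero,
            h.isNodal_apply hθ p ht hp (subset_convexHull ℝ _ hyt)]
        · have hyp : y ≠ p := fun h' => hyt (h' ▸ hp)
          have hy0 := hgneg y (Finset.mem_sdiff.2 ⟨hy, hyt⟩)
          rw [hθ.ne p ⟨t', ht', hy⟩ hyp]
          have h1 := Finset.single_le_sum (f := fun y => |bary t p y / g y|)
            (fun _ _ => abs_nonneg _) hy
          rw [← hκ, abs_div, abs_of_neg hy0] at h1
          have h2 := (div_le_iff₀ (neg_pos.2 hy0)).1 h1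
          have := le_abs_self (bary t p y)
          linarith
      have := mul_le_mul_of_nonneg_left hterm (hb.2 y hy)
      simp only [smul_eq_mul] at this ⊢
      linarith
    rw [hexp x hx, hgp] at hle
    have h1 := mul_le_mul_of_nonneg_left (neg_mul_le_mul_relu (y := bary t q x) hgq) hκ0
    have h2 := mul_le_mul_of_nonneg_left (neg_mul_le_mul_relu (y := bary t r x) hgr) hκ0
    have h3 : 0 ≤ relu (-bary t q x) := le_max_left _ _
    have h4 : 0 ≤ relu (-bary t r x) := le_max_left _ _
    have h5 := mul_nonneg hκ0 (mul_nonneg hgq h4)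
    have h6 := mul_nonneg hκ0 (mul_nonneg hgr h3)
    nlinarith
  · have hgp : 0 < g p := hgpos p (Finset.mem_sdiff.2 ⟨hp, hpt'⟩)
    refine ⟨(g q + g r) / g p, by positivity, fun x hx => ?_⟩
    rw [h.isNodal_apply_of_notMem hθ p ht' hpt' hx]
    have hb := ((mem_convexHull_iff_bary (h.indep ht')).1 hx)
    have hgx : g x ≤ 0 := by
      rw [affine_eq_sum (h.indep ht') g hb.1]
      exact Finset.sum_nonpos fun y hy => mul_nonpos_of_nonneg_of_nonpos (hb.2 y hy) (hgt' y hy)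
    rw [hexp x hx] at hgx
    have h1 := neg_mul_le_mul_relu (y := bary t q x) hgq
    have h2 := neg_mul_le_mul_relu (y := bary t r x) hgr
    have h3 : 0 ≤ relu (-bary t q x) := le_max_left _ _
    have h4 : 0 ≤ relu (-bary t r x) := le_max_left _ _
    rw [div_mul_eq_mul_div, sub_nonpos, le_div_iff₀ hgp]
    have h5 := mul_nonneg hgq h4
    have h6 := mul_nonneg hgr h3
    nlinarith

/-- On a triangle at the vertex `p` the nodal function of `p` coincides with a function which lies
below the nodal function everywhere. -/
theorem exists_hat (h : IsFaceMesh ν c f 𝒯) {θ : vertices 𝒯 → S1 𝒯 f} (hθ : IsNodal θ)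
    (p : vertices 𝒯) (ht : t ∈ 𝒯) (hp : (p : E 3) ∈ t) : ∃ a b d : E 3 →ᵃ[ℝ] ℝ,
      (∀ x ∈ closure f, a x - relu (b x) - relu (d x) ≤ (θ p : E 3 → ℝ) x) ∧
      ∀ x ∈ convexHull ℝ (t : Set (E 3)), a x - relu (b x) - relu (d x) = (θ p : E 3 → ℝ) x := by
  classical
  have hcard : (t.erase p).card = 2 := by
    rw [Finset.card_erase_of_mem hp, (h.regular.simplex t ht).1]
  obtain ⟨q, r, hqr, hq, hr, -⟩ := exists_eq_pair hcard
  rw [Finset.mem_erase] at hq hr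
  have hex : ∀ t', ∃ κ, 0 ≤ κ ∧ (t' ∈ 𝒯 → ∀ x ∈ convexHull ℝ (t' : Set (E 3)),
      bary t p x - κ * (relu (-bary t q x) + relu (-bary t r x)) ≤ (θ p : E 3 → ℝ) x) := by
    intro t'
    by_cases ht' : t' ∈ 𝒯
    · obtain ⟨κ, h0, h1⟩ := h.exists_hat_le_on hθ p ht hp hq.2 hr.2 hq.1 hr.1 hqr ht'
      exact ⟨κ, h0, fun _ => h1⟩
    · exact ⟨0, le_rfl, fun h => absurd h ht'⟩
  choose κ hκ0 hκ using hex
  -- One penalty that serves all triangles. It may be large, but it enters the weights only and not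
  -- their number. On `t` itself the coordinates are nonnegative and the penalty is zero.
  set K := ∑ t' ∈ h.regular.finite.toFinset, κ t' with hK
  have hK0 : 0 ≤ K := Finset.sum_nonneg fun t' _ => hκ0 t'
  refine ⟨bary t p, -K • bary t q, -K • bary t r, fun x hx => ?_, fun x hx => ?_⟩
  · obtain ⟨t', ht', hxt'⟩ := h.exists_mem_convexHull hx
    have h1 := hκ t' ht' x hxt'
    have h2 : κ t' ≤ K := Finset.single_le_sum (f := κ) (fun t' _ => hκ0 t')
      (h.regular.finite.mem_toFinset.2 ht')
    change bary t p x - relu (-K * bary t q x) - relu (-K * bary t r x) ≤ _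
    rw [relu_neg_mul hK0, relu_neg_mul hK0]
    have h3 : 0 ≤ relu (-bary t q x) := le_max_left _ _
    have h4 : 0 ≤ relu (-bary t r x) := le_max_left _ _
    nlinarith
  · change bary t p x - relu (-K * bary t q x) - relu (-K * bary t r x) = _
    have hb := ((mem_convexHull_iff_bary (h.indep ht)).1 hx).2
    rw [relu_neg_mul hK0, relu_neg_mul hK0, h.isNodal_apply hθ p ht hp hx]
    have h3 : relu (-bary t q x) = 0 := max_eq_left (neg_nonpos.2 (hb q hq.2))
    have h4 : relu (-bary t r x) = 0 := max_eq_left (neg_nonpos.2 (hb r hr.2))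
    rw [h3, h4]
    ring

end IsFaceMesh

end TraceFEM

namespace TraceFEM

/-! ### Parallel emulation of families and spaces of functions -/

/-- Some network with activations in `S`, depth `L` and size at most `M` realizes `w ∘ F` on the
preimage of `A`. -/
def EmulatesOn (S : Set (ℝ → ℝ)) (L M : ℕ) (F : E 2 → E 3) (A : Set (E 3)) (w : E 3 → ℝ) : Prop :=
  ∃ u : (Fin 2 → ℝ) → ℝ, Emulates S L M u ∧ ∀ x : E 2, F x ∈ A → u x.ofLp = w (F x)

section Parallel

variable {S : Set (ℝ → ℝ)} {L M μ : ℕ} {F : E 2 → E 3} {A B : Set (E 3)} {W : Type}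
  {coord : W → Fin μ → ℝ} {l : Filter (E 2)} {τ : Type} [Fintype τ]

theorem EmulatesOn.mono {w : E 3 → ℝ} (h : EmulatesOn S L M F A w) (hB : B ⊆ A) :
    EmulatesOn S L M F B w := by
  obtain ⟨u, h1, h2⟩ := h
  exact ⟨u, h1, fun x hx => h2 x (hB hx)⟩

theorem EmulatesOn.congr {w w' : E 3 → ℝ} (h : EmulatesOn S L M F A w) (hw : EqOn w w' A) :
    EmulatesOn S L M F A w' := by
  obtain ⟨u, h1, h2⟩ := h
  exact ⟨u, h1, fun x hx => (h2 x hx).trans (hw hx)⟩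

theorem EmulatesFamily.mono {ι : Type} {θ : ι → E 3 → W} {M M' : ℝ}
    (h : EmulatesFamily S L M l F coord θ) (hM : M ≤ M') : EmulatesFamily S L M' l F coord θ := by
  intro N enum
  obtain ⟨Φ, h1, h2, h3, h4⟩ := h N enum
  exact ⟨Φ, h1, h2, h3.trans hM, h4⟩

theorem EmulatesSpace.mono [AddCommGroup W] [Module ℝ W] {X : Submodule ℝ (E 3 → W)} {M M' : ℝ}
    (h : EmulatesSpace S L M l F coord X) (hM : M ≤ M') : EmulatesSpace S L M' l F coord X := by
  obtain ⟨Φ, h1, h2⟩ := h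
  exact ⟨Φ, fun v => ⟨(h1 v).1, (h1 v).2.1, (h1 v).2.2.1.trans hM, (h1 v).2.2.2⟩, h2⟩

open Classical in
/-- Functions which are sums of emulated functions, where each summand contributes to at most `r`
functions. -/
theorem emulatesFamily_of_sum {ι : Type} [Finite ι] {θ : ι → E 3 → W} {r : ℕ} (hμ : 0 < μ)
    (R : ι → τ → Prop) (hR : ∀ t, {i | R i t}.ncard ≤ r) (hne : ∃ i t, R i t)
    {w : ι → τ → Fin μ → E 3 → ℝ} (hw : ∀ i t j, R i t → EmulatesOn S L M F B (w i t j))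
    (hsum : ∀ i j, ∀ x ∈ B, coord (θ i x) j = ∑ t, if R i t then w i t j x else 0)
    (hl : ∀ᶠ x in l, F x ∈ B) :
    EmulatesFamily S L ((Fintype.card τ * (r * μ) * M : ℕ) : ℝ) l F coord θ := by
  have := Fintype.ofFinite ι
  intro N enum
  choose! u hu1 hu2 using hw
  obtain ⟨i₀, t₀, h₀⟩ := hne
  have : Nonempty (Σ t, {i // R i t} × Fin μ) := ⟨⟨t₀, ⟨i₀, h₀⟩, ⟨0, hμ⟩⟩⟩
  obtain ⟨Ψ, g1, g2, g3, g4⟩ := Emulates.parallel (S := S) (L := L) (M := M) (N * μ)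
    (fun q : Σ t, {i // R i t} × Fin μ => finProdFinEquiv (enum q.2.1.1, q.2.2))
    (g := fun q => u q.2.1.1 q.1 q.2.2) (fun q => hu1 _ _ _ q.2.1.2)
  refine ⟨Ψ, g1, g2, ?_, ?_⟩
  · refine Nat.cast_le.2 (g3.trans (Nat.mul_le_mul_right _ ?_))
    rw [Fintype.card_sigma]
    refine (Finset.sum_le_card_nsmul _ _ (r * μ) fun t _ => ?_).trans (by simp)
    rw [Fintype.card_prod, Fintype.card_fin]
    refine Nat.mul_le_mul_right _ ?_
    rw [← Nat.card_eq_fintype_card]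
    exact hR t
  · filter_upwards [hl] with x hx i j
    rw [g4, hsum i j _ hx, Fintype.sum_sigma]
    refine Finset.sum_congr rfl fun t _ => ?_
    split_ifs with h
    · rw [Finset.sum_eq_single (⟨i, h⟩, j)]
      · rw [if_pos rfl, hu2 _ _ _ h x hx]
      · rintro ⟨⟨i', h'⟩, j'⟩ - hne
        refine if_neg fun heq => hne ?_
        have := finProdFinEquiv.injective heq
        simp only [Prod.mk.injEq, EmbeddingLike.apply_eq_iff_eq] at this
        simp [this.1, this.2]
      · simp
    · refine Finset.sum_eq_zero ?_
      rintro ⟨⟨i', h'⟩, j'⟩ -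
      refine if_neg fun heq => h ?_
      have := finProdFinEquiv.injective heq
      simp only [Prod.mk.injEq, EmbeddingLike.apply_eq_iff_eq] at this
      exact this.1 ▸ h'

/-- Transport of a vector space structure along an injective map. -/
theorem exists_module_range {X Y : Type*} [AddCommGroup X] [Module ℝ X] {Φ : X → Y}
    (hΦ : Function.Injective Φ) : ∃ (_ : AddCommGroup (range Φ)) (_ : Module ℝ (range Φ)),
      ∀ (v w : X) (c : ℝ), rangeFactorization Φ v + c • rangeFactorization Φ w =
        rangeFactorization Φ (v + c • w) := by
  let e : range Φ ≃ X := (Equiv.ofInjective Φ hΦ).symm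
  have he : ∀ v, e (rangeFactorization Φ v) = v := fun v =>
    (Equiv.ofInjective Φ hΦ).symm_apply_apply v
  let _ : AddCommGroup (range Φ) := e.addCommGroup
  let _ : Module ℝ (range Φ) := e.module ℝ
  refine ⟨inferInstance, inferInstance, fun v w c => ?_⟩
  apply (e.addEquiv).injective
  change e _ = e _
  rw [Equiv.add_def, e.apply_symm_apply, Equiv.smul_def, e.apply_symm_apply, he, he, he]

/-- The summands are added in the output layer. As `B` lies in the range of `F`, the realization
determines the function on `B`, so distinct functions have distinct networks and the linear
structure can be transported. -/
theorem emulatesSpace_of_sum [AddCommGroup W] [Module ℝ W] [Nonempty τ] {X : Submodule ℝ (E 3 → W)}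
    (hμ : 0 < μ) (hcoord : Function.Injective coord) {w : X → τ → Fin μ → E 3 → ℝ}
    (hw : ∀ v t j, EmulatesOn S L M F B (w v t j))
    (hsum : ∀ (v : X) j, ∀ x ∈ B, coord ((v : E 3 → W) x) j = ∑ t, w v t j x)
    (hinj : ∀ v v' : X, EqOn (v : E 3 → W) v' B → v = v') (hB : B ⊆ range F)
    (hl : ∀ᶠ x in l, F x ∈ B) :
    EmulatesSpace S L ((Fintype.card τ * μ * M : ℕ) : ℝ) l F coord X := by
  choose u hu1 hu2 using hw
  have : Nonempty (τ × Fin μ) := ⟨⟨Classical.arbitrary τ, ⟨0, hμ⟩⟩⟩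
  have hnet : ∀ v : X, ∃ Ψ : NN 2 μ, Ψ.UsesOnly S ∧ Ψ.depth = L ∧
      Ψ.size ≤ Fintype.card (τ × Fin μ) * M ∧
      ∀ x, F x ∈ B → Ψ.realize x.ofLp = coord ((v : E 3 → W) (F x)) := by
    intro v
    obtain ⟨Ψ, g1, g2, g3, g4⟩ := Emulates.parallel (S := S) (L := L) (M := M) μ
      (fun q : τ × Fin μ => q.2) (g := fun q => u v q.1 q.2) (fun q => hu1 _ _ _)
    refine ⟨Ψ, g1, g2, g3, fun x hx => funext fun j => ?_⟩
    rw [g4, hsum v j _ hx, Fintype.sum_prod_type]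
    refine Finset.sum_congr rfl fun t _ => ?_
    rw [Finset.sum_ite_eq' Finset.univ j, if_pos (Finset.mem_univ _), hu2 _ _ _ x hx]
  choose Φ h1 h2 h3 h4 using hnet
  refine ⟨Φ, fun v => ⟨h1 v, h2 v, ?_, ?_⟩, exists_module_range fun v v' hv => hinj v v' ?_⟩
  · refine Nat.cast_le.2 ((h3 v).trans_eq ?_)
    rw [Fintype.card_prod, Fintype.card_fin]
  · filter_upwards [hl] with x hx using h4 v x hx
  · intro y hy
    obtain ⟨x, rfl⟩ := hB hy
    refine hcoord ?_
    rw [← h4 v x hy, ← h4 v' x hy, hv]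

end Parallel

end TraceFEM

namespace TraceFEM

/-! ### Emulation of piecewise affine functions on a face mesh -/

/-- Composition of affine maps, with respect to the coordinates of the plane. -/
def pull (g : E 3 →ᵃ[ℝ] ℝ) (F : E 2 →ᵃ[ℝ] E 3) : (Fin 2 → ℝ) →ᵃ[ℝ] ℝ :=
  (g.comp F).comp (WithLp.linearEquiv 2 ℝ (Fin 2 → ℝ)).symm.toLinearMap.toAffineMap

theorem pull_apply (g : E 3 →ᵃ[ℝ] ℝ) (F : E 2 →ᵃ[ℝ] E 3) (x : E 2) :
    pull g F x.ofLp = g (F x) := rfl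

namespace IsFaceMesh

variable {ν : E 3} {c : ℝ} {f D : Set (E 3)} {𝒯 : Set (Finset (E 3))} {t : Finset (E 3)}
  {x : E 3}

theorem isCompact_closure (h : IsFaceMesh ν c f 𝒯) : IsCompact (closure f) := by
  rw [← h.regular.cover]
  exact h.regular.finite.isCompact_biUnion fun t _ => t.finite_toSet.isCompact_convexHull (𝕜 := ℝ)

open Classical in
theorem indicator_openHull (h : IsFaceMesh ν c f 𝒯) (ht : t ∈ 𝒯) (e : Fin 3 ≃ t) (g : E 3 → ℝ)
    (hx : x ∈ closure f) : (openHull t).indicator g x =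
      if ∀ i, 0 < bary t (e i) x then g x else 0 := by
  rw [indicator_apply]
  refine if_congr ((h.mem_openHull ht (h.inner_eq_of_mem_closure hx)).trans ?_) rfl rfl
  exact ⟨fun H i => H _ (e i).2, fun H p hp => by simpa using H (e.symm ⟨p, hp⟩)⟩

theorem exists_equiv_fin (h : IsFaceMesh ν c f 𝒯) (ht : t ∈ 𝒯) : Nonempty (Fin 3 ≃ t) :=
  ⟨(Fintype.equivFinOfCardEq (by simpa using (h.regular.simplex t ht).1)).symm⟩

theorem exists_emulatesOn_indicator_const : ∃ M, ∀ {ν : E 3} {c : ℝ} {f : Set (E 3)}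
    {𝒯 : Set (Finset (E 3))}, IsFaceMesh ν c f 𝒯 → ∀ t ∈ 𝒯, ∀ (F : E 2 →ᵃ[ℝ] E 3) (k : ℝ),
      EmulatesOn {relu, bisu} 3 M F (closure f) ((openHull t).indicator fun _ => k) := by
  obtain ⟨M, hM⟩ := exists_emulates_indicator_mul_const 2
  refine ⟨M, fun h t ht F k => ?_⟩
  obtain ⟨e⟩ := h.exists_equiv_fin ht
  refine ⟨_, hM (fun i => pull (bary t (e i)) F) k, fun x hx => ?_⟩
  simp only [pull_apply]
  rw [h.indicator_openHull ht e _ hx]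
  congr

theorem exists_emulatesOn_indicator_affine : ∃ M, ∀ {ν : E 3} {c : ℝ} {f : Set (E 3)}
    {𝒯 : Set (Finset (E 3))}, IsFaceMesh ν c f 𝒯 → ∀ t ∈ 𝒯, ∀ (F : E 2 →ᵃ[ℝ] E 3)
      (g : E 3 →ᵃ[ℝ] ℝ),
      EmulatesOn {relu, bisu} 5 M F (closure f) ((openHull t).indicator g) := by
  obtain ⟨M, hM⟩ := exists_emulates_indicator_mul_affine 2
  refine ⟨M, fun h t ht F g => ?_⟩
  obtain ⟨e⟩ := h.exists_equiv_fin ht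
  obtain ⟨κ, hκ⟩ := h.isCompact_closure.exists_bound_of_continuousOn
    (continuous_affine g).continuousOn
  obtain ⟨u, h1, h2⟩ := hM (fun i => pull (bary t (e i)) F) (pull g F) κ
  refine ⟨u, h1, fun x hx => ?_⟩
  rw [h2 x.ofLp (hκ _ hx)]
  simp only [pull_apply]
  rw [h.indicator_openHull ht e _ hx]
  congr

/-- On a mesh with bounded valence the nodal functions are emulated by ReLU networks. -/
theorem exists_emulatesOn_nodal (N : ℕ) : ∃ L M, ∀ {ν : E 3} {c : ℝ} {f : Set (E 3)}
    {𝒯 : Set (Finset (E 3))}, IsFaceMesh ν c f 𝒯 → (∀ p, {t ∈ 𝒯 | p ∈ t}.ncard ≤ N) →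
      ∀ {θ : vertices 𝒯 → S1 𝒯 f}, IsNodal θ → ∀ (p : vertices 𝒯) (F : E 2 →ᵃ[ℝ] E 3),
      EmulatesOn {relu} L M F (closure f) (θ p) := by
  obtain ⟨L, M, hLM⟩ := exists_emulates_max 2 N
  refine ⟨L, M, fun {ν c f 𝒯} h hN {θ} hθ p F => ?_⟩
  have hfin : Finite {t ∈ 𝒯 | (p : E 3) ∈ t} := h.regular.finite.subset fun t ht => ht.1
  have := Fintype.ofFinite {t ∈ 𝒯 | (p : E 3) ∈ t}
  obtain ⟨t₀, ht₀, hp₀⟩ := p.2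
  have : Nonempty {t ∈ 𝒯 | (p : E 3) ∈ t} := ⟨⟨t₀, ht₀, hp₀⟩⟩
  obtain ⟨φ⟩ := Function.Embedding.nonempty_of_card_le (α := {t ∈ 𝒯 | (p : E 3) ∈ t})
    (β := Fin N) (by
      rw [Fintype.card_fin, ← Nat.card_eq_fintype_card]
      exact hN p)
  have hsurj := Function.invFun_surjective φ.injective
  -- There may be fewer than `N` triangles at `p`; repeating some of them fills all `N` slots of the
  -- maximum.
  set σ := Function.invFun φ
  choose a b d hle heq using fun i : Fin N => h.exists_hat hθ p (σ i).2.1 (σ i).2.2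
  obtain ⟨u, h1, h2⟩ := hLM (fun i => pull (a i) F) (fun i => pull (b i) F) fun i => pull (d i) F
  refine ⟨u, h1, fun x hx => (h2 x.ofLp).unique ⟨?_, ?_⟩⟩
  -- The nodal function is attained: on a triangle at `p` by its own term, on any other triangle by
  -- the value `0`.
  · obtain ⟨t, ht, hxt⟩ := h.exists_mem_convexHull hx
    by_cases hp : (p : E 3) ∈ t
    · obtain ⟨i, hi⟩ := hsurj ⟨t, ht, hp⟩
      refine Or.inr ⟨i, heq i _ ?_⟩
      rw [hi]
      exact hxt
    · exact Or.inl (h.isNodal_apply_of_notMem hθ p ht hp hxt)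
  · rintro y (rfl | ⟨i, rfl⟩)
    · exact h.isNodal_nonneg hθ p hx
    · exact hle i _ hx

theorem sum_indicator_openHull [Fintype 𝒯] (h : IsFaceMesh ν c f 𝒯) (φ : E 3 → ℝ)
    (hx : x ∈ cells 𝒯) : ∑ t : 𝒯, (openHull (t : Finset (E 3))).indicator φ x = φ x := by
  obtain ⟨t, ht, hxt⟩ := mem_iUnion₂.1 hx
  exact h.piecewise_apply (fun _ => φ) ⟨t, ht⟩ hxt

theorem measure_affine_eq_zero {g : E 2 →ᵃ[ℝ] ℝ} {y : E 2} (hy : g y ≠ 0) :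
    volume {x | g x = 0} = 0 := by
  have : {x | g x = 0} = ((affineSpan ℝ {(0 : ℝ)}).comap g : Set (E 2)) := by
    ext x
    simp
  rw [this]
  refine Measure.addHaar_affineSubspace _ _ fun htop => hy ?_
  have : y ∈ (affineSpan ℝ {(0 : ℝ)}).comap g := htop ▸ AffineSubspace.mem_top ℝ _ y
  simpa using this

/-- `D` is enlarged to the closed preimage of the closed face, which is measurable. Its points
outside the cells lie in finitely many zero sets of affine functions that do not vanish identically,
and these are null sets. -/
theorem ae_mem_cells (h : IsFaceMesh ν c f 𝒯) {F : E 2 →ᵃ[ℝ] E 3} {D : Set (E 2)}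
    (hF : BijOn F D f) : ∀ᶠ x in ae (volume.restrict D), F x ∈ cells 𝒯 := by
  have hFc : Continuous F := F.continuous_of_finiteDimensional
  have hD : D ⊆ F ⁻¹' closure f := fun x hx => subset_closure (hF.mapsTo hx)
  refine ae_mono (Measure.restrict_mono hD le_rfl) ?_
  change ∀ᵐ x ∂(volume.restrict (F ⁻¹' closure f)), F x ∈ cells 𝒯
  rw [ae_restrict_iff' (isClosed_closure.preimage hFc).measurableSet]
  have hnull : volume (⋃ t ∈ 𝒯, ⋃ p ∈ t, {x | (bary t p).comp F x = 0}) = 0 := by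
    refine (measure_biUnion_null_iff h.regular.finite.countable).2 fun t ht => ?_
    refine (measure_biUnion_null_iff t.countable_toSet).2 fun p hp => ?_
    obtain ⟨y, hy⟩ := openHull_nonempty (h.regular.simplex t ht).nonempty
    obtain ⟨x, -, rfl⟩ := hF.surjOn (h.openHull_subset t ht hy)
    exact measure_affine_eq_zero (y := x)
      (((mem_openHull_iff_bary (h.indep ht)).1 hy).2 p hp).ne'
  refine measure_mono_null (fun x hx => ?_) hnull
  simp only [mem_compl_iff, mem_ofPred_eq, Classical.not_imp] at hx
  obtain ⟨hxf, hxc⟩ := hx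
  obtain ⟨t, ht, hxt⟩ := h.exists_mem_convexHull hxf
  by_contra hne
  refine hxc (mem_iUnion₂.2 ⟨t, ht, ?_⟩)
  rw [mem_convexHull_iff_bary (h.indep ht)] at hxt
  refine (mem_openHull_iff_bary (h.indep ht)).2 ⟨hxt.1, fun p hp => (hxt.2 p hp).lt_of_ne' ?_⟩
  exact fun h0 => hne (mem_iUnion₂.2 ⟨t, ht, mem_iUnion₂.2 ⟨p, hp, h0⟩⟩)

theorem closure_subset_closure_cells (h : IsFaceMesh ν c f 𝒯) : closure f ⊆ closure (cells 𝒯) := by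
  intro x hx
  obtain ⟨t, ht, hxt⟩ := h.exists_mem_convexHull hx
  rw [← closure_openHull (h.regular.simplex t ht).nonempty] at hxt
  exact closure_mono (subset_biUnion_of_mem (u := fun t => openHull t) ht) hxt

theorem S1_ext_cells (h : IsFaceMesh ν c f 𝒯) {v w : S1 𝒯 f}
    (hvw : EqOn (v : E 3 → ℝ) w (cells 𝒯)) : v = w := by
  refine Subtype.ext (funext fun x => ?_)
  by_cases hx : x ∈ closure f
  · exact hvw.of_subset_closure v.2.2.1 w.2.2.1 (h.cells_subset.trans subset_closure)
      h.closure_subset_closure_cells hx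
  · rw [v.2.1 x hx, w.2.1 x hx]

end IsFaceMesh

theorem ext_of_eqOn {W : Type} [AddCommGroup W] [Module ℝ W] {X : Submodule ℝ (E 3 → W)}
    {A : Set (E 3)} (hX : ∀ v ∈ X, ∀ x ∉ A, v x = 0) {v w : X}
    (hvw : EqOn (v : E 3 → W) w A) : v = w := by
  refine Subtype.ext (funext fun x => ?_)
  by_cases hx : x ∈ A
  · exact hvw hx
  · rw [hX v v.2 x hx, hX w w.2 x hx]

open Classical in
-- A single summand survives, because an interior point determines its triangle and the triangle
-- determines the vertex opposite to `e`.
theorem shapeRT0_apply {𝒯 : Set (Finset (E 3))} {ν : E 3} {c : ℝ} {f : Set (E 3)}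
    (h : IsFaceMesh ν c f 𝒯) {e : Finset (E 3)} (t₁ : Finset (E 3)) {a x : E 3} (hae : a ∉ e)
    (ha : insert a e ∈ 𝒯) (hx : x ∈ openHull (insert a e)) :
    shapeRT0 𝒯 e t₁ x = ((if insert a e = t₁ then 1 else -1) *
      (simplexVol 1 e / (2 * simplexVol 2 (insert a e)))) • (x - a) := by
  unfold shapeRT0
  rw [finsum_eq_single _ a]
  · rw [finsum_eq_if, if_pos (show a ∈ {a | a ∉ e ∧ insert a e ∈ 𝒯} from ⟨hae, ha⟩),
      indicator_of_mem hx]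
  · intro b hb
    rw [finsum_eq_if]
    by_cases hb' : b ∈ {b | b ∉ e ∧ insert b e ∈ 𝒯}
    · rw [if_pos hb']
      refine indicator_of_notMem (fun hxb => hb ?_) _
      have hba := Finset.mem_insert_self b e
      rw [h.eq_of_mem_openHull hb'.2 ha hxb (openHull_subset_convexHull _ hx)] at hba
      exact (Finset.mem_insert.1 hba).resolve_right hb'.1
    · rw [if_neg hb']

open Classical in
theorem exists_affine_shapeRT0 {𝒯 : Set (Finset (E 3))} {ν : E 3} {c : ℝ} {f : Set (E 3)}
    (h : IsFaceMesh ν c f 𝒯) {e : Finset (E 3)} (he : e.card = 2) (t₁ : Finset (E 3))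
    {t : Finset (E 3)} (ht : t ∈ 𝒯) (het : e ⊆ t) :
    ∃ g : E 3 →ᵃ[ℝ] E 3, ∀ x ∈ openHull t, shapeRT0 𝒯 e t₁ x = g x := by
  obtain ⟨a, hae, rfl⟩ := (Finset.exists_eq_insert_iff (s := e) (t := t)).2
    ⟨het, by rw [he, (h.regular.simplex t ht).1]⟩
  exact ⟨((if insert a e = t₁ then 1 else -1) *
      (simplexVol 1 e / (2 * simplexVol 2 (insert a e)))) •
    (AffineMap.id ℝ (E 3) - AffineMap.const ℝ (E 3) a), fun x hx => shapeRT0_apply h t₁ hae ht hx⟩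

theorem shapeRT0_eq_zero {𝒯 : Set (Finset (E 3))} {ν : E 3} {c : ℝ} {f : Set (E 3)}
    (h : IsFaceMesh ν c f 𝒯) {e : Finset (E 3)} (t₁ : Finset (E 3))
    {t : Finset (E 3)} (ht : t ∈ 𝒯) (het : ¬ e ⊆ t) {x : E 3} (hx : x ∈ openHull t) :
    shapeRT0 𝒯 e t₁ x = 0 := by
  classical
  refine finsum_mem_eq_zero_of_forall_eq_zero fun b hb => indicator_of_notMem (fun hxb => het ?_) _
  rw [← h.eq_of_mem_openHull hb.2 ht hxb (openHull_subset_convexHull _ hx)]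
  exact Finset.subset_insert _ _

end TraceFEM

/-! ### Emulation of the finite element families and spaces -/

namespace TraceFEM

theorem vectorCoord_injective : Function.Injective vectorCoord := fun _ _ h => WithLp.ofLp_injective 2 h

theorem scalarCoord_injective : Function.Injective scalarCoord := fun _ _ h => congrFun h 0

theorem ncard_vertices_le {𝒯 : Set (Finset (E 3))} {t : Finset (E 3)} :
    {p : vertices 𝒯 | (p : E 3) ∈ t}.ncard ≤ t.card := by
  rw [← ncard_image_of_injective _ Subtype.val_injective, ← ncard_coe_finset]
  refine ncard_le_ncard ?_ t.finite_toSet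
  rintro _ ⟨p, hp, rfl⟩
  exact hp

theorem ncard_edges_le {𝒯 : Set (Finset (E 3))} {t : Finset (E 3)} :
    {e : edges 𝒯 | (e : Finset (E 3)) ⊆ t}.ncard ≤ t.card.choose 2 := by
  rw [← ncard_image_of_injective _ Subtype.val_injective, ← Finset.card_powersetCard,
    ← ncard_coe_finset]
  refine ncard_le_ncard ?_ (Finset.finite_toSet _)
  rintro _ ⟨e, he, rfl⟩
  exact Finset.mem_coe.2 (Finset.mem_powersetCard.2 ⟨he, e.2.1⟩)

theorem cast_mul_le {T a M b n C : ℕ} (hT : T ≤ b * n) (hC : b * (a * M) ≤ C) :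
    ((T * a * M : ℕ) : ℝ) ≤ (C : ℝ) * n := by
  norm_cast
  calc T * a * M = T * (a * M) := mul_assoc _ _ _
    _ ≤ b * n * (a * M) := Nat.mul_le_mul_right _ hT
    _ = b * (a * M) * n := by ring
    _ ≤ C * n := Nat.mul_le_mul_right _ hC

namespace IsFaceMesh

variable {ν : E 3} {c : ℝ} {f : Set (E 3)} {𝒯 : Set (Finset (E 3))} {F : E 2 →ᵃ[ℝ] E 3}
  {D : Set (E 2)} {S : Set (ℝ → ℝ)} {L M μ : ℕ} {W : Type} {coord : W → Fin μ → ℝ}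

/-- Families of functions of which at most `r` do not vanish on a triangle. -/
theorem emulatesFamily (h : IsFaceMesh ν c f 𝒯) (hF : BijOn F D f) {ι : Type} [Finite ι]
    {θ : ι → E 3 → W} {r : ℕ} (hμ : 0 < μ) (R : ι → Finset (E 3) → Prop)
    (hR : ∀ t ∈ 𝒯, {i | R i t}.ncard ≤ r) (hne : ∀ t ∈ 𝒯, ∃ i, R i t)
    (hw : ∀ i, ∀ t ∈ 𝒯, R i t → ∀ j, EmulatesOn S L M F (closure f)
      ((openHull t).indicator fun x => coord (θ i x) j))
    (hzero : ∀ i, ∀ t ∈ 𝒯, ¬ R i t → ∀ x ∈ openHull t, ∀ j, coord (θ i x) j = 0) :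
    EmulatesFamily S L ((𝒯.ncard * (r * μ) * M : ℕ) : ℝ) (ae (volume.restrict D)) F coord θ := by
  classical
  have := h.regular.finite.fintype
  obtain ⟨t₀, ht₀⟩ := h.mesh_nonempty
  obtain ⟨i₀, hi₀⟩ := hne t₀ ht₀
  have H := emulatesFamily_of_sum (τ := 𝒯) (B := cells 𝒯) hμ (fun i t => R i t) (fun t => hR t t.2)
    ⟨i₀, ⟨t₀, ht₀⟩, hi₀⟩ (S := S) (L := L) (M := M) (F := F) (coord := coord) (θ := θ)
    (fun i t j hit => (hw i t t.2 hit j).mono (h.cells_subset.trans subset_closure)) ?_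
    (h.ae_mem_cells hF)
  · rwa [← Nat.card_eq_fintype_card, Nat.card_coe_set_eq] at H
  · intro i j x hx
    rw [← h.sum_indicator_openHull (fun x => coord (θ i x) j) hx]
    refine Finset.sum_congr rfl fun t _ => ?_
    split_ifs with hit
    · rfl
    · refine indicator_apply_eq_zero.2 fun hxt => hzero i t t.2 hit x hxt j

theorem emulatesSpace (h : IsFaceMesh ν c f 𝒯) (hF : BijOn F D f) [AddCommGroup W] [Module ℝ W]
    {X : Submodule ℝ (E 3 → W)} (hμ : 0 < μ) (hcoord : Function.Injective coord)
    (hw : ∀ v ∈ X, ∀ t ∈ 𝒯, ∀ j, EmulatesOn S L M F (closure f)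
      ((openHull t).indicator fun x => coord (v x) j))
    (hX : ∀ v v' : X, EqOn (v : E 3 → W) v' (cells 𝒯) → v = v') :
    EmulatesSpace S L ((𝒯.ncard * μ * M : ℕ) : ℝ) (ae (volume.restrict D)) F coord X := by
  have := h.regular.finite.fintype
  have : Nonempty 𝒯 := h.mesh_nonempty.to_subtype
  have H := emulatesSpace_of_sum (τ := 𝒯) (B := cells 𝒯) hμ hcoord
    (S := S) (L := L) (M := M) (F := F) (X := X)
    (fun v t j => (hw v v.2 t t.2 j).mono (h.cells_subset.trans subset_closure))
    (fun v j x hx => (h.sum_indicator_openHull (fun x => coord ((v : E 3 → W) x) j) hx).symm) hX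
    ?_ (h.ae_mem_cells hF)
  · rwa [← Nat.card_eq_fintype_card, Nat.card_coe_set_eq] at H
  · refine h.cells_subset.trans fun y hy => ?_
    obtain ⟨x, -, rfl⟩ := hF.surjOn hy
    exact mem_range_self x

/-- A size with which all functions that are affine on a triangle and vanish elsewhere are
emulated. -/
def AffineSize (M : ℕ) : Prop :=
  ∀ {ν : E 3} {c : ℝ} {f : Set (E 3)} {𝒯 : Set (Finset (E 3))}, IsFaceMesh ν c f 𝒯 →
    ∀ t ∈ 𝒯, ∀ (F : E 2 →ᵃ[ℝ] E 3) (g : E 3 →ᵃ[ℝ] ℝ),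
      EmulatesOn {relu, bisu} 5 M F (closure f) ((openHull t).indicator g)

theorem AffineSize.scalar (hM : AffineSize M) (h : IsFaceMesh ν c f 𝒯) {t : Finset (E 3)}
    (ht : t ∈ 𝒯) {v : E 3 → ℝ} {g : E 3 →ᵃ[ℝ] ℝ} (hv : ∀ x ∈ openHull t, v x = g x) (j : Fin 1) :
    EmulatesOn {relu, bisu} 5 M F (closure f)
      ((openHull t).indicator fun x => scalarCoord (v x) j) :=
  (hM h t ht F g).congr fun x _ => congrFun (indicator_congr fun x hx => (hv x hx).symm) x

theorem AffineSize.vector (hM : AffineSize M) (h : IsFaceMesh ν c f 𝒯) {t : Finset (E 3)}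
    (ht : t ∈ 𝒯) {v : E 3 → E 3} {g : E 3 →ᵃ[ℝ] E 3} (hv : ∀ x ∈ openHull t, v x = g x)
    (j : Fin 3) : EmulatesOn {relu, bisu} 5 M F (closure f)
      ((openHull t).indicator fun x => vectorCoord (v x) j) := by
  refine (hM h t ht F ((EuclideanSpace.proj j : E 3 →L[ℝ] ℝ).toLinearMap.toAffineMap.comp
    g)).congr fun x _ => congrFun (indicator_congr fun x hx => ?_) x
  rw [hv x hx]
  rfl

theorem emulatesFamily_nodal (h : IsFaceMesh ν c f 𝒯) (hF : BijOn F D f) (hM : AffineSize M)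
    {θ : vertices 𝒯 → S1 𝒯 f} (hθ : IsNodal θ) :
    EmulatesFamily {relu, bisu} 5 ((𝒯.ncard * (3 * 1) * M : ℕ) : ℝ) (ae (volume.restrict D)) F
      scalarCoord fun p => (θ p : E 3 → ℝ) := by
  have : Finite (vertices 𝒯) := vertices_finite h.regular.finite
  refine h.emulatesFamily hF one_pos (fun p t => (p : E 3) ∈ t) (fun t ht => ?_) (fun t ht => ?_)
    (fun p t ht hp j => ?_) fun p t ht hp x hx j => ?_
  · exact ncard_vertices_le.trans_eq (h.regular.simplex t ht).1
  · obtain ⟨p, hp⟩ := (h.regular.simplex t ht).nonempty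
    exact ⟨⟨p, t, ht, hp⟩, hp⟩
  · exact hM.scalar h ht (fun x hx =>
      h.isNodal_apply hθ p ht hp (openHull_subset_convexHull _ hx)) j
  · exact h.isNodal_apply_of_notMem hθ p ht hp (openHull_subset_convexHull _ hx)

/-- A triangle has three edges, and the values have three components; this is the factor `3 * 3`. -/
theorem emulatesFamily_edges (h : IsFaceMesh ν c f 𝒯) (hF : BijOn F D f) (hM : AffineSize M)
    {θ : edges 𝒯 → E 3 → E 3}
    (hθ : ∀ e : edges 𝒯, ∀ t ∈ 𝒯, e.1 ⊆ t → ∃ g : E 3 →ᵃ[ℝ] E 3, ∀ x ∈ openHull t, θ e x = g x)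
    (hzero : ∀ e : edges 𝒯, ∀ t ∈ 𝒯, ¬ e.1 ⊆ t → ∀ x ∈ openHull t, θ e x = 0) :
    EmulatesFamily {relu, bisu} 5 ((𝒯.ncard * (3 * 3) * M : ℕ) : ℝ) (ae (volume.restrict D)) F
      vectorCoord θ := by
  have : Finite (edges 𝒯) := edges_finite h.regular.finite
  refine h.emulatesFamily hF three_pos (fun e t => (e : Finset (E 3)) ⊆ t) (fun t ht => ?_)
    (fun t ht => ?_) (fun e t ht he j => ?_) fun e t ht he x hx j => ?_
  · exact ncard_edges_le.trans_eq (by rw [(h.regular.simplex t ht).1]; rfl)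
  · obtain ⟨e, het, he⟩ := Finset.exists_subset_card_eq (s := t) (n := 2)
      (by rw [(h.regular.simplex t ht).1]; norm_num)
    exact ⟨⟨e, he, t, ht, het⟩, het⟩
  · obtain ⟨g, hg⟩ := hθ e t ht he
    exact hM.vector h ht hg j
  · rw [hzero e t ht he x hx]
    rfl

theorem emulatesFamily_shapeRT0 (h : IsFaceMesh ν c f 𝒯) (hF : BijOn F D f) (hM : AffineSize M)
    (first : edges 𝒯 → 𝒯) :
    EmulatesFamily {relu, bisu} 5 ((𝒯.ncard * (3 * 3) * M : ℕ) : ℝ) (ae (volume.restrict D)) F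
      vectorCoord fun e : edges 𝒯 => shapeRT0 𝒯 e.1 (first e).1 :=
  h.emulatesFamily_edges hF hM (fun e _ ht het => exists_affine_shapeRT0 h e.2.1 _ ht het)
    fun _ _ ht het _ hx => shapeRT0_eq_zero h _ ht het hx

theorem emulatesFamily_shapeN0 (h : IsFaceMesh ν c f 𝒯) (hF : BijOn F D f) (hM : AffineSize M)
    (first : edges 𝒯 → 𝒯) :
    EmulatesFamily {relu, bisu} 5 ((𝒯.ncard * (3 * 3) * M : ℕ) : ℝ) (ae (volume.restrict D)) F
      vectorCoord fun e : edges 𝒯 => shapeN0 ν 𝒯 e.1 (first e).1 := by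
  refine h.emulatesFamily_edges hF hM (fun e t ht het => ?_) fun e t ht het x hx => ?_
  · obtain ⟨g, hg⟩ := exists_affine_shapeRT0 h e.2.1 (first e).1 ht het
    exact ⟨(crossₗ ν).toAffineMap.comp g, fun x hx => congrArg (cross ν) (hg x hx)⟩
  · rw [shapeN0, shapeRT0_eq_zero h _ ht het hx]
    exact map_zero (crossₗ ν)

theorem emulatesSpace_S1 (h : IsFaceMesh ν c f 𝒯) (hF : BijOn F D f) (hM : AffineSize M) :
    EmulatesSpace {relu, bisu} 5 ((𝒯.ncard * 1 * M : ℕ) : ℝ) (ae (volume.restrict D)) F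
      scalarCoord (S1 𝒯 f) := by
  refine h.emulatesSpace hF one_pos scalarCoord_injective (fun v hv t ht j => ?_)
    fun _ _ => h.S1_ext_cells
  obtain ⟨g, hg⟩ := hv.2.2 t ht
  exact hM.scalar h ht hg j

theorem emulatesSpace_RT0 (h : IsFaceMesh ν c f 𝒯) (hF : BijOn F D f) (hM : AffineSize M) :
    EmulatesSpace {relu, bisu} 5 ((𝒯.ncard * 3 * M : ℕ) : ℝ) (ae (volume.restrict D)) F
      vectorCoord (RT0 𝒯 f ν) := by
  refine h.emulatesSpace hF three_pos vectorCoord_injective (fun v hv t ht j => ?_)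
    fun _ _ => ext_of_eqOn fun v (hv : v ∈ RT0 𝒯 f ν) => hv.1
  obtain ⟨a, k, hg⟩ := hv.2.1 t ht
  exact hM.vector h ht (g := AffineMap.const ℝ (E 3) a + k • AffineMap.id ℝ (E 3))
    (fun x hx => (hg x hx).1) j

theorem emulatesSpace_N0 (h : IsFaceMesh ν c f 𝒯) (hF : BijOn F D f) (hM : AffineSize M) :
    EmulatesSpace {relu, bisu} 5 ((𝒯.ncard * 3 * M : ℕ) : ℝ) (ae (volume.restrict D)) F
      vectorCoord (N0 𝒯 f ν) := by
  refine h.emulatesSpace hF three_pos vectorCoord_injective (fun v hv t ht j => ?_)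
    fun _ _ => ext_of_eqOn fun v (hv : v ∈ N0 𝒯 f ν) => hv.1
  obtain ⟨a, k, hg⟩ := hv.2.1 t ht
  exact hM.vector h ht (g := AffineMap.const ℝ (E 3) a + k • (crossₗ ν).toAffineMap)
    (fun x hx => (hg x hx).1) j

theorem emulatesFamily_shapeS0 (h : IsFaceMesh ν c f 𝒯) (hF : BijOn F D f)
    (hM : ∀ t ∈ 𝒯, ∀ k : ℝ,
      EmulatesOn {relu, bisu} 3 M F (closure f) ((openHull t).indicator fun _ => k)) :
    EmulatesFamily {relu, bisu} 3 ((𝒯.ncard * (1 * 1) * M : ℕ) : ℝ) (ae (volume.restrict D)) F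
      scalarCoord fun t : 𝒯 => shapeS0 t.1 := by
  have : Finite 𝒯 := h.regular.finite
  refine h.emulatesFamily hF one_pos (fun s t => (s : Finset (E 3)) = t) (fun t ht => ?_)
    (fun t ht => ⟨⟨t, ht⟩, rfl⟩) (fun s t ht hst j => ?_) fun s t ht hst x hx j => ?_
  · exact (ncard_le_one_iff (toFinite _)).2 fun {a b} ha hb =>
      Subtype.ext (Eq.trans ha (Eq.symm hb))
  · subst hst
    refine (hM s s.2 1).congr fun x _ => congrFun (indicator_congr fun x hx => ?_) x
    exact (indicator_of_mem hx fun _ => (1 : ℝ)).symm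
  · exact indicator_of_notMem (fun hxs => hst (h.eq_of_mem_openHull s.2 ht hxs
      (openHull_subset_convexHull _ hx))) fun _ => (1 : ℝ)

theorem emulatesSpace_S0 (h : IsFaceMesh ν c f 𝒯) (hF : BijOn F D f)
    (hM : ∀ t ∈ 𝒯, ∀ k : ℝ,
      EmulatesOn {relu, bisu} 3 M F (closure f) ((openHull t).indicator fun _ => k)) :
    EmulatesSpace {relu, bisu} 3 ((𝒯.ncard * 1 * M : ℕ) : ℝ) (ae (volume.restrict D)) F
      scalarCoord (S0 𝒯) := by
  refine h.emulatesSpace hF one_pos scalarCoord_injective (fun v hv t ht j => ?_)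
    fun _ _ => ext_of_eqOn fun v (hv : v ∈ S0 𝒯) => hv.1
  obtain ⟨k, hk⟩ := hv.2 t ht
  exact (hM t ht k).congr fun x _ => congrFun (indicator_congr fun x hx => (hk x hx).symm) x

theorem mapsTo_closure (hF : BijOn F D f) : MapsTo F (closure D) (closure f) :=
  hF.mapsTo.closure F.continuous_of_finiteDimensional

/-- Each nodal function is its own only summand, without a decomposition into triangles, which is
why the identity holds up to the boundary. -/
theorem emulatesFamily_nodal_relu (h : IsFaceMesh ν c f 𝒯) (hF : BijOn F D f)
    {θ : vertices 𝒯 → S1 𝒯 f}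
    (hθ : ∀ p, EmulatesOn {relu} L M F (closure f) (θ p)) :
    EmulatesFamily {relu} L (((vertices 𝒯).ncard * (1 * 1) * M : ℕ) : ℝ) (𝓟 (closure D)) F
      scalarCoord fun p => (θ p : E 3 → ℝ) := by
  classical
  have := (vertices_finite h.regular.finite).fintype
  obtain ⟨t, ht⟩ := h.mesh_nonempty
  obtain ⟨p, hp⟩ := (h.regular.simplex t ht).nonempty
  have H := emulatesFamily_of_sum (S := {relu}) (L := L) (M := M) (F := F) (B := closure f)
    (coord := scalarCoord) (l := 𝓟 (closure D)) (τ := vertices 𝒯)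
    (θ := fun p => (θ p : E 3 → ℝ)) (r := 1) one_pos (fun p q => p = q) (fun q => by simp)
    ⟨⟨p, t, ht, hp⟩, _, rfl⟩ (w := fun p _ _ => θ p) (fun p _ _ _ => hθ p)
    (fun p j x _ => by
      change (θ p : E 3 → ℝ) x = _
      symm
      convert Fintype.sum_ite_eq p fun _ => (θ p : E 3 → ℝ) x) (mapsTo_closure hF)
  rwa [← Nat.card_eq_fintype_card, Nat.card_coe_set_eq] at H

/-- Expand in the nodal basis; scaling an output is counted as one extra entry, hence `M + 1`. The
set `B` is the image of the closure of `D`, as it has to lie in the range of `F`. -/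
theorem emulatesSpace_S1_relu (h : IsFaceMesh ν c f 𝒯) (hF : BijOn F D f)
    {θ : vertices 𝒯 → S1 𝒯 f} (hθ : IsNodal θ)
    (hM : ∀ p, EmulatesOn {relu} L M F (closure f) (θ p)) :
    EmulatesSpace {relu} L (((vertices 𝒯).ncard * 1 * (M + 1) : ℕ) : ℝ) (𝓟 (closure D)) F
      scalarCoord (S1 𝒯 f) := by
  have := (vertices_finite h.regular.finite).fintype
  obtain ⟨t, ht⟩ := h.mesh_nonempty
  obtain ⟨p, hp⟩ := (h.regular.simplex t ht).nonempty
  have : Nonempty (vertices 𝒯) := ⟨⟨p, t, ht, hp⟩⟩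
  have H := emulatesSpace_of_sum (S := {relu}) (L := L) (M := M + 1) (F := F)
    (B := F '' closure D) (coord := scalarCoord) (l := 𝓟 (closure D)) (τ := vertices 𝒯)
    (X := S1 𝒯 f) one_pos scalarCoord_injective
    (w := fun v p _ x => (v : E 3 → ℝ) p * (θ p : E 3 → ℝ) x) (fun v p _ => ?_)
    (fun v j x _ => h.eq_sum_isNodal hθ v x) (fun v w hvw => h.S1_ext_cells (hvw.mono ?_))
    (image_subset_range _ _) (fun x hx => mem_image_of_mem F hx)
  · rwa [← Nat.card_eq_fintype_card, Nat.card_coe_set_eq] at H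
  · obtain ⟨u, h1, h2⟩ := hM p
    refine ⟨_, h1.affine_comp ((v : E 3 → ℝ) p) 0, fun x hx => ?_⟩
    rw [h2 x (image_subset_iff.2 (mapsTo_closure hF) hx), add_zero]
  · exact (h.cells_subset.trans hF.image_eq.ge).trans (image_mono subset_closure)

end IsFaceMesh

end TraceFEM

end

theorem proposition6p1 (K : ℝ) :
    ∃ (C : ℝ) (depthCPwL : ℕ), 0 < C ∧
      ∀ (Ω : Set (TraceFEM.E 3)) (𝒯 : Set (Finset (TraceFEM.E 3)))
        (ν : TraceFEM.E 3) (f : Set (TraceFEM.E 3))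
        (D : Set (TraceFEM.E 2)) (F : TraceFEM.E 2 →ᵃ[ℝ] TraceFEM.E 3)
        (𝒯f : Set (Finset (TraceFEM.E 3))),
        TraceFEM.IsPolytopalDomain Ω →
        TraceFEM.IsRegularPartition 3 𝒯 Ω →
        TraceFEM.IsFace Ω ν f →
        Set.BijOn F D f →
        𝒯f = TraceFEM.traceMesh 𝒯 f →
        TraceFEM.shapeRegularity 𝒯f ≤ K →
        -- the trace of the mesh is a regular simplicial partition of the face
        (TraceFEM.openHull '' 𝒯f = TraceFEM.traceCells 𝒯 f ∧
          TraceFEM.IsRegularPartition 2 𝒯f f) ∧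
        -- the nodal basis functions are well defined
        (∃! θ : TraceFEM.vertices 𝒯f → TraceFEM.S1 𝒯f f, TraceFEM.IsNodal θ) ∧
        -- the shape functions, with ReLU and BiSU activations
        (∀ θ : TraceFEM.vertices 𝒯f → TraceFEM.S1 𝒯f f, TraceFEM.IsNodal θ →
          TraceFEM.EmulatesFamily {TraceFEM.relu, TraceFEM.bisu} 5
            (C * Module.finrank ℝ (TraceFEM.S1 𝒯f f)) (ae (volume.restrict D)) F
            TraceFEM.scalarCoord (fun p => (θ p : TraceFEM.E 3 → ℝ))) ∧
        (∀ first : TraceFEM.edges 𝒯f → 𝒯f,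
          (∀ e : TraceFEM.edges 𝒯f, e.1 ⊆ (first e).1) →
          TraceFEM.EmulatesFamily {TraceFEM.relu, TraceFEM.bisu} 5
            (C * Module.finrank ℝ (TraceFEM.N0 𝒯f f ν)) (ae (volume.restrict D)) F
            TraceFEM.vectorCoord (fun e : TraceFEM.edges 𝒯f => TraceFEM.shapeN0 ν 𝒯f e.1 (first e).1) ∧
          TraceFEM.EmulatesFamily {TraceFEM.relu, TraceFEM.bisu} 5
            (C * Module.finrank ℝ (TraceFEM.RT0 𝒯f f ν)) (ae (volume.restrict D)) F
            TraceFEM.vectorCoord (fun e : TraceFEM.edges 𝒯f => TraceFEM.shapeRT0 𝒯f e.1 (first e).1)) ∧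
        TraceFEM.EmulatesFamily {TraceFEM.relu, TraceFEM.bisu} 3
          (C * Module.finrank ℝ (TraceFEM.S0 𝒯f)) (ae (volume.restrict D)) F
          TraceFEM.scalarCoord (fun t : 𝒯f => TraceFEM.shapeS0 t.1) ∧
        -- all functions of the spaces, with ReLU and BiSU activations
        TraceFEM.EmulatesSpace {TraceFEM.relu, TraceFEM.bisu} 5
          (C * Module.finrank ℝ (TraceFEM.S1 𝒯f f)) (ae (volume.restrict D)) F
          TraceFEM.scalarCoord (TraceFEM.S1 𝒯f f) ∧
        TraceFEM.EmulatesSpace {TraceFEM.relu, TraceFEM.bisu} 5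
          (C * Module.finrank ℝ (TraceFEM.N0 𝒯f f ν)) (ae (volume.restrict D)) F
          TraceFEM.vectorCoord (TraceFEM.N0 𝒯f f ν) ∧
        TraceFEM.EmulatesSpace {TraceFEM.relu, TraceFEM.bisu} 5
          (C * Module.finrank ℝ (TraceFEM.RT0 𝒯f f ν)) (ae (volume.restrict D)) F
          TraceFEM.vectorCoord (TraceFEM.RT0 𝒯f f ν) ∧
        TraceFEM.EmulatesSpace {TraceFEM.relu, TraceFEM.bisu} 3
          (C * Module.finrank ℝ (TraceFEM.S0 𝒯f)) (ae (volume.restrict D)) F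
          TraceFEM.scalarCoord (TraceFEM.S0 𝒯f) ∧
        -- the nodal basis functions, with ReLU activations only
        (∀ θ : TraceFEM.vertices 𝒯f → TraceFEM.S1 𝒯f f, TraceFEM.IsNodal θ →
          TraceFEM.EmulatesFamily {TraceFEM.relu} depthCPwL
            (C * Module.finrank ℝ (TraceFEM.S1 𝒯f f)) (𝓟 (closure D)) F
            TraceFEM.scalarCoord (fun p => (θ p : TraceFEM.E 3 → ℝ))) ∧
        -- all continuous piecewise affine functions, with ReLU activations only
        TraceFEM.EmulatesSpace {TraceFEM.relu} depthCPwL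
          (C * Module.finrank ℝ (TraceFEM.S1 𝒯f f)) (𝓟 (closure D)) F
          TraceFEM.scalarCoord (TraceFEM.S1 𝒯f f) := by
  obtain ⟨N, hN⟩ := TraceFEM.IsFaceMesh.exists_valence_le K
  obtain ⟨M₃, hM₃⟩ := TraceFEM.IsFaceMesh.exists_emulatesOn_indicator_const
  obtain ⟨M₅, hM₅⟩ := TraceFEM.IsFaceMesh.exists_emulatesOn_indicator_affine
  obtain ⟨L, M, hM⟩ := TraceFEM.IsFaceMesh.exists_emulatesOn_nodal N
  -- The first summand serves `S1`, where triangles are counted by `N` times the vertices; the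
  -- second serves `RT0` and `N0`; the third serves `S0`; the last serves the ReLU networks.
  refine ⟨(9 * M₅ * N + 9 * M₅ + M₃ + (M + 1) : ℕ), L, by positivity, ?_⟩
  rintro Ω 𝒯 ν f D F _ hΩ h𝒯 ⟨hν, c, x₀, hx₀, hf⟩ hF rfl hK
  have h := TraceFEM.isFaceMesh_traceMesh hν hΩ h𝒯 hf hx₀
  have hval := hN h hK
  have hS : TraceFEM.IsFaceMesh.AffineSize M₅ := hM₅
  have hC := fun t ht k => hM₃ h t ht F k
  have hcard := h.ncard_le_mul_ncard_vertices hval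
  rw [← h.finrank_S1] at hcard
  have hRT := h.ncard_le_finrank_RT0
  have hNd := h.ncard_le_finrank_N0
  have hex := h.existsUnique_isNodal
  obtain ⟨θ₀, hθ₀, -⟩ := id hex
  rw [← one_mul (Module.finrank _ _)] at hRT hNd
  have hS0 := (h.finrank_S0.symm.trans (one_mul _).symm).le
  have hV := (h.finrank_S1.symm.trans (one_mul _).symm).le
  have hNM := Nat.zero_le (M₅ * N)
  refine ⟨⟨TraceFEM.openHull_image_traceMesh hν hΩ h𝒯 hf, h.regular⟩, hex, fun θ hθ => ?_,
    fun first _ => ⟨?_, ?_⟩, ?_, ?_, ?_, ?_, ?_, fun θ hθ => ?_, ?_⟩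
  · exact (h.emulatesFamily_nodal hF hS hθ).mono (TraceFEM.cast_mul_le hcard (by linarith))
  · exact (h.emulatesFamily_shapeN0 hF hS first).mono (TraceFEM.cast_mul_le hNd (by linarith))
  · exact (h.emulatesFamily_shapeRT0 hF hS first).mono (TraceFEM.cast_mul_le hRT (by linarith))
  · exact (h.emulatesFamily_shapeS0 hF hC).mono (TraceFEM.cast_mul_le hS0 (by linarith))
  · exact (h.emulatesSpace_S1 hF hS).mono (TraceFEM.cast_mul_le hcard (by linarith))
  · exact (h.emulatesSpace_N0 hF hS).mono (TraceFEM.cast_mul_le hNd (by linarith))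
  · exact (h.emulatesSpace_RT0 hF hS).mono (TraceFEM.cast_mul_le hRT (by linarith))
  · exact (h.emulatesSpace_S0 hF hC).mono (TraceFEM.cast_mul_le hS0 (by linarith))
  · exact (h.emulatesFamily_nodal_relu hF fun p => hM h hval hθ p F).mono (TraceFEM.cast_mul_le hV (by linarith))
  · exact (h.emulatesSpace_S1_relu hF hθ₀ fun p => hM h hval hθ₀ p F).mono (TraceFEM.cast_mul_le hV (by linarith))
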